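/- Let $\Bbbk$ be a field of characteristic $p>0$. Write (∗) for the following standing assumptions on a symmetric monoidal category $(\mathbf C,\otimes,\mathbb 1,\gamma)$: $\mathbf C$ is $\Bbbk$-linear abelian with $\mathbb 1\neq 0$, and $-\otimes-$ is $\Bbbk$-linear and right exact in both variables. A tensor category over $\Bbbk$ is an essentially small symmetric monoidal category $\mathbf T$ satisfying (∗) such that the canonical map $\Bbbk\to\mathrm{End}(\mathbb 1)$ is an isomorphism and every object has a dual. A tensor functor between categories satisfying (∗) is a right exact $\Bbbk$-linear (strong) symmetric monoidal functor. A tensor category $\mathbf T$ is locally semisimple if there exist a symmetric monoidal category $\mathbf C$ (with small morphism sets) satisfying (∗) and a tensor functor $F:\mathbf T\to\mathbf C$ which maps every short exact sequence in $\mathbf T$ to a split short exact sequence. For an object $X$ and $n\in\mathbb N$, let $\mathrm{Sym}^nX$ be the cokernel of the morphism $\bigoplus_{i=1}^{n-1}X^{\otimes n}\to X^{\otimes n}$ with components $\mathrm{id}_{X^{\otimes (i-1)}}\otimes(\gamma_{X,X}-1)\otimes\mathrm{id}_{X^{\otimes (n-i-1)}}$, and for $\alpha:\mathbb 1\to X$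 let $\alpha^n:\mathbb 1\to\mathrm{Sym}^nX$ be the composite $\mathbb 1\cong\mathbb 1^{\otimes n}\xrightarrow{\alpha^{\otimes n}}X^{\otimes n}\twoheadrightarrow\mathrm{Sym}^nX$. **Theorem.** A tensor category $\mathbf T$ over $\Bbbk$ is locally semisimple if and only if for every object $X$ of $\mathbf T$ and every non-zero morphism $\alpha:\mathbb 1\to X$, the morphism $\alpha^p:\mathbb 1\to\mathrm{Sym}^pX$ is non-zero. -/

import Mathlib

open CategoryTheory MonoidalCategory Limits

universe w v u u₁ v₁ u₂ v₂

noncomputable section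

/-- The standing assumptions on a `k`-linear abelian symmetric monoidal category `C`:
the tensor product is `k`-linear and right exact in both variables, and the unit is nonzero. -/
class IsLinearSymmetricMonoidal (k : Type w) [Field k] (C : Type u) [Category.{v} C]
    [MonoidalCategory C] [SymmetricCategory C] [Abelian C] [Linear k C] : Prop
    extends MonoidalPreadditive C, MonoidalLinear k C where
  /-- `X ⊗ -` is right exact. -/
  rightExact_tensorLeft (X : C) : PreservesFiniteColimits (tensorLeft X)
  /-- `- ⊗ X` is right exact. -/
  rightExact_tensorRight (X : C) : PreservesFiniteColimits (tensorRight X)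
  /-- The tensor unit is nonzero. -/
  not_isZero_unit : ¬ IsZero (𝟙_ C)

/-- A tensor category over `k`: an essentially small category as above, with `End(𝟙) = k`, in which
every object is dualisable. -/
class IsTensorCategory (k : Type w) [Field k] (T : Type u) [Category.{v} T]
    [MonoidalCategory T] [SymmetricCategory T] [Abelian T] [Linear k T] : Prop
    extends IsLinearSymmetricMonoidal k T where
  /-- `T` is equivalent to a small category. -/
  essentiallySmall : EssentiallySmall.{v} T
  /-- The canonical map `k → End(𝟙)` is an isomorphism. -/
  bijective_algebraMap : Function.Bijective (algebraMap k (End (𝟙_ T)))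
  /-- Every object `X` has a dual `Y`, with `𝟙 ⟶ X ⊗ Y` and `Y ⊗ X ⟶ 𝟙` satisfying the two snake
  relations. -/
  dualisable (X : T) : ∃ Y : T, Nonempty (ExactPairing X Y)

/-- A (strong) symmetric monoidal functor `F` is a tensor functor if it is `k`-linear and right
exact. -/
class IsTensorFunctor (k : Type w) [Field k] {C : Type u₁} [Category.{v₁} C]
    [MonoidalCategory C] [SymmetricCategory C] [Abelian C] [Linear k C]
    {D : Type u₂} [Category.{v₂} D]
    [MonoidalCategory D] [SymmetricCategory D] [Abelian D] [Linear k D]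
    (F : C ⥤ D) [F.Braided] : Prop extends F.Additive, F.Linear k where
  /-- `F` is right exact. -/
  rightExact : PreservesFiniteColimits F

/-- `T` is locally semisimple: some tensor functor `F : T ⥤ C`, to a `k`-linear abelian symmetric
monoidal category `C` with nonzero unit and `k`-linear right exact tensor product, maps every short
exact sequence to a split short exact sequence. As `T` is small up to equivalence, `C` ranges over
the categories with small morphism sets, and a possibly large collection of objects. -/
def IsLocallySemisimple (k : Type w) [Field k] (T : Type u) [Category.{v} T]
    [MonoidalCategory T] [SymmetricCategory T] [Abelian T] [Linear k T] : Prop :=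
  ∃ (C : Type (max u (v + 1))) (_ : Category.{v} C) (_ : MonoidalCategory C)
    (_ : SymmetricCategory C) (_ : Abelian C) (_ : Linear k C)
    (_ : IsLinearSymmetricMonoidal k C)
    (F : T ⥤ C) (_ : F.Braided) (_ : IsTensorFunctor k F),
    ∀ S : ShortComplex T, S.ShortExact → Nonempty (S.map F).Splitting

section Powers

variable {C : Type u} [Category.{v} C] [MonoidalCategory C]

/-- The tensor power `⊗ⁿ X`, bracketed as `X ⊗ (X ⊗ (⋯ ⊗ 𝟙))`. -/
def tensorPow (X : C) : ℕ → C
  | 0 => 𝟙_ C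
  | n + 1 => X ⊗ tensorPow X n

/-- The morphism `⊗ⁿ α : 𝟙 ≅ ⊗ⁿ 𝟙 ⟶ ⊗ⁿ X` attached to `α : 𝟙 ⟶ X`. -/
def tensorPowHom {X : C} (α : 𝟙_ C ⟶ X) : (n : ℕ) → (𝟙_ C ⟶ tensorPow X n)
  | 0 => 𝟙 (𝟙_ C)
  | n + 1 => (λ_ (𝟙_ C)).inv ≫ (α ⊗ₘ tensorPowHom α n)

/-- The braiding of the (zero-based) `i`-th and `(i+1)`-st factors of `⊗ⁿ X`, for `i + 1 < n`
(and the identity for other `i`). -/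
def adjacentSwap [BraidedCategory C] (X : C) :
    (n i : ℕ) → (tensorPow X n ⟶ tensorPow X n)
  | 0, _ => 𝟙 _
  | 1, _ => 𝟙 _
  | n + 2, 0 => (α_ X X (tensorPow X n)).inv ≫ (β_ X X).hom ▷ tensorPow X n ≫
      (α_ X X (tensorPow X n)).hom
  | n + 2, i + 1 => X ◁ adjacentSwap X (n + 1) i

attribute [local instance] Abelian.hasFiniteBiproducts

variable [SymmetricCategory C] [Abelian C]

/-- The morphism `⨁ ⊗ⁿ X ⟶ ⊗ⁿ X`, over the `n - 1` pairs of adjacent factors, whose components are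
the braidings of these pairs minus the identity. -/
def symRelations (X : C) (n : ℕ) : (⨁ fun _ : Fin (n - 1) => tensorPow X n) ⟶ tensorPow X n :=
  biproduct.desc fun i => adjacentSwap X n i - 𝟙 (tensorPow X n)

/-- The symmetric power `Symⁿ X`, the coinvariants of the symmetric group on `⊗ⁿ X`. -/
def symPow (X : C) (n : ℕ) : C := cokernel (symRelations X n)

/-- The morphism `αⁿ : 𝟙 ⟶ Symⁿ X`, the composite of `⊗ⁿ α` and the quotient map
`⊗ⁿ X ⟶ Symⁿ X`. -/
def symPowHom {X : C} (α : 𝟙_ C ⟶ X) (n : ℕ) : 𝟙_ C ⟶ symPow X n :=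
  tensorPowHom α n ≫ cokernel.π (symRelations X n)

end Powers

end

/-! Suppose `F` splits all short exact sequences. A nonzero point `α : 𝟙 ⟶ X` is monic because `𝟙`
is simple, so `F α` has a retraction `r`. The form `r ⊗ ⋯ ⊗ r` is symmetric and takes the value `1`
on `(F α)ⁿ`. A right exact `F` respects symmetric powers, so `αⁿ ≠ 0` for every `n`
(`IsLocallySemisimple.symPowHom_ne_zero`).

Conversely, the condition in degree `p` is bootstrapped to all degrees
(`Slots.symPowHom_ne_zero_of_prime`). Let `A` be the sum of the `Symⁱ X` for `i ≤ p`, on which `X`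
acts by multiplication, and let `v` be the point of `A` obtained from the unit by acting `p` times
with `α`. It is nonzero because its component in degree `p` is `αᵖ`. Distribute `mp` letters into
`m` blocks of size `p`, let each block act on the unit of its own copy of `A`, and sum over all
partitions into such blocks. This gives a symmetric morphism to `Symᵐ A` which sends `α^{mp}` to `N
vᵐ`, where `N` is the number of partitions and is `1` modulo `p` (`Labeling.natCast_card_part`).
Hence `vᵐ ≠ 0` implies `α^{mp} ≠ 0`. Induction settles the powers of `p`, and a vanishing power
would force all higher ones to vanish.

Once all powers are nonzero, `T` is enlarged so that every nonzero point acquires a retraction.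
Pointed objects form a directed preorder. Let `a Z` consist of germs of families of points of `Z ⊗
Symⁿ X`, compatible with multiplication by `α`, for large `(X, α)` and then large `n`. Mapping a
pointed object to a larger one and multiplying gives an operator `a (Z ⊗ X) ⟶ a Z` retracting `a (Z
⊗ α)` (`PointedObj.map_α_ret`). These operators commute since symmetric powers are commutative, so
their bicommutant is a symmetric monoidal category with the objects of `T`; its unit is nonzero
because no `αⁿ` vanishes.

By rigidity every epimorphism acquires a section after tensoring with a nonzero point
(`exists_section`), so retractions of points split all short exact sequences (`nonempty_splitting`).
Finally the additive category so obtained is embedded in an abelian one with right exact tensor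
product, by formally adjoining kernels and then cokernels (`Envelope`). Split sequences stay split,
and an additive functor that splits everything is right exact. -/

noncomputable section

/-! ### Formal cokernels over an additive category, abelian when that category has kernels. -/

/-- Objects of the Freyd category of `K`: formal cokernels of morphisms of `K`. -/
structure Freyd (k : Type u₁) (K : Type u) [Category.{v} K] : Type (max w u v) where
  /-- The object of relations. -/
  rel : K
  /-- The object of generators. -/
  gen : K
  /-- The presenting morphism. -/
  d : rel ⟶ gen
  /-- A universe lift. -/
  pad : PUnit.{w + 1} := PUnit.unit

namespace Freyd

section Basic

variable {k : Type u₁} [Field k] {K : Type u} [Category.{v} K] [Preadditive K] [Linear k K]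

/-- The morphisms that vanish in the formal cokernel. -/
def null (Q : Freyd.{w} k K) (Z : K) : Submodule k (Z ⟶ Q.gen) :=
  LinearMap.range (Linear.rightComp k Z Q.d)

lemma mem_null {Q : Freyd.{w} k K} {Z : K} {f : Z ⟶ Q.gen} :
    f ∈ null Q Z ↔ ∃ h, h ≫ Q.d = f := Iff.rfl

lemma comp_mem_null {Q : Freyd.{w} k K} {Y Z : K} (e : Y ⟶ Z) {f : Z ⟶ Q.gen}
    (hf : f ∈ null Q Z) : e ≫ f ∈ null Q Y := by
  obtain ⟨h, rfl⟩ := mem_null.1 hf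
  exact mem_null.2 ⟨e ≫ h, by simp⟩

/-- The morphisms of generators compatible with the relations. -/
def lifts (P Q : Freyd.{w} k K) : Submodule k (P.gen ⟶ Q.gen) :=
  (null Q P.rel).comap (Linear.leftComp k Q.gen P.d)

lemma mem_lifts {P Q : Freyd.{w} k K} {f : P.gen ⟶ Q.gen} :
    f ∈ lifts P Q ↔ P.d ≫ f ∈ null Q P.rel := Iff.rfl

lemma null_comp {P Q : Freyd.{w} k K} {Z : K} {f : Z ⟶ P.gen} (hf : f ∈ null P Z)
    {g : P.gen ⟶ Q.gen} (hg : g ∈ lifts P Q) : f ≫ g ∈ null Q Z := by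
  obtain ⟨h, rfl⟩ := mem_null.1 hf
  rw [Category.assoc]
  exact comp_mem_null h (mem_lifts.1 hg)

/-- Morphisms of formal cokernels. -/
def Hom (P Q : Freyd.{w} k K) : Type v :=
  ↥(lifts P Q) ⧸ (null Q P.gen).comap (lifts P Q).subtype

instance (P Q : Freyd.{w} k K) : AddCommGroup (Hom P Q) :=
  inferInstanceAs (AddCommGroup (_ ⧸ (null Q P.gen).comap (lifts P Q).subtype))

instance (P Q : Freyd.{w} k K) : Module k (Hom P Q) :=
  inferInstanceAs (Module k (_ ⧸ (null Q P.gen).comap (lifts P Q).subtype))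

/-- The class of a morphism of generators. -/
def Hom.mk {P Q : Freyd.{w} k K} (f : P.gen ⟶ Q.gen) (hf : f ∈ lifts P Q) : Hom P Q :=
  Submodule.Quotient.mk ⟨f, hf⟩

lemma Hom.mk_eq_iff {P Q : Freyd.{w} k K} {f g : P.gen ⟶ Q.gen} {hf hg} :
    (Hom.mk f hf : Hom P Q) = Hom.mk g hg ↔ f - g ∈ null Q P.gen :=
  Submodule.Quotient.eq _

lemma Hom.exists_rep {P Q : Freyd.{w} k K} (f : Hom P Q) : ∃ f₀ hf, Hom.mk f₀ hf = f := by
  obtain ⟨⟨x, hx⟩, rfl⟩ := Submodule.Quotient.mk_surjective _ f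
  exact ⟨x, hx, rfl⟩

/-- A chosen representative. -/
def Hom.rep {P Q : Freyd.{w} k K} (f : Hom P Q) : P.gen ⟶ Q.gen := f.exists_rep.choose

lemma Hom.rep_mem {P Q : Freyd.{w} k K} (f : Hom P Q) : f.rep ∈ lifts P Q :=
  f.exists_rep.choose_spec.choose

lemma Hom.mk_rep {P Q : Freyd.{w} k K} (f : Hom P Q) : Hom.mk f.rep f.rep_mem = f :=
  f.exists_rep.choose_spec.choose_spec

lemma id_mem_lifts (P : Freyd.{w} k K) : 𝟙 P.gen ∈ lifts P P :=
  mem_lifts.2 (mem_null.2 ⟨𝟙 _, by simp⟩)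

lemma comp_mem_lifts {P Q R : Freyd.{w} k K} {f : P.gen ⟶ Q.gen} (hf : f ∈ lifts P Q)
    {g : Q.gen ⟶ R.gen} (hg : g ∈ lifts Q R) : f ≫ g ∈ lifts P R := by
  rw [mem_lifts, ← Category.assoc]
  exact null_comp hf hg

instance : CategoryStruct.{v} (Freyd.{w} k K) where
  Hom P Q := Hom P Q
  id P := Hom.mk (𝟙 _) (id_mem_lifts P)
  comp f g := Hom.mk (f.rep ≫ g.rep) (comp_mem_lifts f.rep_mem g.rep_mem)

/-- The morphism of formal cokernels represented by a morphism of generators. -/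
def cls {P Q : Freyd.{w} k K} (f : P.gen ⟶ Q.gen) (hf : f ∈ lifts P Q) : P ⟶ Q := Hom.mk f hf

lemma cls_eq_iff {P Q : Freyd.{w} k K} {f g : P.gen ⟶ Q.gen} {hf hg} :
    (cls f hf : P ⟶ Q) = cls g hg ↔ f - g ∈ null Q P.gen := Hom.mk_eq_iff

lemma exists_cls {P Q : Freyd.{w} k K} (f : P ⟶ Q) : ∃ f₀ hf, cls f₀ hf = f := Hom.exists_rep f

lemma cls_comp_cls {P Q R : Freyd.{w} k K} {f : P.gen ⟶ Q.gen} (hf : f ∈ lifts P Q)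
    {g : Q.gen ⟶ R.gen} (hg : g ∈ lifts Q R) :
    cls f hf ≫ cls g hg = cls (f ≫ g) (comp_mem_lifts hf hg) := by
  refine cls_eq_iff.2 ?_
  have h1 := Hom.mk_eq_iff.1 (Hom.mk_rep (Hom.mk f hf))
  have h2 := Hom.mk_eq_iff.1 (Hom.mk_rep (Hom.mk g hg))
  have h3 := (null R P.gen).add_mem (null_comp h1 (Hom.rep_mem (Hom.mk g hg)))
    (comp_mem_null f h2)
  convert h3 using 1
  simp [cls]

lemma cls_id (P : Freyd.{w} k K) : cls (𝟙 P.gen) (id_mem_lifts P) = 𝟙 P := rfl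

instance : Category.{v} (Freyd.{w} k K) where
  id_comp f := by
    obtain ⟨f, hf, rfl⟩ := exists_cls f
    rw [← cls_id, cls_comp_cls]
    simp only [Category.id_comp]
  comp_id f := by
    obtain ⟨f, hf, rfl⟩ := exists_cls f
    rw [← cls_id, cls_comp_cls]
    simp only [Category.comp_id]
  assoc f g h := by
    obtain ⟨f, hf, rfl⟩ := exists_cls f
    obtain ⟨g, hg, rfl⟩ := exists_cls g
    obtain ⟨h, hh, rfl⟩ := exists_cls h
    simp only [cls_comp_cls, Category.assoc]

instance (P Q : Freyd.{w} k K) : AddCommGroup (P ⟶ Q) := inferInstanceAs (AddCommGroup (Hom P Q))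

instance (P Q : Freyd.{w} k K) : Module k (P ⟶ Q) := inferInstanceAs (Module k (Hom P Q))

lemma cls_add {P Q : Freyd.{w} k K} {f g : P.gen ⟶ Q.gen} (hf hg) :
    (cls f hf + cls g hg : P ⟶ Q) = cls (f + g) ((lifts P Q).add_mem hf hg) := rfl

lemma smul_cls {P Q : Freyd.{w} k K} (c : k) {f : P.gen ⟶ Q.gen} (hf) :
    (c • cls f hf : P ⟶ Q) = cls (c • f) ((lifts P Q).smul_mem c hf) := rfl

lemma cls_zero (P Q : Freyd.{w} k K) : (cls 0 (lifts P Q).zero_mem : P ⟶ Q) = 0 := rfl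

lemma cls_eq_zero_iff {P Q : Freyd.{w} k K} {f : P.gen ⟶ Q.gen} {hf} :
    (cls f hf : P ⟶ Q) = 0 ↔ f ∈ null Q P.gen := by
  rw [← cls_zero, cls_eq_iff, sub_zero]

instance : Preadditive (Freyd.{w} k K) where
  add_comp _ _ _ f g h := by
    obtain ⟨f, hf, rfl⟩ := exists_cls f
    obtain ⟨g, hg, rfl⟩ := exists_cls g
    obtain ⟨h, hh, rfl⟩ := exists_cls h
    simp only [cls_comp_cls, cls_add, Preadditive.add_comp]
  comp_add _ _ _ f g h := by
    obtain ⟨f, hf, rfl⟩ := exists_cls f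
    obtain ⟨g, hg, rfl⟩ := exists_cls g
    obtain ⟨h, hh, rfl⟩ := exists_cls h
    simp only [cls_comp_cls, cls_add, Preadditive.comp_add]

instance : Linear k (Freyd.{w} k K) where
  smul_comp _ _ _ c f g := by
    obtain ⟨f, hf, rfl⟩ := exists_cls f
    obtain ⟨g, hg, rfl⟩ := exists_cls g
    simp only [cls_comp_cls, smul_cls, Linear.smul_comp]
  comp_smul _ _ _ f c g := by
    obtain ⟨f, hf, rfl⟩ := exists_cls f
    obtain ⟨g, hg, rfl⟩ := exists_cls g
    simp only [cls_comp_cls, smul_cls, Linear.comp_smul]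

end Basic

section Abelian

variable {k : Type u₁} [Field k] {K : Type u} [Category.{v} K] [Preadditive K] [Linear k K]
  [HasZeroObject K] [HasBinaryBiproducts K]

lemma lifts_of_null_desc {A B : K} {a b : Freyd.{w} k K} {f : a.gen ⟶ b.gen}
    (e : a.rel ≅ A ⊞ B) (h₁ : biprod.inl ≫ e.inv ≫ a.d ≫ f ∈ null b A)
    (h₂ : biprod.inr ≫ e.inv ≫ a.d ≫ f ∈ null b B) : f ∈ lifts a b := by
  obtain ⟨h, hh⟩ := mem_null.1 h₁
  obtain ⟨h', hh'⟩ := mem_null.1 h₂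
  refine mem_lifts.2 (mem_null.2 ⟨e.hom ≫ biprod.desc h h', ?_⟩)
  rw [Category.assoc, ← Iso.eq_inv_comp]
  ext <;> simp [hh, hh']

/-- The cokernel of the morphism represented by `f`. -/
abbrev coker {P Q : Freyd.{w} k K} (f : P.gen ⟶ Q.gen) : Freyd.{w} k K where
  rel := P.gen ⊞ Q.rel
  gen := Q.gen
  d := biprod.desc f Q.d

lemma mem_null_coker {P Q : Freyd.{w} k K} (f : P.gen ⟶ Q.gen) {Z : K} {g : Z ⟶ Q.gen} :
    g ∈ null (coker f) Z ↔ ∃ s, g - s ≫ f ∈ null Q Z := by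
  constructor
  · rintro ⟨h, rfl⟩
    refine ⟨h ≫ biprod.fst, mem_null.2 ⟨h ≫ biprod.snd, ?_⟩⟩
    simp [coker, biprod.desc_eq]
  · rintro ⟨s, t, ht⟩
    refine mem_null.2 ⟨biprod.lift s t, ?_⟩
    simp only [Linear.rightComp_apply] at ht
    simp [coker, ht]

lemma lifts_coker {P Q R : Freyd.{w} k K} (f : P.gen ⟶ Q.gen) {g : Q.gen ⟶ R.gen} :
    g ∈ lifts (coker f) R ↔ g ∈ lifts Q R ∧ f ≫ g ∈ null R P.gen := by
  constructor
  · intro h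
    refine ⟨mem_lifts.2 ?_, ?_⟩
    · simpa [coker] using comp_mem_null (biprod.inr : _ ⟶ P.gen ⊞ Q.rel) (mem_lifts.1 h)
    · simpa [coker] using comp_mem_null (biprod.inl : _ ⟶ P.gen ⊞ Q.rel) (mem_lifts.1 h)
  · rintro ⟨h₁, h₂⟩
    refine lifts_of_null_desc (Iso.refl _) ?_ ?_
    · simpa [coker] using h₂
    · simpa [coker] using mem_lifts.1 h₁

/-- The projection to the cokernel. -/
def cokerπ {P Q : Freyd.{w} k K} (f : P.gen ⟶ Q.gen) : Q ⟶ coker f :=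
  cls (𝟙 _) (mem_lifts.2 (mem_null.2 ⟨biprod.inr, by simp [coker]⟩))

lemma cls_comp_cokerπ {P Q : Freyd.{w} k K} (f : P.gen ⟶ Q.gen) (hf : f ∈ lifts P Q) :
    cls f hf ≫ cokerπ f = 0 := by
  rw [cokerπ, cls_comp_cls, cls_eq_zero_iff, mem_null_coker]
  exact ⟨𝟙 _, by simp [coker]⟩

instance {P Q : Freyd.{w} k K} (f : P.gen ⟶ Q.gen) : Epi (cokerπ f) := by
  refine Preadditive.epi_of_cancel_zero _ fun {R} g hg => ?_
  obtain ⟨g, hg', rfl⟩ := exists_cls g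
  rw [cokerπ, cls_comp_cls, cls_eq_zero_iff] at hg
  refine cls_eq_zero_iff.2 ?_
  simpa using hg

/-- `coker f` is a cokernel. -/
def cokerIsColimit {P Q : Freyd.{w} k K} (f : P.gen ⟶ Q.gen) (hf : f ∈ lifts P Q) :
    IsColimit (CokernelCofork.ofπ (cokerπ f) (cls_comp_cokerπ f hf)) :=
  Cofork.IsColimit.mk' _ fun s => by
    have hs : cls f hf ≫ s.π = 0 := CokernelCofork.condition s
    have h : ∃ l : coker f ⟶ s.pt, cokerπ f ≫ l = s.π := by
      generalize s.π = g at hs ⊢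
      obtain ⟨g, hg, rfl⟩ := exists_cls g
      rw [cls_comp_cls, cls_eq_zero_iff] at hs
      exact ⟨cls g ((lifts_coker f).2 ⟨hg, hs⟩), by simp [cokerπ, cls_comp_cls]⟩
    refine ⟨h.choose, h.choose_spec, fun {m} hm => ?_⟩
    rw [← cancel_epi (cokerπ f)]
    exact hm.trans h.choose_spec.symm

instance : HasCokernels (Freyd.{w} k K) where
  has_colimit {P Q} f := by
    obtain ⟨f, hf, rfl⟩ := exists_cls f
    exact ⟨⟨⟨_, cokerIsColimit f hf⟩⟩⟩

open ZeroObject in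
instance : HasZeroObject (Freyd.{w} k K) := by
  refine ⟨⟨0, 0, 0, ⟨⟩⟩, ⟨fun Q => ⟨⟨⟨0⟩, fun f => ?_⟩⟩, fun Q => ⟨⟨⟨0⟩, fun f => ?_⟩⟩⟩⟩
  · obtain ⟨f, hf, rfl⟩ := exists_cls f
    exact cls_eq_zero_iff.2 (by rw [(isZero_zero K).eq_of_src f 0]; exact Submodule.zero_mem _)
  · obtain ⟨f, hf, rfl⟩ := exists_cls f
    exact cls_eq_zero_iff.2 (by rw [(isZero_zero K).eq_of_tgt f 0]; exact Submodule.zero_mem _)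

/-- The direct sum of formal cokernels. -/
abbrev sum (P Q : Freyd.{w} k K) : Freyd.{w} k K where
  rel := P.rel ⊞ Q.rel
  gen := P.gen ⊞ Q.gen
  d := biprod.map P.d Q.d

/-- The direct sum is a biproduct. -/
def sumBicone (P Q : Freyd.{w} k K) : BinaryBicone P Q where
  pt := sum P Q
  fst := cls biprod.fst (mem_lifts.2 (mem_null.2 ⟨biprod.fst, by simp [sum]⟩))
  snd := cls biprod.snd (mem_lifts.2 (mem_null.2 ⟨biprod.snd, by simp [sum]⟩))
  inl := cls biprod.inl (mem_lifts.2 (mem_null.2 ⟨biprod.inl, by simp [sum]⟩))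
  inr := cls biprod.inr (mem_lifts.2 (mem_null.2 ⟨biprod.inr, by simp [sum]⟩))
  inl_fst := by simp only [cls_comp_cls, biprod.inl_fst]; rfl
  inl_snd := by simp only [cls_comp_cls, biprod.inl_snd]; rfl
  inr_fst := by simp only [cls_comp_cls, biprod.inr_fst]; rfl
  inr_snd := by simp only [cls_comp_cls, biprod.inr_snd]; rfl

instance : HasBinaryBiproducts (Freyd.{w} k K) where
  has_binary_biproduct P Q := ⟨⟨⟨sumBicone P Q, isBinaryBilimitOfTotal _ (by
    simp only [sumBicone, cls_comp_cls]
    exact (cls_add _ _).trans (cls_eq_iff.2 (by simp)))⟩⟩⟩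

instance : HasFiniteBiproducts (Freyd.{w} k K) :=
  have : HasFiniteProducts (Freyd.{w} k K) := hasFiniteProducts_of_has_binary_and_terminal
  HasFiniteBiproducts.of_hasFiniteProducts

section Kernels

variable [HasKernels K]

/-- The generators of the kernel: pairs of a generator of the source and a relation of the target
with the same image. -/
abbrev kerGen {P Q : Freyd.{w} k K} (f : P.gen ⟶ Q.gen) : K := kernel (biprod.desc f (-Q.d))

/-- The inclusion of the generators of the kernel. -/
def kerGenι {P Q : Freyd.{w} k K} (f : P.gen ⟶ Q.gen) : kerGen f ⟶ P.gen :=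
  kernel.ι (biprod.desc f (-Q.d)) ≫ biprod.fst

lemma kerGenι_comp_mem {P Q : Freyd.{w} k K} (f : P.gen ⟶ Q.gen) :
    kerGenι f ≫ f ∈ null Q (kerGen f) := by
  refine mem_null.2 ⟨kernel.ι (biprod.desc f (-Q.d)) ≫ biprod.snd, ?_⟩
  have := kernel.condition (biprod.desc f (-Q.d))
  simp only [biprod.desc_eq, Preadditive.comp_add, Preadditive.comp_neg] at this
  simpa [kerGenι, add_neg_eq_zero] using (add_neg_eq_zero.1 this).symm

/-- Only existence holds: the lift depends on the relation chosen to kill `z ≫ f`. The choice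
disappears modulo the relations of `ker f`. -/
lemma exists_kerGen_lift {P Q : Freyd.{w} k K} (f : P.gen ⟶ Q.gen) {Z : K} (z : Z ⟶ P.gen)
    (hz : z ≫ f ∈ null Q Z) : ∃ l, l ≫ kerGenι f = z := by
  obtain ⟨h, hh⟩ := mem_null.1 hz
  exact ⟨kernel.lift _ (biprod.lift z h) (by simp [hh]), by simp [kerGenι]⟩

/-- The kernel of the morphism represented by `f`. -/
abbrev ker {P Q : Freyd.{w} k K} (f : P.gen ⟶ Q.gen) : Freyd.{w} k K where
  -- The source presentation is a dummy: `kerGen` uses only the generators of its source.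
  rel := kerGen (P := ⟨P.rel, kerGen f, 0, ⟨⟩⟩) (Q := P) (kerGenι f)
  gen := kerGen f
  d := kerGenι (P := ⟨P.rel, kerGen f, 0, ⟨⟩⟩) (Q := P) (kerGenι f)

/-- The relations of `ker f` are a second application of `kerGen`, made for this purpose: a
generator is a relation as soon as it becomes one in `P`. This is what makes `kerι f` monic. -/
lemma mem_null_ker {P Q : Freyd.{w} k K} (f : P.gen ⟶ Q.gen) {Z : K} {g : Z ⟶ kerGen f} :
    g ∈ null (ker f) Z ↔ g ≫ kerGenι f ∈ null P Z := by
  constructor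
  · rintro ⟨h, rfl⟩
    rw [Linear.rightComp_apply, Category.assoc]
    exact comp_mem_null h (kerGenι_comp_mem (P := ⟨P.rel, kerGen f, 0, ⟨⟩⟩) (kerGenι f))
  · intro h
    exact mem_null.2 (exists_kerGen_lift (P := ⟨P.rel, kerGen f, 0, ⟨⟩⟩) (kerGenι f) g h)

lemma kerGenι_mem_lifts {P Q : Freyd.{w} k K} (f : P.gen ⟶ Q.gen) :
    (show (ker f).gen ⟶ P.gen from kerGenι f) ∈ lifts (ker f) P :=
  mem_lifts.2 ((mem_null_ker f).1 (mem_null.2 ⟨𝟙 _, by simp⟩))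

/-- The inclusion of the kernel. -/
def kerι {P Q : Freyd.{w} k K} (f : P.gen ⟶ Q.gen) : ker f ⟶ P :=
  cls (kerGenι f) (kerGenι_mem_lifts f)

instance {P Q : Freyd.{w} k K} (f : P.gen ⟶ Q.gen) : Mono (kerι f) := by
  refine Preadditive.mono_of_cancel_zero _ fun {R} g hg => ?_
  obtain ⟨g, hg', rfl⟩ := exists_cls g
  rw [kerι, cls_comp_cls, cls_eq_zero_iff] at hg
  exact cls_eq_zero_iff.2 ((mem_null_ker f).2 hg)

lemma kerι_comp_cls {P Q : Freyd.{w} k K} (f : P.gen ⟶ Q.gen) (hf : f ∈ lifts P Q) :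
    kerι f ≫ cls f hf = 0 := by
  rw [kerι, cls_comp_cls, cls_eq_zero_iff]
  exact kerGenι_comp_mem f

lemma exists_ker_lift {P Q R : Freyd.{w} k K} (f : P.gen ⟶ Q.gen) (hf : f ∈ lifts P Q)
    (g : R ⟶ P) (hg : g ≫ cls f hf = 0) : ∃ l, l ≫ kerι f = g := by
  obtain ⟨g, hg', rfl⟩ := exists_cls g
  rw [cls_comp_cls, cls_eq_zero_iff] at hg
  obtain ⟨l, hl⟩ := exists_kerGen_lift f g hg
  have : (show R.gen ⟶ (ker f).gen from l) ∈ lifts R (ker f) := by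
    refine mem_lifts.2 ((mem_null_ker f).2 ?_)
    rw [Category.assoc, hl]
    exact hg'
  exact ⟨cls l this, by rw [kerι, cls_comp_cls]; subst hl; rfl⟩

/-- `ker f` is a kernel. -/
def kerIsLimit {P Q : Freyd.{w} k K} (f : P.gen ⟶ Q.gen) (hf : f ∈ lifts P Q) :
    IsLimit (KernelFork.ofι (kerι f) (kerι_comp_cls f hf)) :=
  KernelFork.IsLimit.ofι' _ _ fun g hg =>
    ⟨(exists_ker_lift f hf g hg).choose, (exists_ker_lift f hf g hg).choose_spec⟩

instance : HasKernels (Freyd.{w} k K) where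
  has_limit {P Q} f := by
    obtain ⟨f, hf, rfl⟩ := exists_cls f
    exact ⟨⟨⟨_, kerIsLimit f hf⟩⟩⟩

instance : IsNormalMonoCategory (Freyd.{w} k K) where
  normalMonoOfMono {P Q} f' hf' := by
    obtain ⟨f, hf, rfl⟩ := exists_cls f'
    -- Monicity in terms of generators: the kernel inclusion is zero, so `f` reflects relations.
    have key : ∀ {Z : K} (z : Z ⟶ P.gen), z ≫ f ∈ null Q Z → z ∈ null P Z := by
      intro Z z hz
      have h0 : kerι f = 0 := (cancel_mono (cls f hf)).1 (by rw [kerι_comp_cls, zero_comp])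
      obtain ⟨l, rfl⟩ := exists_kerGen_lift f z hz
      exact comp_mem_null l (cls_eq_zero_iff.1 h0)
    refine ⟨⟨coker f, cokerπ f, cls_comp_cokerπ f hf, KernelFork.IsLimit.ofι' _ _ fun {R} g hg =>
      Classical.choice ?_⟩⟩
    obtain ⟨g, hg', rfl⟩ := exists_cls g
    rw [cokerπ, cls_comp_cls, cls_eq_zero_iff, mem_null_coker] at hg
    obtain ⟨a, ha⟩ := hg
    rw [Category.comp_id] at ha
    -- The factorisation `a` exists on generators only; it respects relations because `f` reflects
    -- them.
    have ha' : a ∈ lifts R P := by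
      refine mem_lifts.2 (key _ ?_)
      have := (null Q R.rel).sub_mem (mem_lifts.1 hg') (comp_mem_null R.d ha)
      simpa using this
    exact ⟨cls a ha', by rw [cls_comp_cls, cls_eq_iff, ← Submodule.neg_mem_iff, neg_sub]; exact ha⟩

instance : IsNormalEpiCategory (Freyd.{w} k K) where
  normalEpiOfEpi {P Q} f' hf' := by
    obtain ⟨f, hf, rfl⟩ := exists_cls f'
    -- The cokernel of an epimorphism is zero, so on generators `f` has a section modulo the
    -- relations of `Q`.
    obtain ⟨s, h, hs⟩ : ∃ (s : Q.gen ⟶ P.gen) (h : Q.gen ⟶ Q.rel), s ≫ f = 𝟙 _ - h ≫ Q.d := by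
      have h0 : cokerπ f = 0 := (cancel_epi (cls f hf)).1 (by rw [cls_comp_cokerπ, comp_zero])
      rw [cokerπ, cls_eq_zero_iff, mem_null_coker] at h0
      obtain ⟨s, h, hh⟩ := h0
      refine ⟨s, h, ?_⟩
      rw [Linear.rightComp_apply] at hh
      rw [hh]
      simp [coker]
    refine ⟨⟨ker f, kerι f, kerι_comp_cls f hf, CokernelCofork.IsColimit.ofπ' _ _ fun {R} g hg =>
      Classical.choice ?_⟩⟩
    obtain ⟨g, hg', rfl⟩ := exists_cls g
    rw [kerι, cls_comp_cls, cls_eq_zero_iff] at hg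
    have key : ∀ {Z : K} (z : Z ⟶ P.gen), z ≫ f ∈ null Q Z → z ≫ g ∈ null R Z := by
      intro Z z hz
      obtain ⟨l, rfl⟩ := exists_kerGen_lift f z hz
      rw [Category.assoc]
      exact comp_mem_null l hg
    -- The section `s` need not respect relations, but its composite with `g` does, since `g` kills
    -- the kernel of `f`.
    have hsg : s ≫ g ∈ lifts Q R := by
      rw [mem_lifts, ← Category.assoc]
      refine key _ (mem_null.2 ⟨𝟙 _ - Q.d ≫ h, ?_⟩)
      simp [hs]
    refine ⟨cls (s ≫ g) hsg, ?_⟩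
    rw [cls_comp_cls, cls_eq_iff, ← Category.assoc]
    have : f ≫ s ≫ g - g = (f ≫ s - 𝟙 _) ≫ g := by simp
    rw [Category.assoc, this]
    refine key _ (mem_null.2 ⟨-(f ≫ h), ?_⟩)
    simp [hs]

instance : Abelian (Freyd.{w} k K) where

end Kernels

end Abelian

end Freyd

/-! ### The right exact symmetric tensor product of formal cokernels. -/

lemma whiskerLeft_sub' {C : Type u} [Category.{v} C] [Preadditive C] [MonoidalCategory C]
    [MonoidalPreadditive C] (X : C) {Y Z : C} (f g : Y ⟶ Z) : X ◁ (f - g) = X ◁ f - X ◁ g :=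
  (tensorLeft X).map_sub

lemma sub_whiskerRight' {C : Type u} [Category.{v} C] [Preadditive C] [MonoidalCategory C]
    [MonoidalPreadditive C] {Y Z : C} (f g : Y ⟶ Z) (X : C) : (f - g) ▷ X = f ▷ X - g ▷ X :=
  (tensorRight X).map_sub

namespace Freyd

variable {k : Type u₁} [Field k] {K : Type u} [Category.{v} K] [Preadditive K] [Linear k K]
  [HasZeroObject K] [HasBinaryBiproducts K] [MonoidalCategory K] [MonoidalPreadditive K]

/-- The tensor product of formal cokernels. -/
abbrev tensor (P Q : Freyd.{w} k K) : Freyd.{w} k K where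
  rel := P.rel ⊗ Q.gen ⊞ P.gen ⊗ Q.rel
  gen := P.gen ⊗ Q.gen
  d := biprod.desc (P.d ▷ Q.gen) (P.gen ◁ Q.d)

open ZeroObject in
/-- An object of `K` as a formal cokernel without relations. -/
abbrev free (X : K) : Freyd.{w} k K where
  rel := (0 : K)
  gen := X
  d := 0

lemma mem_null_free {X Z : K} {f : Z ⟶ X} : f ∈ null (free (k := k) X : Freyd.{w} k K) Z ↔ f = 0 := by
  rw [mem_null]
  simp [eq_comm]

lemma mem_lifts_free {X : K} {Q : Freyd.{w} k K} (f : X ⟶ Q.gen) : f ∈ lifts (free X) Q := by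
  rw [mem_lifts, zero_comp]
  exact Submodule.zero_mem _

lemma whiskerRight_mem_null {P : Freyd.{w} k K} (Q : Freyd.{w} k K) {Z : K} {f : Z ⟶ P.gen}
    (hf : f ∈ null P Z) : f ▷ Q.gen ∈ null (tensor P Q) (Z ⊗ Q.gen) := by
  obtain ⟨h, rfl⟩ := mem_null.1 hf
  exact mem_null.2 ⟨h ▷ Q.gen ≫ biprod.inl, by simp⟩

lemma whiskerLeft_mem_null (P : Freyd.{w} k K) {Q : Freyd.{w} k K} {Z : K} {f : Z ⟶ Q.gen}
    (hf : f ∈ null Q Z) : P.gen ◁ f ∈ null (tensor P Q) (P.gen ⊗ Z) := by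
  obtain ⟨h, rfl⟩ := mem_null.1 hf
  exact mem_null.2 ⟨P.gen ◁ h ≫ biprod.inr, by simp⟩

lemma d_mem_null (P : Freyd.{w} k K) : P.d ∈ null P P.rel := mem_null.2 ⟨𝟙 _, by simp⟩

lemma mem_lifts_tensor {P Q R : Freyd.{w} k K} {f : P.gen ⊗ Q.gen ⟶ R.gen} :
    f ∈ lifts (tensor P Q) R ↔
      P.d ▷ Q.gen ≫ f ∈ null R _ ∧ P.gen ◁ Q.d ≫ f ∈ null R _ := by
  constructor
  · intro h
    constructor
    · simpa using comp_mem_null (biprod.inl : _ ⟶ P.rel ⊗ Q.gen ⊞ P.gen ⊗ Q.rel) (mem_lifts.1 h)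
    · simpa using comp_mem_null (biprod.inr : _ ⟶ P.rel ⊗ Q.gen ⊞ P.gen ⊗ Q.rel) (mem_lifts.1 h)
  · rintro ⟨h₁, h₂⟩
    exact lifts_of_null_desc (Iso.refl _) (by simpa using h₁) (by simpa using h₂)

lemma tensor_d_whiskerRight_comp {P Q R : Freyd.{w} k K} {W : K}
    {f : (P.gen ⊗ Q.gen) ⊗ W ⟶ R.gen} (h₁ : (P.d ▷ Q.gen) ▷ W ≫ f ∈ null R _)
    (h₂ : (P.gen ◁ Q.d) ▷ W ≫ f ∈ null R _) : (tensor P Q).d ▷ W ≫ f ∈ null R _ := by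
  have := (null R _).add_mem (comp_mem_null (biprod.fst ▷ W) h₁) (comp_mem_null (biprod.snd ▷ W) h₂)
  simpa [biprod.desc_eq] using this

lemma whiskerLeft_tensor_d_comp {P Q R : Freyd.{w} k K} {W : K}
    {f : W ⊗ (P.gen ⊗ Q.gen) ⟶ R.gen} (h₁ : W ◁ (P.d ▷ Q.gen) ≫ f ∈ null R _)
    (h₂ : W ◁ (P.gen ◁ Q.d) ≫ f ∈ null R _) : W ◁ (tensor P Q).d ≫ f ∈ null R _ := by
  have := (null R _).add_mem (comp_mem_null (W ◁ biprod.fst) h₁) (comp_mem_null (W ◁ biprod.snd) h₂)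
  simpa [biprod.desc_eq] using this

lemma whiskerLeft_mem_lifts (P : Freyd.{w} k K) {Q R : Freyd.{w} k K} {f : Q.gen ⟶ R.gen}
    (hf : f ∈ lifts Q R) : P.gen ◁ f ∈ lifts (tensor P Q) (tensor P R) := by
  refine mem_lifts_tensor.2 ⟨?_, ?_⟩
  · rw [← whisker_exchange]
    exact comp_mem_null _ (whiskerRight_mem_null R (d_mem_null P))
  · rw [← whiskerLeft_comp]
    exact whiskerLeft_mem_null P (mem_lifts.1 hf)

lemma whiskerRight_mem_lifts {Q R : Freyd.{w} k K} {f : Q.gen ⟶ R.gen} (hf : f ∈ lifts Q R)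
    (P : Freyd.{w} k K) : f ▷ P.gen ∈ lifts (tensor Q P) (tensor R P) := by
  refine mem_lifts_tensor.2 ⟨?_, ?_⟩
  · rw [← comp_whiskerRight]
    exact whiskerRight_mem_null P (mem_lifts.1 hf)
  · rw [whisker_exchange]
    exact comp_mem_null _ (whiskerLeft_mem_null R (d_mem_null P))

lemma associator_hom_mem (P Q R : Freyd.{w} k K) :
    (α_ P.gen Q.gen R.gen).hom ∈ lifts (tensor (tensor P Q) R) (tensor P (tensor Q R)) := by
  refine mem_lifts_tensor.2 ⟨tensor_d_whiskerRight_comp ?_ ?_, ?_⟩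
  · rw [associator_naturality_left]
    exact comp_mem_null _ (whiskerRight_mem_null (tensor Q R) (d_mem_null P))
  · rw [associator_naturality_middle]
    exact comp_mem_null _ (whiskerLeft_mem_null P (whiskerRight_mem_null R (d_mem_null Q)))
  · rw [associator_naturality_right]
    exact comp_mem_null _ (whiskerLeft_mem_null P (whiskerLeft_mem_null Q (d_mem_null R)))

lemma associator_inv_mem (P Q R : Freyd.{w} k K) :
    (α_ P.gen Q.gen R.gen).inv ∈ lifts (tensor P (tensor Q R)) (tensor (tensor P Q) R) := by
  refine mem_lifts_tensor.2 ⟨?_, whiskerLeft_tensor_d_comp ?_ ?_⟩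
  · rw [associator_inv_naturality_left]
    exact comp_mem_null _ (whiskerRight_mem_null R (whiskerRight_mem_null Q (d_mem_null P)))
  · rw [associator_inv_naturality_middle]
    exact comp_mem_null _ (whiskerRight_mem_null R (whiskerLeft_mem_null P (d_mem_null Q)))
  · rw [associator_inv_naturality_right]
    exact comp_mem_null _ (whiskerLeft_mem_null (tensor P Q) (d_mem_null R))

/-- Isomorphisms of generators, compatible with relations. -/
def clsIso {P Q : Freyd.{w} k K} (e : P.gen ≅ Q.gen) (h : e.hom ∈ lifts P Q)
    (h' : e.inv ∈ lifts Q P) : P ≅ Q where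
  hom := cls e.hom h
  inv := cls e.inv h'
  hom_inv_id := by rw [cls_comp_cls, ← cls_id]; simp only [e.hom_inv_id]
  inv_hom_id := by rw [cls_comp_cls, ← cls_id]; simp only [e.inv_hom_id]

lemma leftUnitor_hom_mem (P : Freyd.{w} k K) :
    (λ_ P.gen).hom ∈ lifts (tensor (free (𝟙_ K)) P) P := by
  refine mem_lifts_tensor.2 ⟨?_, ?_⟩
  · simp
  · rw [leftUnitor_naturality]
    exact comp_mem_null _ (d_mem_null P)

lemma leftUnitor_inv_mem (P : Freyd.{w} k K) :
    (λ_ P.gen).inv ∈ lifts P (tensor (free (𝟙_ K)) P) := by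
  rw [mem_lifts, leftUnitor_inv_naturality]
  exact comp_mem_null _ (whiskerLeft_mem_null (free (𝟙_ K)) (d_mem_null P))

lemma rightUnitor_hom_mem (P : Freyd.{w} k K) :
    (ρ_ P.gen).hom ∈ lifts (tensor P (free (𝟙_ K))) P := by
  refine mem_lifts_tensor.2 ⟨?_, ?_⟩
  · rw [rightUnitor_naturality]
    exact comp_mem_null _ (d_mem_null P)
  · simp

lemma rightUnitor_inv_mem (P : Freyd.{w} k K) :
    (ρ_ P.gen).inv ∈ lifts P (tensor P (free (𝟙_ K))) := by
  rw [mem_lifts, rightUnitor_inv_naturality]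
  exact comp_mem_null _ (whiskerRight_mem_null (free (𝟙_ K)) (d_mem_null P))

instance : MonoidalCategoryStruct (Freyd.{w} k K) where
  tensorObj := tensor
  tensorUnit := free (𝟙_ K)
  whiskerLeft P _ _ f := cls (P.gen ◁ Hom.rep f) (whiskerLeft_mem_lifts P (Hom.rep_mem f))
  whiskerRight f P := cls (Hom.rep f ▷ P.gen) (whiskerRight_mem_lifts (Hom.rep_mem f) P)
  tensorHom {_ P Q _} f g :=
    (cls (Hom.rep f ▷ Q.gen) (whiskerRight_mem_lifts (Hom.rep_mem f) Q) : _ ⟶ tensor P Q) ≫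
      cls (P.gen ◁ Hom.rep g) (whiskerLeft_mem_lifts P (Hom.rep_mem g))
  associator P Q R := clsIso (α_ _ _ _) (associator_hom_mem P Q R) (associator_inv_mem P Q R)
  leftUnitor P := clsIso (λ_ _) (leftUnitor_hom_mem P) (leftUnitor_inv_mem P)
  rightUnitor P := clsIso (ρ_ _) (rightUnitor_hom_mem P) (rightUnitor_inv_mem P)

lemma whiskerLeft_cls (P : Freyd.{w} k K) {Q R : Freyd.{w} k K} {f : Q.gen ⟶ R.gen}
    (hf : f ∈ lifts Q R) : P ◁ cls f hf = cls (P.gen ◁ f) (whiskerLeft_mem_lifts P hf) := by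
  refine cls_eq_iff.2 ?_
  have := whiskerLeft_mem_null P (Hom.mk_eq_iff.1 (Hom.mk_rep (Hom.mk f hf)))
  change P.gen ◁ (_ - f) ∈ _ at this
  rwa [whiskerLeft_sub'] at this

lemma cls_whiskerRight {Q R : Freyd.{w} k K} {f : Q.gen ⟶ R.gen} (hf : f ∈ lifts Q R)
    (P : Freyd.{w} k K) : cls f hf ▷ P = cls (f ▷ P.gen) (whiskerRight_mem_lifts hf P) := by
  refine cls_eq_iff.2 ?_
  have := whiskerRight_mem_null P (Hom.mk_eq_iff.1 (Hom.mk_rep (Hom.mk f hf)))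
  change (_ - f) ▷ P.gen ∈ _ at this
  rwa [sub_whiskerRight'] at this

lemma cls_congr {P Q : Freyd.{w} k K} {f g : P.gen ⟶ Q.gen} {hf : f ∈ lifts P Q}
    {hg : g ∈ lifts P Q} (h : f = g) : cls f hf = cls g hg := by subst h; rfl

lemma associator_hom_eq (P Q R : Freyd.{w} k K) :
    (α_ P Q R).hom = cls (α_ P.gen Q.gen R.gen).hom (associator_hom_mem P Q R) := rfl

lemma leftUnitor_hom_eq (P : Freyd.{w} k K) :
    (λ_ P).hom = cls (λ_ P.gen).hom (leftUnitor_hom_mem P) := rfl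

lemma rightUnitor_hom_eq (P : Freyd.{w} k K) :
    (ρ_ P).hom = cls (ρ_ P.gen).hom (rightUnitor_hom_mem P) := rfl

lemma tensorHom_mem_lifts {P Q R S : Freyd.{w} k K} {f : P.gen ⟶ Q.gen} (hf : f ∈ lifts P Q)
    {g : R.gen ⟶ S.gen} (hg : g ∈ lifts R S) : f ⊗ₘ g ∈ lifts (tensor P R) (tensor Q S) := by
  rw [MonoidalCategory.tensorHom_def]
  exact comp_mem_lifts (whiskerRight_mem_lifts hf R) (whiskerLeft_mem_lifts Q hg)

lemma tensorHom_cls {P Q R S : Freyd.{w} k K} {f : P.gen ⟶ Q.gen} (hf : f ∈ lifts P Q)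
    {g : R.gen ⟶ S.gen} (hg : g ∈ lifts R S) :
    cls f hf ⊗ₘ cls g hg = cls (f ⊗ₘ g) (tensorHom_mem_lifts hf hg) := by
  change cls f hf ▷ R ≫ Q ◁ cls g hg = _
  rw [cls_whiskerRight, whiskerLeft_cls, cls_comp_cls]
  exact cls_congr (MonoidalCategory.tensorHom_def _ _).symm

instance : MonoidalCategory (Freyd.{w} k K) where
  tensorHom_def _ _ := rfl
  id_tensorHom_id _ _ := (tensorHom_cls _ _).trans (cls_congr (id_tensorHom_id _ _))
  tensorHom_comp_tensorHom f₁ f₂ g₁ g₂ := by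
    obtain ⟨f₁, hf₁, rfl⟩ := exists_cls f₁
    obtain ⟨f₂, hf₂, rfl⟩ := exists_cls f₂
    obtain ⟨g₁, hg₁, rfl⟩ := exists_cls g₁
    obtain ⟨g₂, hg₂, rfl⟩ := exists_cls g₂
    simp only [tensorHom_cls, cls_comp_cls]
    exact cls_congr (tensorHom_comp_tensorHom _ _ _ _)
  whiskerLeft_id _ _ := (whiskerLeft_cls _ _).trans (cls_congr (whiskerLeft_id _ _))
  id_whiskerRight _ _ := (cls_whiskerRight _ _).trans (cls_congr (id_whiskerRight _ _))
  associator_naturality f₁ f₂ f₃ := by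
    obtain ⟨f₁, hf₁, rfl⟩ := exists_cls f₁
    obtain ⟨f₂, hf₂, rfl⟩ := exists_cls f₂
    obtain ⟨f₃, hf₃, rfl⟩ := exists_cls f₃
    simp only [tensorHom_cls, associator_hom_eq, cls_comp_cls]
    exact cls_congr (associator_naturality _ _ _)
  leftUnitor_naturality f := by
    obtain ⟨f, hf, rfl⟩ := exists_cls f
    simp only [whiskerLeft_cls, leftUnitor_hom_eq, cls_comp_cls]
    exact cls_congr (leftUnitor_naturality _)
  rightUnitor_naturality f := by
    obtain ⟨f, hf, rfl⟩ := exists_cls f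
    simp only [cls_whiskerRight, rightUnitor_hom_eq, cls_comp_cls]
    exact cls_congr (rightUnitor_naturality _)
  pentagon W X Y Z := by
    simp only [associator_hom_eq, cls_whiskerRight, whiskerLeft_cls, cls_comp_cls]
    exact cls_congr (pentagon _ _ _ _)
  triangle X Y := by
    simp only [associator_hom_eq, cls_whiskerRight, whiskerLeft_cls, cls_comp_cls,
      leftUnitor_hom_eq, rightUnitor_hom_eq]
    exact cls_congr (triangle _ _)

instance : MonoidalPreadditive (Freyd.{w} k K) where
  whiskerLeft_zero {P Q R} := (whiskerLeft_cls P (lifts Q R).zero_mem).trans (cls_congr (by simp))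
  zero_whiskerRight {P Q R} := (cls_whiskerRight (lifts Q R).zero_mem P).trans (cls_congr (by simp))
  whiskerLeft_add f g := by
    obtain ⟨f, hf, rfl⟩ := exists_cls f
    obtain ⟨g, hg, rfl⟩ := exists_cls g
    simp only [whiskerLeft_cls, cls_add]
    exact cls_congr (MonoidalPreadditive.whiskerLeft_add _ _)
  add_whiskerRight f g := by
    obtain ⟨f, hf, rfl⟩ := exists_cls f
    obtain ⟨g, hg, rfl⟩ := exists_cls g
    simp only [cls_whiskerRight, cls_add]
    exact cls_congr (MonoidalPreadditive.add_whiskerRight _ _)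

instance [MonoidalLinear k K] : MonoidalLinear k (Freyd.{w} k K) where
  whiskerLeft_smul _ _ _ c f := by
    obtain ⟨f, hf, rfl⟩ := exists_cls f
    simp only [whiskerLeft_cls, smul_cls]
    exact cls_congr (MonoidalLinear.whiskerLeft_smul _ _ _)
  smul_whiskerRight c _ _ f _ := by
    obtain ⟨f, hf, rfl⟩ := exists_cls f
    simp only [cls_whiskerRight, smul_cls]
    exact cls_congr (MonoidalLinear.smul_whiskerRight _ _ _)

section Braided

variable [SymmetricCategory K]

lemma braiding_mem (P Q : Freyd.{w} k K) :
    (β_ P.gen Q.gen).hom ∈ lifts (tensor P Q) (tensor Q P) := by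
  refine mem_lifts_tensor.2 ⟨?_, ?_⟩
  · rw [BraidedCategory.braiding_naturality_left]
    exact comp_mem_null _ (whiskerLeft_mem_null Q (d_mem_null P))
  · rw [BraidedCategory.braiding_naturality_right]
    exact comp_mem_null _ (whiskerRight_mem_null P (d_mem_null Q))

lemma braiding_inv_mem (P Q : Freyd.{w} k K) :
    (β_ P.gen Q.gen).inv ∈ lifts (tensor Q P) (tensor P Q) := by
  rw [← SymmetricCategory.braiding_swap_eq_inv_braiding]
  exact braiding_mem Q P

lemma associator_inv_eq (P Q R : Freyd.{w} k K) :
    (α_ P Q R).inv = cls (α_ P.gen Q.gen R.gen).inv (associator_inv_mem P Q R) := rfl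

instance : BraidedCategory (Freyd.{w} k K) where
  braiding P Q := clsIso (β_ P.gen Q.gen) (braiding_mem P Q) (braiding_inv_mem P Q)
  braiding_naturality_right P Q R f := by
    obtain ⟨f, hf, rfl⟩ := exists_cls f
    simp only [whiskerLeft_cls, cls_whiskerRight]
    exact (cls_comp_cls _ _).trans ((cls_congr
      (BraidedCategory.braiding_naturality_right _ _)).trans (cls_comp_cls _ _).symm)
  braiding_naturality_left {P Q} f R := by
    obtain ⟨f, hf, rfl⟩ := exists_cls f
    simp only [whiskerLeft_cls, cls_whiskerRight]
    exact (cls_comp_cls _ _).trans ((cls_congr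
      (BraidedCategory.braiding_naturality_left _ _)).trans (cls_comp_cls _ _).symm)
  hexagon_forward P Q R := by
    simp only [associator_hom_eq, clsIso, cls_whiskerRight, whiskerLeft_cls, cls_comp_cls]
    exact cls_congr (BraidedCategory.hexagon_forward _ _ _)
  hexagon_reverse P Q R := by
    simp only [associator_inv_eq, clsIso, cls_whiskerRight, whiskerLeft_cls, cls_comp_cls]
    exact cls_congr (BraidedCategory.hexagon_reverse _ _ _)

lemma braiding_hom_eq (P Q : Freyd.{w} k K) :
    (β_ P Q).hom = cls (β_ P.gen Q.gen).hom (braiding_mem P Q) := rfl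

instance : SymmetricCategory (Freyd.{w} k K) where
  symmetry P Q := by
    simp only [braiding_hom_eq, cls_comp_cls]
    exact cls_congr (SymmetricCategory.symmetry _ _)

end Braided

section RightExact

/-- `P ⊗ coker f` has the generators of `P ⊗ R`, with the image of `P ◁ f` added to the relations.
So a representative of `g` is already a representative of the factorisation. -/
lemma exists_tensorLeft_desc (P : Freyd.{w} k K) {Q R : Freyd.{w} k K} (f : Q.gen ⟶ R.gen)
    (hf : f ∈ lifts Q R) {V : Freyd.{w} k K} (g : P ⊗ R ⟶ V) (hg : P ◁ cls f hf ≫ g = 0) :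
    ∃ l, P ◁ cokerπ f ≫ l = g := by
  obtain ⟨g, hg', rfl⟩ := exists_cls g
  rw [whiskerLeft_cls] at hg
  replace hg : P.gen ◁ f ≫ g ∈ null V _ := cls_eq_zero_iff.1 ((cls_comp_cls _ _).symm.trans hg)
  obtain ⟨h₁, h₂⟩ := mem_lifts_tensor.1 hg'
  have : (show P.gen ⊗ (coker f).gen ⟶ V.gen from g) ∈ lifts (tensor P (coker f)) V := by
    refine mem_lifts_tensor.2 ⟨h₁, ?_⟩
    have := (null V _).add_mem (comp_mem_null (P.gen ◁ biprod.fst) hg)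
      (comp_mem_null (P.gen ◁ biprod.snd) h₂)
    simpa [biprod.desc_eq] using this
  refine ⟨cls g this, ?_⟩
  rw [cokerπ, whiskerLeft_cls]
  refine (cls_comp_cls _ _).trans (cls_congr ?_)
  rw [whiskerLeft_id]
  exact Category.id_comp g

lemma epi_whiskerLeft_cokerπ (P : Freyd.{w} k K) {Q R : Freyd.{w} k K} (f : Q.gen ⟶ R.gen) :
    Epi (P ◁ (cokerπ f : R ⟶ _)) := by
  refine Preadditive.epi_of_cancel_zero _ fun {R} g hg => ?_
  obtain ⟨g, hg', rfl⟩ := exists_cls g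
  rw [cokerπ, whiskerLeft_cls] at hg
  refine cls_eq_zero_iff.2 ?_
  have := cls_eq_zero_iff.1 ((cls_comp_cls _ _).symm.trans hg)
  rw [whiskerLeft_id] at this
  rwa [← Category.id_comp g]

instance (P : Freyd.{w} k K) : PreservesFiniteColimits (tensorLeft P) := by
  have (Q R : Freyd.{w} k K) (f : Q ⟶ R) : PreservesColimit (parallelPair f 0) (tensorLeft P) := by
    obtain ⟨f, hf, rfl⟩ := exists_cls f
    refine preservesColimit_of_preserves_colimit_cocone (cokerIsColimit f hf) ?_
    refine (CokernelCofork.isColimitMapCoconeEquiv _ _).symm ?_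
    have (V : Freyd.{w} k K) (g : P ⊗ R ⟶ V) (hg : P ◁ cls f hf ≫ g = 0) :
      ∃ l, P ◁ cokerπ f ≫ l = g := exists_tensorLeft_desc P _ _ g hg
    choose d hd using this
    refine Cofork.IsColimit.mk _ (fun s => d _ s.π (CokernelCofork.condition s))
      (fun s => hd _ s.π (CokernelCofork.condition s)) fun s m hm => ?_
    have := epi_whiskerLeft_cokerπ P f
    exact (cancel_epi (P ◁ cokerπ f)).1
      (hm.trans (hd _ s.π (CokernelCofork.condition s)).symm)
  have := Preadditive.hasCoequalizers_of_hasCokernels (C := Freyd.{w} k K)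
  exact Functor.preservesFiniteColimits_of_preservesCokernels _

end RightExact

lemma not_isZero_unit (h : ¬ IsZero (𝟙_ K)) : ¬ IsZero (𝟙_ (Freyd.{w} k K)) := by
  intro h'
  apply h
  rw [IsZero.iff_id_eq_zero] at h' ⊢
  exact mem_null_free.1 (cls_eq_zero_iff.1 h')

lemma mem_lifts_free_free {X Y : K} (f : X ⟶ Y) :
    f ∈ lifts (free X : Freyd.{w} k K) (free Y) := mem_lifts_free (Q := free Y) f

/-- The embedding of `K` as the formal cokernels without relations. -/
abbrev ι : K ⥤ Freyd.{w} k K where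
  obj X := free X
  map {X Y} f := cls (P := free X) (Q := free Y) f (mem_lifts_free_free f)
  map_id _ := rfl
  map_comp {X Y Z} f g := (cls_comp_cls (P := free X) (Q := free Y) (R := free Z)
    (mem_lifts_free_free f) (mem_lifts_free_free g)).symm

instance : (ι : K ⥤ Freyd.{w} k K).Additive where
  map_add {X Y f g} := (cls_add (P := free X) (Q := free Y)
    (mem_lifts_free_free f) (mem_lifts_free_free g)).symm

instance : (ι : K ⥤ Freyd.{w} k K).Linear k where
  map_smul {X Y} f c := (smul_cls (P := free X) (Q := free Y) c (mem_lifts_free_free f)).symm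

lemma id_mem_tensor_free (X Y : K) :
    𝟙 (X ⊗ Y) ∈ lifts (tensor (free X) (free Y) : Freyd.{w} k K) (free (X ⊗ Y)) :=
  mem_lifts_tensor.2 ⟨by simp, by simp⟩

/-- The embedding is compatible with tensor products. -/
def ιμ (X Y : K) : (tensor (free X) (free Y) : Freyd.{w} k K) ≅ free (X ⊗ Y) :=
  clsIso (P := tensor (free X) (free Y)) (Q := free (X ⊗ Y)) (Iso.refl _)
    (id_mem_tensor_free X Y) (mem_lifts_free _)

lemma ιμ_hom (X Y : K) : (ιμ X Y : (tensor (free X) (free Y) : Freyd.{w} k K) ≅ _).hom =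
    cls (𝟙 (X ⊗ Y)) (id_mem_tensor_free X Y) := rfl

/-- The embedding is monoidal. -/
def ιCoreMonoidal : (ι : K ⥤ Freyd.{w} k K).CoreMonoidal where
  εIso := Iso.refl _
  μIso X Y := ιμ X Y
  μIso_hom_natural_left f X := by
    simp only [ιμ_hom, cls_whiskerRight]
    refine (cls_comp_cls _ _).trans (Eq.trans (cls_congr ?_) (cls_comp_cls _ _).symm)
    exact (Category.comp_id _).trans (Category.id_comp _).symm
  μIso_hom_natural_right X f := by
    simp only [ιμ_hom, whiskerLeft_cls]
    refine (cls_comp_cls _ _).trans (Eq.trans (cls_congr ?_) (cls_comp_cls _ _).symm)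
    exact (Category.comp_id _).trans (Category.id_comp _).symm
  associativity X Y Z := by
    simp only [ιμ_hom, cls_whiskerRight, whiskerLeft_cls, associator_hom_eq, cls_comp_cls]
    have e : 𝟙 (X ⊗ Y) ▷ Z ≫ 𝟙 ((X ⊗ Y) ⊗ Z) ≫ (α_ X Y Z).hom =
        (α_ X Y Z).hom ≫ X ◁ 𝟙 (Y ⊗ Z) ≫ 𝟙 (X ⊗ Y ⊗ Z) := by simp
    exact cls_congr e
  left_unitality X := by
    simp only [ιμ_hom, Iso.refl_hom, id_whiskerRight, Category.id_comp, cls_comp_cls]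
    exact cls_congr (Category.id_comp _).symm
  right_unitality X := by
    simp only [ιμ_hom, Iso.refl_hom, whiskerLeft_id, Category.id_comp, cls_comp_cls]
    exact cls_congr (Category.id_comp _).symm

instance : (ι : K ⥤ Freyd.{w} k K).Monoidal := ιCoreMonoidal.toMonoidal

instance [SymmetricCategory K] : (ι : K ⥤ Freyd.{w} k K).Braided where
  braided X Y := by
    change (ιμ (k := k) X Y).hom ≫ _ = _ ≫ (ιμ Y X).hom
    simp only [ιμ_hom, braiding_hom_eq]
    refine (cls_comp_cls _ _).trans (Eq.trans (cls_congr ?_) (cls_comp_cls _ _).symm)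
    simp

end Freyd

/-! ### Opposites, and the abelian envelope obtained by adjoining kernels and then cokernels. -/

section Op

open Opposite

variable {k : Type u₁} [Field k] {K : Type u} [Category.{v} K] [Preadditive K] [Linear k K]

/-- The opposite of a linear category is linear. -/
instance linearOpposite : Linear k Kᵒᵖ where
  homModule X Y :=
    { smul := fun c f => (c • f.unop).op
      one_smul := fun f => Quiver.Hom.unop_inj (one_smul k f.unop)
      mul_smul := fun c d f => Quiver.Hom.unop_inj (mul_smul c d f.unop)
      smul_zero := fun c => Quiver.Hom.unop_inj (smul_zero (A := unop Y ⟶ unop X) c)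
      smul_add := fun c f g => Quiver.Hom.unop_inj (smul_add c f.unop g.unop)
      add_smul := fun c d f => Quiver.Hom.unop_inj (add_smul c d f.unop)
      zero_smul := fun f => Quiver.Hom.unop_inj (zero_smul k f.unop) }
  smul_comp _ _ _ c f g := Quiver.Hom.unop_inj (Linear.comp_smul _ _ _ g.unop c f.unop)
  comp_smul _ _ _ f c g := Quiver.Hom.unop_inj (Linear.smul_comp _ _ _ c g.unop f.unop)

variable [MonoidalCategory K]

instance [MonoidalPreadditive K] : MonoidalPreadditive Kᵒᵖ where
  whiskerLeft_zero {X Y Z} := Quiver.Hom.unop_inj (MonoidalPreadditive.whiskerLeft_zero (X := unop X))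
  zero_whiskerRight {X Y Z} :=
    Quiver.Hom.unop_inj (MonoidalPreadditive.zero_whiskerRight (X := unop X))
  whiskerLeft_add f g := Quiver.Hom.unop_inj (MonoidalPreadditive.whiskerLeft_add f.unop g.unop)
  add_whiskerRight f g := Quiver.Hom.unop_inj (MonoidalPreadditive.add_whiskerRight f.unop g.unop)

instance [MonoidalPreadditive K] [MonoidalLinear k K] : MonoidalLinear k Kᵒᵖ where
  whiskerLeft_smul X _ _ c f :=
    Quiver.Hom.unop_inj (MonoidalLinear.whiskerLeft_smul (unop X) c f.unop)
  smul_whiskerRight c _ _ f X :=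
    Quiver.Hom.unop_inj (MonoidalLinear.smul_whiskerRight c f.unop (unop X))

instance [SymmetricCategory K] : SymmetricCategory Kᵒᵖ where
  symmetry X Y := Quiver.Hom.unop_inj (SymmetricCategory.symmetry (unop X) (unop Y))

instance [HasCokernels K] : HasKernels Kᵒᵖ where
  has_limit f := by
    have : HasCokernel f.unop := inferInstance
    exact ⟨⟨⟨_, CokernelCofork.IsColimit.ofπOp _ (cokernel.condition f.unop)
      (cokernelIsCokernel f.unop)⟩⟩⟩

end Op

/-- An abelian category containing an additive category `K`. -/
abbrev Envelope (k : Type u₁) [Field k] (K : Type u) [Category.{v} K] [Preadditive K] [Linear k K] :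
   Type (max w u v) := Freyd.{w} k (Freyd.{0} k Kᵒᵖ)ᵒᵖ

section RightOp

open Opposite Functor.LaxMonoidal Functor.OplaxMonoidal

variable {C : Type u₁} [Category.{v₁} C] [MonoidalCategory C] [SymmetricCategory C]
  {D : Type u₂} [Category.{v₂} D] [MonoidalCategory D] [SymmetricCategory D]
  (F : Cᵒᵖ ⥤ D) [F.Braided]

/-- The monoidal structure on `F.rightOp`. -/
def rightOpCoreMonoidal : F.rightOp.CoreMonoidal where
  εIso := (Functor.Monoidal.εIso F).symm.op
  μIso X Y := (Functor.Monoidal.μIso F (op X) (op Y)).symm.op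
  μIso_hom_natural_left f X := Quiver.Hom.unop_inj (by
    simpa using (Functor.OplaxMonoidal.δ_natural_left F f.op (op X)).symm)
  μIso_hom_natural_right X f := Quiver.Hom.unop_inj (by
    simpa using (Functor.OplaxMonoidal.δ_natural_right F (op X) f.op).symm)
  associativity X Y Z := Quiver.Hom.unop_inj (by
    have := Functor.OplaxMonoidal.associativity_inv F (op X) (op Y) (op Z)
    simpa using this)
  left_unitality X := Quiver.Hom.unop_inj (by
    have := Functor.OplaxMonoidal.left_unitality F (op X)
    simpa using this)
  right_unitality X := Quiver.Hom.unop_inj (by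
    have := Functor.OplaxMonoidal.right_unitality F (op X)
    simpa using this)

instance : F.rightOp.Monoidal := (rightOpCoreMonoidal F).toMonoidal

instance : F.rightOp.Braided where
  braided X Y := Quiver.Hom.unop_inj (by
    change F.map (β_ (op Y) (op X)).hom ≫ δ F (op X) (op Y) =
      δ F (op Y) (op X) ≫ (β_ (F.obj (op Y)) (F.obj (op X))).hom
    rw [Functor.map_braiding]
    simp)

end RightOp

section

variable (k : Type u₁) [Field k] (K : Type u) [Category.{v} K] [Preadditive K] [Linear k K]
  [HasZeroObject K] [HasBinaryBiproducts K] [MonoidalCategory K] [MonoidalPreadditive K]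
  [SymmetricCategory K]

/-- The embedding of an additive category into its abelian envelope. -/
abbrev Envelope.ι : K ⥤ Envelope.{w} k K :=
  (Freyd.ι (k := k) (K := Kᵒᵖ)).rightOp ⋙ Freyd.ι

instance [MonoidalLinear k K] [HasKernels K] [h : Fact (¬ IsZero (𝟙_ K))] :
    IsLinearSymmetricMonoidal k (Freyd.{w} k K) where
  rightExact_tensorLeft _ := inferInstance
  rightExact_tensorRight X :=
    preservesFiniteColimits_of_natIso (BraidedCategory.tensorLeftIsoTensorRight X)
  not_isZero_unit := Freyd.not_isZero_unit h.out

/-- The inner layer, taken on opposites, supplies the kernels that make the outer layer abelian.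
Right exactness of the tensor product comes from the outer layer alone. -/
lemma Envelope.isLinearSymmetricMonoidal [MonoidalLinear k K] (h : ¬ IsZero (𝟙_ K)) :
    IsLinearSymmetricMonoidal k (Envelope.{w} k K) :=
  have : Fact (¬ IsZero (𝟙_ (Freyd.{0} k Kᵒᵖ)ᵒᵖ)) :=
    ⟨fun h' => Freyd.not_isZero_unit (k := k) (K := Kᵒᵖ) (fun h'' => h h''.unop) h'.unop⟩
  inferInstance

instance : (Envelope.ι.{w} k K).Braided := inferInstance

instance : (Envelope.ι.{w} k K).Additive := inferInstance

instance : (Freyd.ι (k := k) (K := Kᵒᵖ)).rightOp.Linear k where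
  map_smul f c := Quiver.Hom.unop_inj (Functor.map_smul (Freyd.ι (k := k) (K := Kᵒᵖ)) c f.op)

instance : (Envelope.ι.{w} k K).Linear k := inferInstance

end

/-! ### Natural operators `a (- ⊗ X) ⟶ a (- ⊗ Y)` and the symmetric monoidal category of a
bicommutant. -/

namespace Twist

section Ops

variable {T : Type u} [Category.{v} T] [MonoidalCategory T]
  [SymmetricCategory T] {D : Type u₁} [Category.{v₁} D] (a : T ⥤ D)

/-- The functor `Z ↦ a (Z ⊗ X)`. -/
abbrev obj (X : T) : T ⥤ D := tensorRight X ⋙ a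

/-- The action of a morphism of `T`. -/
def map {X Y : T} (f : X ⟶ Y) : obj a X ⟶ obj a Y where
  app Z := a.map (Z ◁ f)
  naturality Z Z' g := by
    dsimp
    rw [← a.map_comp, ← a.map_comp, whisker_exchange]

variable {a}

lemma naturality {X Y : T} (φ : obj a X ⟶ obj a Y) {Z Z' : T} (g : Z ⟶ Z') :
    a.map (g ▷ X) ≫ φ.app Z' = φ.app Z ≫ a.map (g ▷ Y) :=
  φ.naturality g

/-- Whiskering on the left. -/
def left (W : T) {X Y : T} (φ : obj a X ⟶ obj a Y) : obj a (W ⊗ X) ⟶ obj a (W ⊗ Y) where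
  app Z := a.map (α_ Z W X).inv ≫ φ.app (Z ⊗ W) ≫ a.map (α_ Z W Y).hom
  naturality Z Z' g := by
    have := naturality φ (g ▷ W)
    dsimp
    rw [Category.assoc, Category.assoc, ← a.map_comp, ← associator_naturality_left, a.map_comp,
      ← reassoc_of% this, ← a.map_comp_assoc, ← a.map_comp_assoc, associator_inv_naturality_left]

lemma left_app (W : T) {X Y : T} (φ : obj a X ⟶ obj a Y) (Z : T) :
    (left W φ).app Z = a.map (α_ Z W X).inv ≫ φ.app (Z ⊗ W) ≫ a.map (α_ Z W Y).hom := rfl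

lemma map_app {X Y : T} (f : X ⟶ Y) (Z : T) : (map a f).app Z = a.map (Z ◁ f) := rfl

/-- Whiskering on the right. -/
def right {X Y : T} (φ : obj a X ⟶ obj a Y) (W : T) : obj a (X ⊗ W) ⟶ obj a (Y ⊗ W) :=
  map a (β_ X W).hom ≫ left W φ ≫ map a (β_ W Y).hom

@[simp] lemma map_id (X : T) : map a (𝟙 X) = 𝟙 _ := by
  ext1; ext1 Z; simp [map]

lemma map_comp {X Y Z : T} (f : X ⟶ Y) (g : Y ⟶ Z) :
    map a (f ≫ g) = map a f ≫ map a g := by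
  ext1; ext1 Z; simp [map]

lemma map_comp_assoc {X Y Z : T} (f : X ⟶ Y) (g : Y ⟶ Z) {M : T ⥤ D} (h : obj a Z ⟶ M) :
    map a (f ≫ g) ≫ h = map a f ≫ map a g ≫ h := by
  rw [map_comp, Category.assoc]

@[simp] lemma left_id (W X : T) : left W (𝟙 (obj a X)) = 𝟙 _ := by
  ext1; ext1 Z
  simp [left, ← a.map_comp]

lemma left_comp (W : T) {X Y Z : T} (φ : obj a X ⟶ obj a Y) (ψ : obj a Y ⟶ obj a Z) :
    left W (φ ≫ ψ) = left W φ ≫ left W ψ := by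
  ext1; ext1 Z
  simp [left, ← a.map_comp_assoc]

lemma left_comp_assoc (W : T) {X Y Z : T} (φ : obj a X ⟶ obj a Y) (ψ : obj a Y ⟶ obj a Z)
    {M : T ⥤ D} (h : obj a (W ⊗ Z) ⟶ M) :
    left W (φ ≫ ψ) ≫ h = left W φ ≫ left W ψ ≫ h := by
  rw [left_comp, Category.assoc]

lemma left_map (W : T) {X Y : T} (f : X ⟶ Y) : left W (map a f) = map a (W ◁ f) := by
  ext1; ext1 Z
  rw [left_app, map_app, map_app, ← a.map_comp, ← a.map_comp]
  congr 1
  simp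

lemma map_whiskerRight_left {W W' X Y : T} (h : W ⟶ W') (φ : obj a X ⟶ obj a Y) :
    map a (h ▷ X) ≫ left W' φ = left W φ ≫ map a (h ▷ Y) := by
  ext1; ext1 Z
  have := naturality φ (Z ◁ h)
  rw [NatTrans.comp_app, NatTrans.comp_app, map_app, map_app, left_app, left_app]
  rw [Category.assoc, Category.assoc]
  rw [← a.map_comp_assoc, associator_inv_naturality_middle, a.map_comp_assoc, reassoc_of% this,
    ← a.map_comp, associator_naturality_middle, a.map_comp]

lemma left_unit {X Y : T} (φ : obj a X ⟶ obj a Y) :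
    left (𝟙_ T) φ = map a (λ_ X).hom ≫ φ ≫ map a (λ_ Y).inv := by
  ext1; ext1 Z
  have := naturality φ (ρ_ Z).hom
  simp only [NatTrans.comp_app, map_app, left_app]
  rw [← cancel_mono (a.map (Z ◁ (λ_ Y).hom))]
  simp only [Category.assoc, ← a.map_comp, triangle, whiskerLeft_inv_hom, Functor.map_id]
  erw [a.map_id, Category.comp_id]
  rw [← this, ← a.map_comp_assoc, triangle_assoc_comp_right]

lemma left_tensor (V W : T) {X Y : T} (φ : obj a X ⟶ obj a Y) :
    left (V ⊗ W) φ = map a (α_ V W X).hom ≫ left V (left W φ) ≫ map a (α_ V W Y).inv := by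
  ext1; ext1 Z
  have := naturality φ (α_ Z V W).hom
  simp only [NatTrans.comp_app, map_app, left_app]
  have e1 : a.map (α_ Z (V ⊗ W) X).inv = a.map (Z ◁ (α_ V W X).hom) ≫ a.map (α_ Z V (W ⊗ X)).inv ≫
      a.map (α_ (Z ⊗ V) W X).inv ≫ a.map ((α_ Z V W).hom ▷ X) := by
    simp only [← a.map_comp]; congr 1; simp
  have e2 : a.map (α_ Z (V ⊗ W) Y).hom = a.map ((α_ Z V W).inv ▷ Y) ≫ a.map (α_ (Z ⊗ V) W Y).hom ≫
      a.map (α_ Z V (W ⊗ Y)).hom ≫ a.map (Z ◁ (α_ V W Y).inv) := by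
    simp only [← a.map_comp]; congr 1; simp
  have e3 : a.map ((α_ Z V W).hom ▷ Y) ≫ a.map ((α_ Z V W).inv ▷ Y) = 𝟙 _ := by
    simp [← a.map_comp]
  rw [e1, e2]
  simp only [Category.assoc]
  rw [reassoc_of% this, reassoc_of% e3]

@[simp] lemma right_id (X W : T) : right (𝟙 (obj a X)) W = 𝟙 _ := by
  simp [right, ← map_comp]

lemma right_comp {X Y Z : T} (φ : obj a X ⟶ obj a Y) (ψ : obj a Y ⟶ obj a Z) (W : T) :
    right (φ ≫ ψ) W = right φ W ≫ right ψ W := by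
  simp [right, left_comp, ← map_comp_assoc]

lemma right_map {X Y : T} (f : X ⟶ Y) (W : T) : right (map a f) W = map a (f ▷ W) := by
  simp [right, left_map, ← map_comp]

lemma right_unit {X Y : T} (φ : obj a X ⟶ obj a Y) :
    right φ (𝟙_ T) = map a (ρ_ X).hom ≫ φ ≫ map a (ρ_ Y).inv := by
  simp [right, left_unit, ← map_comp, ← map_comp_assoc]

/-- Up to structure isomorphisms the two sides are whiskerings of `φ` by `W ⊗ V` and by `V ⊗ W`.
Naturality of `φ` along the braiding `β_ V W` identifies them. -/
lemma left_right (V W : T) {X Y : T} (φ : obj a X ⟶ obj a Y) :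
    right (left V φ) W = map a (α_ V X W).hom ≫ left V (right φ W) ≫ map a (α_ V Y W).inv := by
  have h := left_tensor W V φ
  have h' := left_tensor V W φ
  have e := map_whiskerRight_left (β_ V W).hom φ
  have e' : left W (left V φ) = map a (α_ W V X).inv ≫ left (W ⊗ V) φ ≫ map a (α_ W V Y).hom := by
    rw [h]; simp [← map_comp, ← map_comp_assoc]
  have e'' : left (W ⊗ V) φ = map a ((β_ V W).inv ▷ X) ≫ left (V ⊗ W) φ ≫
      map a ((β_ V W).hom ▷ Y) := by
    rw [← e]; simp [← map_comp_assoc]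
  rw [right, e', e'', h', right, left_comp, left_comp, left_map, left_map]
  simp only [← map_comp, Category.assoc, ← map_comp_assoc]
  congr 1
  · congr 1
    simp [BraidedCategory.braiding_tensor_left_hom]
  · congr 2
    simp [BraidedCategory.braiding_tensor_right_hom, ← comp_whiskerRight_assoc]

lemma right_tensor {X Y : T} (φ : obj a X ⟶ obj a Y) (V W : T) :
    right φ (V ⊗ W) = map a (α_ X V W).inv ≫ right (right φ V) W ≫ map a (α_ Y V W).hom := by
  have h := left_tensor W V φ
  have e := map_whiskerRight_left (β_ V W).hom φ
  have e' : left W (left V φ) = map a (α_ W V X).inv ≫ left (W ⊗ V) φ ≫ map a (α_ W V Y).hom := by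
    rw [h]; simp [← map_comp, ← map_comp_assoc]
  have e'' : left (V ⊗ W) φ = map a ((β_ V W).hom ▷ X) ≫ left (W ⊗ V) φ ≫
      map a ((β_ V W).inv ▷ Y) := by
    rw [← Category.assoc, e]; simp [← map_comp]
  rw [right, right, e'', right, left_comp, left_comp, left_map, left_map, e']
  simp only [← map_comp, Category.assoc, ← map_comp_assoc]
  congr 1
  · congr 1
    have := BraidedCategory.yang_baxter X V W
    simp [BraidedCategory.braiding_tensor_right_hom, ← cancel_mono (α_ W V X).hom, this]
  · congr 2
    have := BraidedCategory.yang_baxter W V Y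
    simp [BraidedCategory.braiding_tensor_left_hom, ← cancel_epi (α_ W V Y).inv, this,
      ← SymmetricCategory.braiding_swap_eq_inv_braiding]


end Ops

end Twist

namespace Twist

section Comm

variable {T : Type u} [Category.{v} T] [MonoidalCategory T]
  [SymmetricCategory T] {D : Type u₁} [Category.{v₁} D] {a : T ⥤ D}

/-- The two ways of composing `φ ▷ -` and `- ◁ ψ` agree. -/
def Comm {X X' Y Y' : T} (φ : obj a X ⟶ obj a X') (ψ : obj a Y ⟶ obj a Y') : Prop :=
  right φ Y ≫ left X' ψ = left X ψ ≫ right φ Y'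

lemma left_eq {X Y : T} (W : T) (φ : obj a X ⟶ obj a Y) :
    left W φ = map a (β_ W X).hom ≫ right φ W ≫ map a (β_ Y W).hom := by
  simp [right, ← map_comp, ← map_comp_assoc]

namespace Comm

variable {X X' X'' Y Y' : T} {φ : obj a X ⟶ obj a X'} {φ' : obj a X' ⟶ obj a X''}
  {ψ : obj a Y ⟶ obj a Y'}

lemma symm (h : Comm φ ψ) : Comm ψ φ := by
  unfold Comm at h ⊢
  have r1 : right ψ X = map a (β_ Y X).hom ≫ left X ψ ≫ map a (β_ X Y').hom := rfl
  have r2 : right ψ X' = map a (β_ Y X').hom ≫ left X' ψ ≫ map a (β_ X' Y').hom := rfl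
  rw [left_eq Y' φ, left_eq Y φ, r1, r2]
  have e : ∀ (U V W : T) (g : obj a (U ⊗ V) ⟶ obj a W),
      map a (β_ U V).hom ≫ map a (β_ V U).hom ≫ g = g := by
    intro U V W g
    rw [← map_comp_assoc, SymmetricCategory.symmetry, map_id, Category.id_comp]
  simp only [Category.assoc]
  rw [e, e, reassoc_of% h]

/-- This is the naturality of `ψ`. It places all morphisms of `T` in every bicommutant. -/
lemma map_left (f : X ⟶ X') (ψ : obj a Y ⟶ obj a Y') : Comm (map a f) ψ := by
  unfold Comm
  rw [right_map, right_map, map_whiskerRight_left]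

lemma comp (h : Comm φ ψ) (h' : Comm φ' ψ) : Comm (φ ≫ φ') ψ := by
  unfold Comm at *
  rw [right_comp, right_comp, Category.assoc, h', reassoc_of% h]

lemma whiskerLeft (V : T) (h : Comm φ ψ) : Comm (left V φ) ψ := by
  unfold Comm at *
  rw [left_right, left_right, left_tensor, left_tensor]
  have e : ∀ (U W U' Z : T) (g : obj a (U ⊗ (W ⊗ U')) ⟶ obj a Z),
      map a (α_ U W U').inv ≫ map a (α_ U W U').hom ≫ g = g := by
    intro U W U' Z g
    rw [← map_comp_assoc, Iso.inv_hom_id, map_id, Category.id_comp]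
  simp only [Category.assoc]
  rw [e, e, ← left_comp_assoc, ← left_comp_assoc, h]

lemma whiskerRight (V : T) (h : Comm φ ψ) : Comm (right φ V) ψ :=
  (map_left _ _).comp ((h.whiskerLeft V).comp (map_left _ _))

end Comm

end Comm

/-- The category with the objects of `T`, with the bicommutant of `R` as its morphisms. -/
structure Ext (k : Type w) {T : Type u} [Category.{v} T] [MonoidalCategory T]
    {D : Type u₁} [Category.{v₁} D] {a : T ⥤ D}
    (R : ∀ X Y : T, (obj a X ⟶ obj a Y) → Prop) where
  /-- The underlying object. -/
  of : T

section Linear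

variable {k : Type w} [Field k] {T : Type u} [Category.{v} T] [MonoidalCategory T]
  [SymmetricCategory T] [Preadditive T] [Linear k T] [MonoidalPreadditive T]
  [MonoidalLinear k T] {D : Type u₁} [Category.{v₁} D] [Preadditive D] [Linear k D] {a : T ⥤ D}

lemma left_add (W : T) {X Y : T} (φ ψ : obj a X ⟶ obj a Y) :
    left W (φ + ψ) = left W φ + left W ψ := by
  ext1; ext1 Z
  simp [left_app]

lemma left_smul (W : T) {X Y : T} (r : k) (φ : obj a X ⟶ obj a Y) :
    left W (r • φ) = r • left W φ := by
  ext1; ext1 Z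
  simp [left_app]

lemma left_zero (W X Y : T) : left W (0 : obj a X ⟶ obj a Y) = 0 := by
  ext1; ext1 Z
  simp [left_app]

lemma right_add (W : T) {X Y : T} (φ ψ : obj a X ⟶ obj a Y) :
    right (φ + ψ) W = right φ W + right ψ W := by
  simp [right, left_add]

lemma right_smul (W : T) {X Y : T} (r : k) (φ : obj a X ⟶ obj a Y) :
    right (r • φ) W = r • right φ W := by
  simp [right, left_smul]

lemma right_zero (W X Y : T) : right (0 : obj a X ⟶ obj a Y) W = 0 := by
  simp [right, left_zero]

lemma map_add [a.Additive] {X Y : T} (f g : X ⟶ Y) : map a (f + g) = map a f + map a g := by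
  ext1; ext1 Z
  simp [map_app, a.map_add]

lemma map_smul [a.Additive] [a.Linear k] {X Y : T} (r : k) (f : X ⟶ Y) :
    map a (r • f) = r • map a f := by
  ext1; ext1 Z
  simp [map_app, a.map_smul]

variable (k) in
/-- The morphisms commuting with everything that commutes with the family `R`. -/
def bicommutant (R : ∀ X Y : T, (obj a X ⟶ obj a Y) → Prop) (X Y : T) :
    Submodule k (obj a X ⟶ obj a Y) where
  carrier := {φ | ∀ (X' Y' : T) (ψ : obj a X' ⟶ obj a Y'),
    (∀ (U V : T) (ρ : obj a U ⟶ obj a V), R U V ρ → Comm ρ ψ) → Comm φ ψ}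
  add_mem' h h' X' Y' ψ hψ := by
    have h1 := h X' Y' ψ hψ
    have h2 := h' X' Y' ψ hψ
    unfold Comm at *
    rw [right_add, right_add, Preadditive.add_comp, Preadditive.comp_add, h1, h2]
  zero_mem' X' Y' ψ hψ := by
    unfold Comm
    rw [right_zero, right_zero, Limits.zero_comp, Limits.comp_zero]
  smul_mem' r φ h X' Y' ψ hψ := by
    have h1 := h X' Y' ψ hψ
    unfold Comm at *
    rw [right_smul, right_smul, Linear.smul_comp, Linear.comp_smul, h1]

/-- A family of mutually commuting morphisms. -/
class IsCommuting (R : ∀ X Y : T, (obj a X ⟶ obj a Y) → Prop) : Prop where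
  comm {X Y X' Y' : T} {φ : obj a X ⟶ obj a Y} {ψ : obj a X' ⟶ obj a Y'} :
    R X Y φ → R X' Y' ψ → Comm φ ψ

variable {R : ∀ X Y : T, (obj a X ⟶ obj a Y) → Prop}

lemma subset_bicommutant {X Y : T} {φ : obj a X ⟶ obj a Y} (h : R X Y φ) :
    φ ∈ bicommutant k R X Y :=
  fun _ _ _ hψ => hψ _ _ _ h

/-- The double commutant argument: `R` lies in its own commutant, so the bicommutant commutes with
`R`, hence lies in the commutant of `R`, hence commutes with itself. -/
lemma comm_of_mem_bicommutant [IsCommuting R] {X Y X' Y' : T} {φ : obj a X ⟶ obj a Y}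
    {ψ : obj a X' ⟶ obj a Y'} (h : φ ∈ bicommutant k R X Y) (h' : ψ ∈ bicommutant k R X' Y') :
    Comm φ ψ :=
  h _ _ _ fun _ _ _ hρ => (h' _ _ _ fun _ _ _ hρ' => IsCommuting.comm hρ' hρ).symm

lemma map_mem_bicommutant {X Y : T} (f : X ⟶ Y) : map a f ∈ bicommutant k R X Y :=
  fun _ _ _ _ => Comm.map_left _ _

lemma comp_mem_bicommutant {X Y Z : T} {φ : obj a X ⟶ obj a Y} {ψ : obj a Y ⟶ obj a Z}
    (h : φ ∈ bicommutant k R X Y) (h' : ψ ∈ bicommutant k R Y Z) :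
    φ ≫ ψ ∈ bicommutant k R X Z :=
  fun _ _ _ hρ => (h _ _ _ hρ).comp (h' _ _ _ hρ)

lemma left_mem_bicommutant (W : T) {X Y : T} {φ : obj a X ⟶ obj a Y}
    (h : φ ∈ bicommutant k R X Y) : left W φ ∈ bicommutant k R (W ⊗ X) (W ⊗ Y) :=
  fun _ _ _ hρ => (h _ _ _ hρ).whiskerLeft W

lemma right_mem_bicommutant (W : T) {X Y : T} {φ : obj a X ⟶ obj a Y}
    (h : φ ∈ bicommutant k R X Y) : right φ W ∈ bicommutant k R (X ⊗ W) (Y ⊗ W) :=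
  fun _ _ _ hρ => (h _ _ _ hρ).whiskerRight W

namespace Ext

instance : Category (Ext k R) where
  Hom X Y := bicommutant k R X.of Y.of
  id X := ⟨𝟙 _, by rw [← map_id]; exact map_mem_bicommutant _⟩
  comp f g := ⟨f.1 ≫ g.1, comp_mem_bicommutant f.2 g.2⟩
  id_comp f := Subtype.ext (Category.id_comp _)
  comp_id f := Subtype.ext (Category.comp_id _)
  assoc f g h := Subtype.ext (Category.assoc _ _ _)

instance (X Y : Ext k R) : AddCommGroup (X ⟶ Y) :=
  inferInstanceAs (AddCommGroup (bicommutant k R X.of Y.of))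

instance (X Y : Ext k R) : Module k (X ⟶ Y) :=
  inferInstanceAs (Module k (bicommutant k R X.of Y.of))

/-- The underlying natural transformation. -/
def val {X Y : Ext k R} (f : X ⟶ Y) : obj a X.of ⟶ obj a Y.of := f.1

lemma hom_ext {X Y : Ext k R} {f g : X ⟶ Y} (h : val f = val g) : f = g := Subtype.ext h

lemma val_id (X : Ext k R) : val (𝟙 X) = 𝟙 _ := rfl

lemma val_comp {X Y Z : Ext k R} (f : X ⟶ Y) (g : Y ⟶ Z) : val (f ≫ g) = val f ≫ val g := rfl

instance : Preadditive (Ext k R) where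
  add_comp _ _ _ f g h := Subtype.ext (Preadditive.add_comp _ _ _ f.1 g.1 h.1)
  comp_add _ _ _ f g h := Subtype.ext (Preadditive.comp_add _ _ _ f.1 g.1 h.1)

instance : Linear k (Ext k R) where
  smul_comp _ _ _ r f g := Subtype.ext (Linear.smul_comp _ _ _ r f.1 g.1)
  comp_smul _ _ _ f r g := Subtype.ext (Linear.comp_smul _ _ _ f.1 r g.1)

variable (k R) in
/-- The functor from `T`. -/
def J : T ⥤ Ext k R where
  obj X := ⟨X⟩
  map f := ⟨map a f, map_mem_bicommutant f⟩
  map_id X := Subtype.ext (map_id X)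
  map_comp f g := Subtype.ext (map_comp f g)

instance [a.Additive] : (J k R).Additive where
  map_add := Subtype.ext (map_add _ _)

instance [a.Additive] [a.Linear k] : (J k R).Linear k where
  map_smul _ _ := Subtype.ext (map_smul _ _)

/-- An isomorphism coming from `T`. -/
abbrev iso {X Y : T} (e : X ≅ Y) : (⟨X⟩ : Ext k R) ≅ ⟨Y⟩ := (J k R).mapIso e

instance : MonoidalCategoryStruct (Ext k R) where
  tensorObj X Y := ⟨X.of ⊗ Y.of⟩
  tensorUnit := ⟨𝟙_ T⟩
  whiskerLeft X _ _ f := ⟨left X.of f.1, left_mem_bicommutant _ f.2⟩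
  whiskerRight f X := ⟨right f.1 X.of, right_mem_bicommutant _ f.2⟩
  tensorHom {X Y X' Y'} f g := ⟨right f.1 X'.of ≫ left Y.of g.1,
    comp_mem_bicommutant (right_mem_bicommutant _ f.2) (left_mem_bicommutant _ g.2)⟩
  associator X Y Z := iso (α_ X.of Y.of Z.of)
  leftUnitor X := iso (λ_ X.of)
  rightUnitor X := iso (ρ_ X.of)

lemma val_tensorHom {X Y X' Y' : Ext k R} (f : X ⟶ Y) (g : X' ⟶ Y') :
    val (f ⊗ₘ g) = right (val f) X'.of ≫ left Y.of (val g) := rfl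

variable [IsCommuting R]

lemma comm_val {X Y X' Y' : Ext k R} (f : X ⟶ Y) (g : X' ⟶ Y') : Comm (val f) (val g) :=
  comm_of_mem_bicommutant (k := k) f.2 g.2

/-- The interchange law amounts to `Comm`; this is why a commuting family is required. -/
lemma tensorHom_comp {X Y Z X' Y' Z' : Ext k R} (f : X ⟶ Y) (f' : X' ⟶ Y')
    (g : Y ⟶ Z) (g' : Y' ⟶ Z') : (f ⊗ₘ f') ≫ (g ⊗ₘ g') = (f ≫ g) ⊗ₘ (f' ≫ g') := by
  have h : Comm (val g) (val f') := comm_val g f'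
  unfold Comm at h
  apply hom_ext
  simp only [val_comp, val_tensorHom, right_comp, left_comp, Category.assoc]
  rw [← reassoc_of% h]

lemma associator_naturality' {X Y Z X' Y' Z' : Ext k R} (f : X ⟶ X') (g : Y ⟶ Y')
    (h : Z ⟶ Z') : ((f ⊗ₘ g) ⊗ₘ h) ≫ (α_ X' Y' Z').hom = (α_ X Y Z).hom ≫ (f ⊗ₘ (g ⊗ₘ h)) := by
  apply hom_ext
  have e : ∀ (U V W Z : T) (g : obj a (U ⊗ (V ⊗ W)) ⟶ obj a Z),
      map a (α_ U V W).inv ≫ map a (α_ U V W).hom ≫ g = g := by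
    intro U V W Z g
    rw [← map_comp_assoc, Iso.inv_hom_id, map_id, Category.id_comp]
  have e' : ∀ (U V W Z : T) (g : obj a ((U ⊗ V) ⊗ W) ⟶ obj a Z),
      map a (α_ U V W).hom ≫ map a (α_ U V W).inv ≫ g = g := by
    intro U V W Z g
    rw [← map_comp_assoc, Iso.hom_inv_id, map_id, Category.id_comp]
  have e'' : ∀ (U V W : T), map a (α_ U V W).inv ≫ map a (α_ U V W).hom = 𝟙 _ := by
    intro U V W
    rw [← map_comp, Iso.inv_hom_id, map_id]
  rw [val_comp, val_comp, val_tensorHom, val_tensorHom, val_tensorHom, val_tensorHom]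
  change (right (right (val f) Y.of ≫ left X'.of (val g)) Z.of ≫ left (X'.of ⊗ Y'.of) (val h)) ≫
      map a (α_ X'.of Y'.of Z'.of).hom = map a (α_ X.of Y.of Z.of).hom ≫
      right (val f) (Y.of ⊗ Z.of) ≫ left X'.of (right (val g) Z.of ≫ left Y'.of (val h))
  rw [right_comp, left_comp, left_right, left_tensor, right_tensor]
  simp only [Category.assoc, e, e', e'', Category.comp_id]

instance : MonoidalCategory (Ext k R) where
  tensorHom_def _ _ := rfl
  id_tensorHom_id X Y := hom_ext (by
    rw [val_tensorHom, val_id, val_id, right_id, left_id, Category.comp_id]; rfl)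
  tensorHom_comp_tensorHom f f' g g' := tensorHom_comp f f' g g'
  whiskerLeft_id X Y := hom_ext (left_id _ _)
  id_whiskerRight X Y := hom_ext (right_id _ _)
  associator_naturality f g h := associator_naturality' f g h
  leftUnitor_naturality {X Y} f := hom_ext (by
    change left (𝟙_ T) (val f) ≫ map a (λ_ Y.of).hom = map a (λ_ X.of).hom ≫ val f
    simp [left_unit, ← map_comp])
  rightUnitor_naturality {X Y} f := hom_ext (by
    change right (val f) (𝟙_ T) ≫ map a (ρ_ Y.of).hom = map a (ρ_ X.of).hom ≫ val f
    simp [right_unit, ← map_comp])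
  pentagon W X Y Z := hom_ext (by
    have := congr_arg (map a) (pentagon W.of X.of Y.of Z.of)
    rw [map_comp, map_comp, map_comp, ← left_map, ← right_map] at this
    exact this)
  triangle X Y := hom_ext (by
    have := congr_arg (map a) (triangle X.of Y.of)
    rw [map_comp, ← left_map, ← right_map] at this
    exact this)

instance : MonoidalPreadditive (Ext k R) where
  whiskerLeft_zero := hom_ext (left_zero _ _ _)
  zero_whiskerRight := hom_ext (right_zero _ _ _)
  whiskerLeft_add _ _ := hom_ext (left_add _ _ _)
  add_whiskerRight _ _ := hom_ext (right_add _ _ _)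

instance : MonoidalLinear k (Ext k R) where
  whiskerLeft_smul _ _ _ _ _ := hom_ext (left_smul _ _ _)
  smul_whiskerRight _ _ _ _ _ := hom_ext (right_smul _ _ _)

instance : BraidedCategory (Ext k R) where
  braiding X Y := iso (β_ X.of Y.of)
  braiding_naturality_right X Y Z f := hom_ext (by
    change left X.of (val f) ≫ map a (β_ X.of Z.of).hom =
      map a (β_ X.of Y.of).hom ≫ right (val f) X.of
    simp [right, ← map_comp_assoc])
  braiding_naturality_left {X Y} f Z := hom_ext (by
    change right (val f) Z.of ≫ map a (β_ Y.of Z.of).hom =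
      map a (β_ X.of Z.of).hom ≫ left Z.of (val f)
    simp [right, ← map_comp])
  hexagon_forward X Y Z := hom_ext (by
    have := congr_arg (map a) (BraidedCategory.hexagon_forward X.of Y.of Z.of)
    rw [map_comp, map_comp, map_comp, map_comp, ← left_map, ← right_map] at this
    exact this)
  hexagon_reverse X Y Z := hom_ext (by
    have := congr_arg (map a) (BraidedCategory.hexagon_reverse X.of Y.of Z.of)
    rw [map_comp, map_comp, map_comp, map_comp, ← left_map, ← right_map] at this
    exact this)

instance : SymmetricCategory (Ext k R) where
  symmetry X Y := hom_ext (by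
    have := congr_arg (map a) (SymmetricCategory.symmetry X.of Y.of)
    rw [map_comp, map_id] at this
    exact this)

instance : (J k R).Monoidal :=
  Functor.CoreMonoidal.toMonoidal
    { εIso := Iso.refl _
      μIso X Y := Iso.refl _
      μIso_hom_natural_left {X Y} f X' := (Category.comp_id _).trans
        (Eq.trans (hom_ext (right_map f X') : (J k R).map f ▷ (J k R).obj X' =
          (J k R).map (f ▷ X')) (Category.id_comp _).symm)
      μIso_hom_natural_right {X Y} X' f := (Category.comp_id _).trans
        (Eq.trans (hom_ext (left_map X' f) : (J k R).obj X' ◁ (J k R).map f =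
          (J k R).map (X' ◁ f)) (Category.id_comp _).symm)
      associativity X Y Z := by
        have h1 : 𝟙 ((J k R).obj X ⊗ (J k R).obj Y) ▷ (J k R).obj Z = 𝟙 _ := id_whiskerRight _ _
        have h2 : (J k R).obj X ◁ 𝟙 ((J k R).obj Y ⊗ (J k R).obj Z) = 𝟙 _ :=
          MonoidalCategory.whiskerLeft_id _ _
        refine (congrArg₂ (· ≫ ·) h1 rfl).trans ((Category.id_comp _).trans
          ((Category.id_comp _).trans ?_))
        exact ((Category.comp_id _).symm.trans (congrArg₂ (· ≫ ·) rfl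
          ((Category.comp_id _).symm.trans (congrArg₂ (· ≫ ·) h2.symm rfl))))
      left_unitality X := by
        have h1 : 𝟙 (𝟙_ (Ext k R)) ▷ (J k R).obj X = 𝟙 _ := id_whiskerRight _ _
        exact ((Category.id_comp _).symm.trans (congrArg₂ (· ≫ ·) h1.symm
          (Category.id_comp _).symm))
      right_unitality X := by
        have h1 : (J k R).obj X ◁ 𝟙 (𝟙_ (Ext k R)) = 𝟙 _ := MonoidalCategory.whiskerLeft_id _ _
        exact ((Category.id_comp _).symm.trans (congrArg₂ (· ≫ ·) h1.symm
          (Category.id_comp _).symm)) }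

instance : (J k R).Braided where
  braided X Y := (Category.id_comp _).trans (Category.comp_id _).symm

omit [IsCommuting R] in
lemma hasZeroObject [a.Additive] [HasZeroObject T] : HasZeroObject (Ext k R) :=
  let ⟨_, hZ⟩ := HasZeroObject.zero (C := T)
  ⟨_, (J k R).map_isZero hZ⟩

omit [IsCommuting R] in
lemma hasBinaryBiproducts [a.Additive] [HasBinaryBiproducts T] :
    HasBinaryBiproducts (Ext k R) where
  has_binary_biproduct X Y :=
    have := Functor.preservesFiniteBiproductsOfAdditive (J k R)
    have := preservesBinaryBiproduct_of_preservesBiproduct (J k R) X.of Y.of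
    HasBinaryBiproduct.mk
    { bicone := (J k R).mapBinaryBicone (BinaryBiproduct.bicone X.of Y.of)
      isBilimit := isBinaryBilimitOfPreserves (J k R) (BinaryBiproduct.isBilimit X.of Y.of) }

lemma not_isZero_unit {Z : T} (h : ¬ IsZero (a.obj Z)) : ¬ IsZero (𝟙_ (Ext k R)) := by
  intro h'
  apply h
  have e := congr_arg (fun f => (val f).app Z) ((IsZero.iff_id_eq_zero _).1 h')
  have e' : 𝟙 (a.obj (Z ⊗ 𝟙_ T)) = 0 := e
  exact IsZero.of_iso ((IsZero.iff_id_eq_zero _).2 e') (a.mapIso (ρ_ Z).symm)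

end Ext

end Linear

end Twist

/-! ### Symmetric powers: universal property and multiplication by degree one. -/

section SymPow

variable {C : Type u} [Category.{v} C] [MonoidalCategory C] [SymmetricCategory C]

lemma adjacentSwap_of_le (X : C) : ∀ {n i : ℕ}, n ≤ i + 1 → adjacentSwap X n i = 𝟙 _
  | 0, _, _ => rfl
  | 1, _, _ => rfl
  | n + 2, 0, h => by omega
  | n + 2, i + 1, h => by
    change X ◁ adjacentSwap X (n + 1) i = _
    rw [adjacentSwap_of_le X (by omega)]
    exact MonoidalCategory.whiskerLeft_id _ _

lemma whiskerLeft_adjacentSwap (X : C) : ∀ n i : ℕ,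
    (X ◁ adjacentSwap X n i : tensorPow X (n + 1) ⟶ tensorPow X (n + 1)) =
      adjacentSwap X (n + 1) (i + 1)
  | 0, _ => MonoidalCategory.whiskerLeft_id _ _
  | 1, _ => rfl
  | _ + 2, _ => rfl

variable [Abelian C]

attribute [local instance] Abelian.hasFiniteBiproducts

namespace symPow

/-- The quotient map. -/
def π (X : C) (n : ℕ) : tensorPow X n ⟶ symPow X n := cokernel.π (symRelations X n)

instance (X : C) (n : ℕ) : Epi (π X n) :=
  inferInstanceAs (Epi (cokernel.π (symRelations X n)))

lemma symRelations_π (X : C) (n : ℕ) : symRelations X n ≫ π X n = 0 :=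
  cokernel.condition _

lemma tensorPowHom_π {X : C} (α : 𝟙_ C ⟶ X) (n : ℕ) :
    tensorPowHom α n ≫ π X n = symPowHom α n := rfl

@[simp]
lemma adjacentSwap_π (X : C) (n i : ℕ) : adjacentSwap X n i ≫ π X n = π X n := by
  by_cases h : i < n - 1
  · have h1 : biproduct.ι (fun _ : Fin (n - 1) => tensorPow X n) ⟨i, h⟩ ≫ symRelations X n =
        adjacentSwap X n i - 𝟙 _ := biproduct.ι_desc _ _
    have h2 : (adjacentSwap X n i - 𝟙 _) ≫ π X n = 0 := by
      rw [← h1, Category.assoc, symRelations_π, comp_zero]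
    rwa [Preadditive.sub_comp, Category.id_comp, sub_eq_zero] at h2
  · rw [adjacentSwap_of_le X (by omega), Category.id_comp]

lemma symRelations_comp {X : C} {n : ℕ} {Q : C} {q : tensorPow X n ⟶ Q}
    (h : ∀ i, adjacentSwap X n i ≫ q = q) : symRelations X n ≫ q = 0 := by
  apply biproduct.hom_ext'
  intro i
  rw [symRelations, biproduct.ι_desc_assoc, Preadditive.sub_comp, h, Category.id_comp, sub_self,
    comp_zero]

/-- The morphism induced by a symmetric morphism. -/
def desc {X : C} {n : ℕ} {Q : C} (q : tensorPow X n ⟶ Q)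
    (h : ∀ i, adjacentSwap X n i ≫ q = q) : symPow X n ⟶ Q :=
  cokernel.desc _ q (symRelations_comp h)

@[simp]
lemma π_desc {X : C} {n : ℕ} {Q : C} (q : tensorPow X n ⟶ Q)
    (h : ∀ i, adjacentSwap X n i ≫ q = q) : π X n ≫ desc q h = q :=
  cokernel.π_desc _ _ _

/-- Allows nonvanishing to be tested by symmetric morphisms on tensor powers, where explicit
formulas are available. -/
lemma symPowHom_ne_zero_iff {X : C} (α : 𝟙_ C ⟶ X) (n : ℕ) :
    symPowHom α n ≠ 0 ↔ ∃ (Q : C) (q : tensorPow X n ⟶ Q),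
      (∀ i, adjacentSwap X n i ≫ q = q) ∧ tensorPowHom α n ≫ q ≠ 0 := by
  constructor
  · intro h
    exact ⟨_, π X n, adjacentSwap_π X n, h⟩
  · rintro ⟨Q, q, hq, h⟩ h'
    apply h
    rw [← π_desc q hq, ← Category.assoc, tensorPowHom_π, h', zero_comp]

variable [MonoidalPreadditive C] [∀ X : C, PreservesFiniteColimits (tensorLeft X)]

lemma epi_whiskerLeft (W : C) {X Y : C} (f : X ⟶ Y) [Epi f] : Epi (W ◁ f) :=
  inferInstanceAs (Epi ((tensorLeft W).map f))

instance (W X : C) (n : ℕ) : Epi (W ◁ π X n) := epi_whiskerLeft _ _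

omit [MonoidalPreadditive C] [∀ X : C, PreservesFiniteColimits (tensorLeft X)] in
/-- Right exact functors preserve the universal property of symmetric powers. -/
lemma exists_map_desc {D : Type u₁} [Category.{v₁} D] [Preadditive D] (F : C ⥤ D) [F.Additive]
    [PreservesFiniteColimits F] {X : C} {n : ℕ} {Q : D} (q : F.obj (tensorPow X n) ⟶ Q)
    (h : ∀ i, F.map (adjacentSwap X n i) ≫ q = q) :
    ∃ m : F.obj (symPow X n) ⟶ Q, F.map (π X n) ≫ m = q := by
  have hq : F.map (symRelations X n) ≫ q = 0 := by
    have := Functor.preservesFiniteBiproductsOfAdditive F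
    have e : IsColimit (F.mapCocone
        (biproduct.bicone (fun _ : Fin (n - 1) => tensorPow X n)).toCocone) :=
      isColimitOfPreserves _ (biproduct.isColimit _)
    apply e.hom_ext
    rintro ⟨i⟩
    change F.map (biproduct.ι (fun _ : Fin (n - 1) => tensorPow X n) i) ≫ _ =
      F.map (biproduct.ι (fun _ : Fin (n - 1) => tensorPow X n) i) ≫ _
    rw [← F.map_comp_assoc, symRelations, biproduct.ι_desc, F.map_sub, Preadditive.sub_comp, h,
      F.map_id, Category.id_comp, sub_self, comp_zero]
  have hc := isColimitCoforkMapOfIsColimit' F (cokernel.condition (symRelations X n))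
    (cokernelIsCokernel (symRelations X n))
  exact ⟨hc.desc (CokernelCofork.ofπ q hq), hc.fac _ WalkingParallelPair.one⟩

/-- By right exactness `X ⊗ Symⁿ X` is the quotient of `X ⊗ Xⁿ` by the swaps avoiding the first
factor, and these are among the swaps killed in `Symⁿ⁺¹ X`. -/
lemma exists_mul (X : C) (n : ℕ) :
    ∃ m : X ⊗ symPow X n ⟶ symPow X (n + 1), X ◁ π X n ≫ m = π X (n + 1) :=
  exists_map_desc (tensorLeft X) (π X (n + 1)) fun i => by
    refine Eq.trans ?_ (adjacentSwap_π X (n + 1) (i + 1))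
    rw [← whiskerLeft_adjacentSwap]
    rfl

/-- The multiplication `X ⊗ Symⁿ X ⟶ Symⁿ⁺¹ X`. -/
def mul (X : C) (n : ℕ) : X ⊗ symPow X n ⟶ symPow X (n + 1) := (exists_mul X n).choose

/-- The quotient map on a tensor power with a distinguished first factor. -/
def πSucc (X : C) (n : ℕ) : X ⊗ tensorPow X n ⟶ symPow X (n + 1) := π X (n + 1)

lemma whiskerLeft_π_mul (X : C) (n : ℕ) : X ◁ π X n ≫ mul X n = πSucc X n :=
  (exists_mul X n).choose_spec

lemma whiskerLeft_πSucc_mul (X : C) (n : ℕ) :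
    X ◁ πSucc X n ≫ mul X (n + 1) = πSucc X (n + 1) :=
  whiskerLeft_π_mul X (n + 1)

lemma braiding_πSucc (X : C) (n : ℕ) :
    (α_ X X (tensorPow X n)).inv ≫ (β_ X X).hom ▷ tensorPow X n ≫
      (α_ X X (tensorPow X n)).hom ≫ X ◁ πSucc X n ≫ mul X (n + 1) =
        X ◁ πSucc X n ≫ mul X (n + 1) := by
  have e : X ◁ πSucc X n ≫ mul X (n + 1) = πSucc X (n + 1) := whiskerLeft_πSucc_mul X n
  have h : ((α_ X X (tensorPow X n)).inv ≫ (β_ X X).hom ▷ tensorPow X n ≫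
      (α_ X X (tensorPow X n)).hom) ≫ X ◁ πSucc X n ≫ mul X (n + 1) =
      X ◁ πSucc X n ≫ mul X (n + 1) := by
    rw [e]
    exact adjacentSwap_π X (n + 2) 0
  rwa [Category.assoc, Category.assoc] at h

/-- After the epimorphism `X ◁ X ◁ π X n`, both sides become the quotient map to `Symⁿ⁺² X`, which
absorbs the first swap. -/
lemma mul_comm (X : C) (n : ℕ) :
    (α_ X X (symPow X n)).inv ≫ (β_ X X).hom ▷ symPow X n ≫ (α_ X X (symPow X n)).hom ≫
      X ◁ mul X n ≫ mul X (n + 1) = X ◁ mul X n ≫ mul X (n + 1) := by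
  have := epi_whiskerLeft X (X ◁ π X n)
  rw [← cancel_epi (X ◁ X ◁ π X n)]
  have h1 : X ◁ X ◁ π X n ≫ X ◁ mul X n ≫ mul X (n + 1) = X ◁ πSucc X n ≫ mul X (n + 1) := by
    rw [← MonoidalCategory.whiskerLeft_comp_assoc, whiskerLeft_π_mul]
  rw [h1, associator_inv_naturality_right_assoc, whisker_exchange_assoc,
    associator_naturality_right_assoc, h1, braiding_πSucc]

lemma symPowHom_succ {X : C} (α : 𝟙_ C ⟶ X) (n : ℕ) :
    symPowHom α (n + 1) = (λ_ (𝟙_ C)).inv ≫ α ▷ 𝟙_ C ≫ X ◁ symPowHom α n ≫ mul X n := by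
  have h : symPowHom α (n + 1) = ((λ_ (𝟙_ C)).inv ≫ (α ⊗ₘ tensorPowHom α n)) ≫ πSucc X n := rfl
  rw [h, ← whiskerLeft_π_mul, ← tensorPowHom_π, MonoidalCategory.tensorHom_def]
  simp only [Category.assoc, MonoidalCategory.whiskerLeft_comp]

lemma mul_map_comm {X Y Y' : C} (φ : Y ⟶ X) (φ' : Y' ⟶ X) (n : ℕ) :
    (α_ Y Y' (symPow X n)).inv ≫ (β_ Y Y').hom ▷ symPow X n ≫ (α_ Y' Y (symPow X n)).hom ≫
      Y' ◁ (φ ▷ symPow X n ≫ mul X n) ≫ φ' ▷ symPow X (n + 1) ≫ mul X (n + 1) =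
    Y ◁ (φ' ▷ symPow X n ≫ mul X n) ≫ φ ▷ symPow X (n + 1) ≫ mul X (n + 1) := by
  have h1 : ∀ (A B : C) (f : A ⟶ X) (g : B ⟶ X), A ◁ (g ▷ symPow X n ≫ mul X n) ≫
      f ▷ symPow X (n + 1) ≫ mul X (n + 1) =
      A ◁ g ▷ symPow X n ≫ f ▷ (X ⊗ symPow X n) ≫ X ◁ mul X n ≫ mul X (n + 1) := by
    intro A B f g
    rw [MonoidalCategory.whiskerLeft_comp, Category.assoc, whisker_exchange_assoc]
  rw [h1, h1]
  have h2 : ∀ (A B : C) (f : A ⟶ X) (g : B ⟶ X), A ◁ g ▷ symPow X n ≫ f ▷ (X ⊗ symPow X n) =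
      (α_ A B (symPow X n)).inv ≫ (A ◁ g ≫ f ▷ X) ▷ symPow X n ≫
        (α_ X X (symPow X n)).hom := by
    intro A B f g
    rw [comp_whiskerRight_assoc, associator_naturality_left, associator_naturality_middle_assoc,
      Iso.inv_hom_id_assoc]
  have h3 : (β_ Y Y').hom ≫ Y' ◁ φ ≫ φ' ▷ X = (Y ◁ φ' ≫ φ ▷ X) ≫ (β_ X X).hom := by
    rw [← BraidedCategory.braiding_naturality_left_assoc,
      ← BraidedCategory.braiding_naturality_right, ← whisker_exchange_assoc, Category.assoc]
  rw [reassoc_of% (h2 _ _ φ' φ), reassoc_of% (h2 _ _ φ φ')]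
  simp only [Iso.hom_inv_id_assoc]
  rw [← comp_whiskerRight_assoc, h3, comp_whiskerRight_assoc]
  conv_rhs => rw [← mul_comm, Iso.hom_inv_id_assoc]

end symPow

end SymPow

/-! ### Rigidity: simplicity of the unit, and splitting exact sequences by retractions of points. -/

namespace IsTensorCategory

variable (k : Type w) [Field k] {T : Type u} [Category.{v} T] [MonoidalCategory T]
  [SymmetricCategory T] [Abelian T] [Linear k T] [IsTensorCategory k T]

include k

lemma id_unit_ne_zero : 𝟙 (𝟙_ T) ≠ 0 := fun h =>
  IsLinearSymmetricMonoidal.not_isZero_unit k (C := T) ((IsZero.iff_id_eq_zero _).2 h)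

lemma isRightAdjoint_tensorLeft (X : T) : (tensorLeft X).IsRightAdjoint := by
  obtain ⟨Y, ⟨_⟩⟩ := dualisable k X
  exact (tensorLeftAdjunction X Y).isRightAdjoint

lemma preservesFiniteLimits_tensorLeft (X : T) : PreservesFiniteLimits (tensorLeft X) := by
  have := isRightAdjoint_tensorLeft k X
  infer_instance

lemma mono_whiskerLeft (X : T) {Y Z : T} (f : Y ⟶ Z) [Mono f] : Mono (X ◁ f) := by
  have := preservesFiniteLimits_tensorLeft k X
  exact inferInstanceAs (Mono ((tensorLeft X).map f))

lemma epi_whiskerLeft (X : T) {Y Z : T} (f : Y ⟶ Z) [Epi f] : Epi (X ◁ f) := by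
  have := IsLinearSymmetricMonoidal.rightExact_tensorLeft k X
  exact inferInstanceAs (Epi ((tensorLeft X).map f))

lemma whiskerRight_eq (X : T) {Y Z : T} (f : Y ⟶ Z) :
    f ▷ X = (β_ Y X).hom ≫ X ◁ f ≫ (β_ Z X).inv := by
  simp

lemma epi_whiskerRight (X : T) {Y Z : T} (f : Y ⟶ Z) [Epi f] : Epi (f ▷ X) := by
  have := epi_whiskerLeft k X f
  rw [whiskerRight_eq k]
  infer_instance

/-- An epimorphism from the unit whose target is nonzero is a monomorphism. -/
lemma mono_of_epi_unit {V : T} (q : 𝟙_ T ⟶ V) [Epi q] (hq : q ≠ 0) : Mono q := by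
  have := (inferInstance : IsLinearSymmetricMonoidal k T).toMonoidalPreadditive
  obtain ⟨D, ⟨_⟩⟩ := dualisable k V
  let i := kernel.ι q
  -- The ideal `kernel q` acts by zero on the quotient `V` of the unit.
  have hi : i ▷ V = 0 := by
    have := epi_whiskerLeft k (kernel q) q
    rw [← cancel_epi (kernel q ◁ q), whisker_exchange, comp_zero]
    have : i ▷ 𝟙_ T ≫ (ρ_ _).hom ≫ q = 0 := by
      rw [rightUnitor_naturality_assoc, kernel.condition, comp_zero]
    rw [← cancel_mono (λ_ V).hom, Category.assoc, leftUnitor_naturality, zero_comp,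
      unitors_equal, this]
  have ret : ∀ {A B : T} (s : B ⟶ A) (r : A ⟶ B), s ≫ r = 𝟙 B → i ▷ A = 0 → i ▷ B = 0 := by
    intro A B s r hsr h
    calc i ▷ B = i ▷ B ≫ 𝟙_ T ◁ (s ≫ r) := by rw [hsr]; simp
      _ = (kernel q ◁ s ≫ i ▷ A) ≫ 𝟙_ T ◁ r := by
        rw [whisker_exchange, MonoidalCategory.whiskerLeft_comp, Category.assoc]
      _ = 0 := by rw [h, comp_zero, zero_comp]
  have tens : ∀ {A : T} (B : T), i ▷ A = 0 → i ▷ (A ⊗ B) = 0 := by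
    intro A B h
    rw [whiskerRight_tensor, h]
    simp
  -- The dual `D` is a retract of `D ⊗ (V ⊗ D)` by a snake relation, so the ideal kills it too.
  have hi' : i ▷ D = 0 := by
    refine ret ((ρ_ D).inv ≫ D ◁ η_ V D) ((α_ _ _ _).inv ≫ ε_ V D ▷ D ≫ (λ_ D).hom) ?_ ?_
    · rw [Category.assoc, ExactPairing.coevaluation_evaluation_assoc]
      simp
    · exact ret (β_ D (V ⊗ D)).hom (β_ D (V ⊗ D)).inv (Iso.hom_inv_id _) (tens D (tens D hi))
  have hi'' : D ◁ i = 0 := by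
    have := BraidedCategory.braiding_naturality_right D i
    rw [hi', comp_zero] at this
    exact (cancel_mono (β_ D (𝟙_ T)).hom).1 (this.trans zero_comp.symm)
  have := preservesFiniteLimits_tensorLeft k D
  have := IsLinearSymmetricMonoidal.rightExact_tensorLeft k D
  let S : ShortComplex T := ShortComplex.mk i q (kernel.condition q)
  have hS : S.Exact := S.exact_of_f_is_kernel (kernelIsKernel q)
  have hD : (S.map (tensorLeft D)).Exact := hS.map (tensorLeft D)
  -- Exactness of `D ⊗ -` turns the vanishing of `D ◁ i` into injectivity, so `D ⊗ 𝟙 ≅ D ⊗ V`.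
  have hm : Mono (D ◁ q) := hD.mono_g hi''
  have he : Epi (D ◁ q) := epi_whiskerLeft k D q
  have hiso : IsIso (D ◁ q) := isIso_of_mono_of_epi _
  have := BraidedCategory.exactPairing_swap V D
  -- The coevaluation moved through this isomorphism is a point of `D`; its transpose `s` is a
  -- section of `q`.
  let t : 𝟙_ T ⟶ D := η_ D V ≫ inv (D ◁ q) ≫ (ρ_ D).hom
  have ht : t ≫ (ρ_ D).inv ≫ D ◁ q = η_ D V := by simp [t]
  let s : V ⟶ 𝟙_ T := (ρ_ V).inv ≫ V ◁ t ≫ ε_ D V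
  have hs : s ≫ q = 𝟙 V := by
    calc s ≫ q = (ρ_ V).inv ≫ V ◁ t ≫ (ρ_ _).inv ≫ (V ⊗ D) ◁ q ≫ ε_ D V ▷ V ≫ (λ_ V).hom := by
          rw [whisker_exchange_assoc, leftUnitor_naturality, ← rightUnitor_inv_naturality_assoc,
            unitors_equal, Iso.inv_hom_id_assoc]
          simp [s]
      _ = (ρ_ V).inv ≫ V ◁ (t ≫ (ρ_ D).inv ≫ D ◁ q) ≫ (α_ _ _ _).inv ≫ ε_ D V ▷ V ≫
          (λ_ V).hom := by simp
      _ = 𝟙 V := by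
          rw [ht, ExactPairing.coevaluation_evaluation_assoc]
          simp
  -- `q ≫ s` is a scalar that acts as `1` on the nonzero `q`, hence it is the identity.
  obtain ⟨c, hc⟩ := (bijective_algebraMap (k := k) (T := T)).2 (q ≫ s)
  have hc' : c • 𝟙 (𝟙_ T) = q ≫ s := hc
  have h1 : (c - 1) • q = 0 := by
    have : (q ≫ s) ≫ q = q := by rw [Category.assoc, hs, Category.comp_id]
    rw [← hc', Linear.smul_comp, Category.id_comp] at this
    rw [sub_smul, this, one_smul, sub_self]
  have h2 : c = 1 := by
    rcases smul_eq_zero.1 h1 with h | h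
    · exact sub_eq_zero.1 h
    · exact absurd h hq
  rw [h2, one_smul] at hc'
  exact mono_of_mono_fac hc'.symm

/-- The image of `α` is a nonzero quotient of the unit, hence the unit itself. -/
lemma mono_of_ne_zero {X : T} (α : 𝟙_ T ⟶ X) (hα : α ≠ 0) : Mono α := by
  have h : Abelian.factorThruImage α ≠ 0 := fun h => hα (by
    rw [← Abelian.image.fac α, h, zero_comp])
  have := mono_of_epi_unit k _ h
  rw [← Abelian.image.fac α]
  infer_instance

/-- Pulling `g ▷ D` back along the coevaluation of `Z` gives an epimorphism `q : P ⟶ 𝟙` and a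
morphism `P ⊗ Z ⟶ Y` lifting `q ▷ Z` through `g`. Passing `P` to its dual `E` on the other side
turns these into `α` and `c`. -/
lemma exists_section {Y Z : T} (g : Y ⟶ Z) [Epi g] : ∃ (E : T) (α : 𝟙_ T ⟶ E) (c : Z ⟶ E ⊗ Y),
    α ≠ 0 ∧ c ≫ E ◁ g = (λ_ Z).inv ≫ α ▷ Z := by
  obtain ⟨D, ⟨_⟩⟩ := dualisable k Z
  have := epi_whiskerRight k D g
  let P := pullback (g ▷ D) (η_ Z D)
  let p : P ⟶ Y ⊗ D := pullback.fst _ _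
  let q : P ⟶ 𝟙_ T := pullback.snd _ _
  have hpq : p ≫ g ▷ D = q ≫ η_ Z D := pullback.condition
  have hq : Epi q := inferInstanceAs (Epi (pullback.snd _ _))
  clear_value P p q
  obtain ⟨E, ⟨_⟩⟩ := dualisable k P
  have := BraidedCategory.exactPairing_swap P E
  let h : P ⊗ Z ⟶ Y := p ▷ Z ≫ (α_ _ _ _).hom ≫ Y ◁ ε_ Z D ≫ (ρ_ Y).hom
  have hg : h ≫ g = q ▷ Z ≫ (λ_ Z).hom := by
    have := congrArg (fun t => t ▷ Z ≫ (α_ _ _ _).hom ≫ Z ◁ ε_ Z D ≫ (ρ_ Z).hom) hpq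
    rw [comp_whiskerRight_assoc, comp_whiskerRight_assoc,
      ExactPairing.evaluation_coevaluation_assoc] at this
    simp only [Iso.inv_hom_id, Category.comp_id] at this
    rw [← this]
    simp only [h, Category.assoc]
    rw [associator_naturality_left_assoc, ← whisker_exchange_assoc, rightUnitor_naturality]
  refine ⟨E, η_ E P ≫ E ◁ q ≫ (ρ_ E).hom, (λ_ Z).inv ≫ η_ E P ▷ Z ≫ (α_ _ _ _).hom ≫ E ◁ h,
    fun h0 => ?_, ?_⟩
  -- A snake relation recovers `q` from `α`, and the zero morphism to `𝟙` is not epi.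
  · have h1 : η_ E P ≫ E ◁ q = 0 := by
      rw [← cancel_mono (ρ_ E).hom, Category.assoc, h0, zero_comp]
    have : q = 0 := by
      have h2 := ExactPairing.coevaluation_evaluation E P
      have h3 : (ρ_ P).hom ≫ (λ_ P).inv ≫ 𝟙_ T ◁ q = 0 := by
        rw [← reassoc_of% h2, ← whisker_exchange, ← associator_inv_naturality_right_assoc,
          ← MonoidalCategory.whiskerLeft_comp_assoc, h1]
        simp
      simpa using h3
    rw [this] at hq
    exact id_unit_ne_zero k (T := T) ((cancel_epi (0 : P ⟶ 𝟙_ T)).1 (by simp))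
  · simp only [Category.assoc, ← MonoidalCategory.whiskerLeft_comp, hg]
    simp

/-- A symmetric monoidal functor inverting on one side the nonzero morphisms from the unit splits
short exact sequences. -/
theorem nonempty_splitting {K : Type u₁} [Category.{v₁} K] [Preadditive K] [MonoidalCategory K]
    [MonoidalPreadditive K] (J : T ⥤ K) [J.Additive] [J.Monoidal]
    (hJ : ∀ (X : T) (α : 𝟙_ T ⟶ X), α ≠ 0 →
      ∃ r : J.obj X ⟶ 𝟙_ K, Functor.LaxMonoidal.ε J ≫ J.map α ≫ r = 𝟙 _)
    (S : ShortComplex T) (hS : S.ShortExact) : Nonempty (S.map J).Splitting := by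
  have := (inferInstance : IsLinearSymmetricMonoidal k T).toMonoidalPreadditive
  have := hS.epi_g
  have := hS.mono_f
  obtain ⟨E, α, c, hα, hc⟩ := exists_section k S.g
  obtain ⟨r, hr⟩ := hJ E α hα
  -- Contracting `E` with `r` is natural in `X` and undoes the insertion of `α`; it turns sections
  -- up to `α` into true ones.
  let R (X : T) : J.obj (E ⊗ X) ⟶ J.obj X :=
    Functor.OplaxMonoidal.δ J E X ≫ r ▷ J.obj X ≫ (λ_ (J.obj X)).hom
  have hR (X : T) : J.map ((λ_ X).inv ≫ α ▷ X) ≫ R X = 𝟙 _ := by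
    have e : J.map α ≫ r = Functor.OplaxMonoidal.η J := by
      rw [← cancel_epi (Functor.LaxMonoidal.ε J), hr, Functor.Monoidal.ε_η]
    simp only [R]
    rw [J.map_comp, Category.assoc, ← Functor.OplaxMonoidal.δ_natural_left_assoc,
      ← comp_whiskerRight_assoc, e, Functor.OplaxMonoidal.left_unitality_hom, ← J.map_comp,
      Iso.inv_hom_id, J.map_id]
  have hR' {X Y : T} (f : X ⟶ Y) : J.map (E ◁ f) ≫ R Y = R X ≫ J.map f := by
    simp only [R]
    rw [← Functor.OplaxMonoidal.δ_natural_right_assoc, whisker_exchange_assoc,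
      leftUnitor_naturality]
    simp
  have := preservesFiniteLimits_tensorLeft k E
  have := IsLinearSymmetricMonoidal.rightExact_tensorLeft k E
  have hE : (S.map (tensorLeft E)).ShortExact := hS.map_of_exact _
  have : Mono (S.map (tensorLeft E)).f := hE.mono_f
  have : Mono (E ◁ S.f) := mono_whiskerLeft k E S.f
  -- The defect of `c` vanishes in `E ⊗ S.X₃`, so it factors through `E ⊗ S.X₁`; this is the
  -- matching retraction up to `α`.
  obtain ⟨h, hh⟩ : ∃ h : S.X₂ ⟶ E ⊗ S.X₁, h ≫ E ◁ S.f =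
      (λ_ S.X₂).inv ≫ α ▷ S.X₂ - S.g ≫ c := by
    have e : ((λ_ S.X₂).inv ≫ α ▷ S.X₂ - S.g ≫ c) ≫ (S.map (tensorLeft E)).g = 0 := by
      change _ ≫ E ◁ S.g = 0
      rw [Preadditive.sub_comp, Category.assoc, Category.assoc, hc]
      rw [← whisker_exchange, ← leftUnitor_inv_naturality_assoc, sub_self]
    exact ⟨hE.exact.lift _ e, hE.exact.lift_f _ e⟩
  have hf : S.f ≫ h = (λ_ S.X₁).inv ≫ α ▷ S.X₁ := by
    rw [← cancel_mono (E ◁ S.f), Category.assoc, hh, Preadditive.comp_sub, S.zero_assoc, zero_comp, sub_zero,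
      Category.assoc, ← whisker_exchange, leftUnitor_inv_naturality_assoc]
  refine ⟨⟨J.map h ≫ R _, J.map c ≫ R _, ?_, ?_, ?_⟩⟩
  · change J.map S.f ≫ J.map h ≫ R _ = 𝟙 _
    rw [← J.map_comp_assoc, hf, hR]
  · change (J.map c ≫ R _) ≫ J.map S.g = 𝟙 _
    rw [Category.assoc, ← hR', ← J.map_comp_assoc, hc, hR]
  · change (J.map h ≫ R _) ≫ J.map S.f + J.map S.g ≫ J.map c ≫ R _ = 𝟙 _
    rw [Category.assoc, ← hR', ← J.map_comp_assoc, hh, J.map_sub, Preadditive.sub_comp, hR,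
      J.map_comp, Category.assoc, sub_add_cancel]

end IsTensorCategory

/-! ### Pointed objects, germs of points, and the commuting retraction operators. -/

namespace Submodule

variable {k : Type w} [Field k] {M M' M'' : Type u} [AddCommGroup M] [Module k M] [AddCommGroup M']
  [Module k M'] [AddCommGroup M''] [Module k M'']

/-- The subquotient of a module attached to two submodules. -/
abbrev Subquot (C N : Submodule k M) : Type u := C ⧸ N.submoduleOf C

/-- The map of subquotients induced by a linear map. -/
def subquotMap {C N : Submodule k M} {C' N' : Submodule k M'} (f : M →ₗ[k] M')
    (hC : ∀ x ∈ C, f x ∈ C') (hN : ∀ x ∈ N, f x ∈ N') : Subquot C N →ₗ[k] Subquot C' N' :=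
  Submodule.mapQ _ _ (f.restrict hC) fun x hx => hN x.1 hx

lemma subquot_mk_eq {C N : Submodule k M} {x y : C} :
    (Submodule.Quotient.mk x : Subquot C N) = Submodule.Quotient.mk y ↔ x.1 - y.1 ∈ N :=
  Submodule.Quotient.eq _

lemma subquot_mk_eq_zero {C N : Submodule k M} {x : C} :
    (Submodule.Quotient.mk x : Subquot C N) = 0 ↔ x.1 ∈ N :=
  Submodule.Quotient.mk_eq_zero _

end Submodule

/-- A nonzero morphism from the unit. -/
structure PointedObj (T : Type u) [Category.{v} T] [MonoidalCategory T] [HasZeroMorphisms T] where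
  /-- The target. -/
  X : T
  /-- The morphism. -/
  α : 𝟙_ T ⟶ X
  ne : α ≠ 0

namespace PointedObj

instance (T : Type u) [Category.{v} T] [MonoidalCategory T] [HasZeroMorphisms T] :
    Preorder (PointedObj T) where
  le b c := ∃ φ : b.X ⟶ c.X, b.α ≫ φ = c.α
  le_refl b := ⟨𝟙 _, Category.comp_id _⟩
  le_trans b c d := fun ⟨φ, hφ⟩ ⟨ψ, hψ⟩ => ⟨φ ≫ ψ, by rw [reassoc_of% hφ, hψ]⟩

variable {k : Type w} [Field k] {T : Type u} [Category.{v} T] [MonoidalCategory T]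
  [SymmetricCategory T] [Abelian T] [Linear k T] [MonoidalPreadditive T] [MonoidalLinear k T]
  [∀ X : T, PreservesFiniteColimits (tensorLeft X)]

/-- Multiplication of symmetric powers along a morphism `φ`. -/
def act (b : PointedObj T) {Y : T} (φ : Y ⟶ b.X) (n : ℕ) :
    Y ⊗ symPow b.X n ⟶ symPow b.X (n + 1) :=
  φ ▷ _ ≫ symPow.mul b.X n

/-- Multiplication of symmetric powers by `b.α`. -/
def step (b : PointedObj T) (n : ℕ) : symPow b.X n ⟶ symPow b.X (n + 1) :=
  (λ_ _).inv ≫ b.act b.α n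

lemma act_comm (b : PointedObj T) {Y Y' : T} (φ : Y ⟶ b.X) (φ' : Y' ⟶ b.X) (n : ℕ) :
    (α_ Y Y' _).inv ≫ (β_ Y Y').hom ▷ _ ≫ (α_ Y' Y _).hom ≫ Y' ◁ b.act φ n ≫ b.act φ' (n + 1) =
      Y ◁ b.act φ' n ≫ b.act φ (n + 1) :=
  symPow.mul_map_comm φ φ' n

/-- Multiplications in symmetric powers commute, so every one of them is compatible with the
transition maps `step`. This makes them act on germs. -/
lemma step_act (b : PointedObj T) {Y : T} (φ : Y ⟶ b.X) (n : ℕ) :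
    Y ◁ b.step n ≫ b.act φ (n + 1) = b.act φ n ≫ b.step (n + 1) := by
  have h := b.act_comm φ b.α n
  rw [step, step, MonoidalCategory.whiskerLeft_comp, Category.assoc, ← h,
    leftUnitor_inv_naturality_assoc]
  simp

variable (T) in
/-- Eventually in `b`, eventually in `n`. -/
@[irreducible] def germFilter : Filter (PointedObj T × ℕ) := Filter.atTop.curry Filter.atTop

omit [SymmetricCategory T] [MonoidalPreadditive T]
  [∀ X : T, PreservesFiniteColimits (tensorLeft X)] in
lemma eventually_iff {p : PointedObj T × ℕ → Prop} :
    (∀ᶠ i in germFilter T, p i) ↔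
      ∀ᶠ b in Filter.atTop, ∀ᶠ n in Filter.atTop, p (b, n) := by
  rw [germFilter, Filter.eventually_curry_iff]

omit [SymmetricCategory T] [MonoidalPreadditive T]
  [∀ X : T, PreservesFiniteColimits (tensorLeft X)] in
lemma eventually_succ {p : PointedObj T × ℕ → Prop} :
    (∀ᶠ i in germFilter T, p (i.1, i.2 + 1)) ↔ ∀ᶠ i in germFilter T, p i := by
  rw [eventually_iff, eventually_iff]
  refine Filter.eventually_congr (Filter.Eventually.of_forall fun b => ?_)
  have h : Filter.map (· + 1) (Filter.atTop : Filter ℕ) = Filter.atTop :=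
    Filter.map_add_atTop_eq_nat 1
  exact (Filter.eventually_map (m := (· + 1)) (P := fun n => p (b, n))).symm.trans (by rw [h])

omit [SymmetricCategory T] [MonoidalPreadditive T]
  [∀ X : T, PreservesFiniteColimits (tensorLeft X)] in
lemma eventually_le (c : PointedObj T) : ∀ᶠ i in germFilter T, c ≤ i.1 := by
  rw [eventually_iff]
  filter_upwards [Filter.eventually_ge_atTop c] with b hb
  exact Filter.Eventually.of_forall fun _ => hb

/-- Families of points of the `Z ⊗ Symⁿ X`. -/
abbrev Seq (Z : T) : Type (max u v) :=
  ∀ i : PointedObj T × ℕ, 𝟙_ T ⟶ Z ⊗ symPow i.1.X i.2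

variable (k) in
/-- Families which are eventually compatible. -/
def compat (Z : T) : Submodule k (Seq Z) where
  -- Compatibility is asked only along `n`. Morphisms of pointed objects are not unique, so no
  -- condition relates different `b`.
  carrier := {x | ∀ᶠ i in germFilter T, x (i.1, i.2 + 1) = x i ≫ Z ◁ i.1.step i.2}
  add_mem' hx hy := by
    filter_upwards [hx, hy] with i h1 h2
    simp [h1, h2]
  zero_mem' := Filter.Eventually.of_forall fun i => by simp
  smul_mem' r x hx := by
    filter_upwards [hx] with i h1
    simp [h1]

variable (k) in
/-- Families which are eventually zero. -/
def null (Z : T) : Submodule k (Seq Z) where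
  carrier := {x | ∀ᶠ i in germFilter T, x i = 0}
  add_mem' hx hy := by
    filter_upwards [hx, hy] with i h1 h2
    simp [h1, h2]
  zero_mem' := Filter.Eventually.of_forall fun i => rfl
  smul_mem' r x hx := by
    filter_upwards [hx] with i h1
    simp [h1]

variable (k) in
/-- The action of a morphism on families. -/
def seqMap {Z Z' : T} (f : Z ⟶ Z') : Seq Z →ₗ[k] Seq Z' where
  toFun x i := x i ≫ f ▷ _
  map_add' x y := by ext i; simp
  map_smul' r x := by ext i; simp

lemma seqMap_compat {Z Z' : T} (f : Z ⟶ Z') (x : Seq Z) (hx : x ∈ compat k Z) :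
    seqMap k f x ∈ compat k Z' := by
  filter_upwards [show ∀ᶠ i in germFilter T, _ from hx] with i h
  simp [seqMap, h, whisker_exchange]

lemma seqMap_null {Z Z' : T} (f : Z ⟶ Z') (x : Seq Z) (hx : x ∈ null k Z) :
    seqMap k f x ∈ null k Z' := by
  filter_upwards [show ∀ᶠ i in germFilter T, _ from hx] with i h
  simp [seqMap, h]

variable (k) in
/-- The map induced on germs by a morphism. -/
def germMap {Z Z' : T} (f : Z ⟶ Z') :
    Submodule.Subquot (compat k Z) (null k Z) →ₗ[k] Submodule.Subquot (compat k Z') (null k Z') :=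
  Submodule.subquotMap (seqMap k f) (seqMap_compat f) (seqMap_null f)

lemma germ_ext {Z : T} {x y : compat k Z} (h : ∀ᶠ i in germFilter T, x.1 i = y.1 i) :
    (Submodule.Quotient.mk x : Submodule.Subquot (compat k Z) (null k Z)) =
      Submodule.Quotient.mk y := by
  rw [Submodule.subquot_mk_eq]
  filter_upwards [h] with i hi
  simp [hi]

variable (k T) in
/-- The functor of germs of points. -/
def germs : T ⥤ ModuleCat.{max u v} k where
  obj Z := ModuleCat.of k (Submodule.Subquot (compat k Z) (null k Z))
  map f := ModuleCat.ofHom (germMap k f)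
  map_id Z := by
    ext x
    exact germ_ext (Filter.Eventually.of_forall fun i => by simp [seqMap])
  map_comp f g := by
    ext x
    exact germ_ext (Filter.Eventually.of_forall fun i => by simp [seqMap])

instance : (germs k T).Additive where
  map_add {X Y f g} := by
    ext x
    obtain ⟨x, rfl⟩ := Submodule.Quotient.mk_surjective ((null k X).submoduleOf (compat k X)) x
    exact germ_ext (x := ⟨seqMap k (f + g) x.1, seqMap_compat _ _ x.2⟩)
      (y := ⟨seqMap k f x.1, seqMap_compat _ _ x.2⟩ + ⟨seqMap k g x.1, seqMap_compat _ _ x.2⟩)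
      (Filter.Eventually.of_forall fun i => by simp [seqMap])

instance : (germs k T).Linear k where
  map_smul {X Y} f r := by
    ext x
    obtain ⟨x, rfl⟩ := Submodule.Quotient.mk_surjective ((null k X).submoduleOf (compat k X)) x
    exact germ_ext (x := ⟨seqMap k (r • f) x.1, seqMap_compat _ _ x.2⟩)
      (y := r • ⟨seqMap k f x.1, seqMap_compat _ _ x.2⟩)
      (Filter.Eventually.of_forall fun i => by simp [seqMap])

/-- The powers of the base points form a compatible family. If its germ were zero, one of these
powers would vanish, since the filters involved are nontrivial. -/
lemma germs_not_isZero [IsDirectedOrder (PointedObj T)] [Nonempty (PointedObj T)]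
    (h : ∀ (b : PointedObj T) (n : ℕ), symPowHom b.α n ≠ 0) :
    ¬ IsZero ((germs k T).obj (𝟙_ T)) := by
  intro h0
  let x : compat k (𝟙_ T) := ⟨fun i => symPowHom i.1.α i.2 ≫ (λ_ _).inv, by
    refine Filter.Eventually.of_forall fun i => ?_
    simp only [symPow.symPowHom_succ, step, act]
    rw [← whisker_exchange_assoc]
    simp [← leftUnitor_inv_naturality_assoc, ← leftUnitor_inv_naturality]⟩
  have hx : (Submodule.Quotient.mk x : Submodule.Subquot (compat k (𝟙_ T)) (null k (𝟙_ T))) = 0 := by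
    have := ModuleCat.subsingleton_of_isZero h0
    exact Subsingleton.elim (α := (germs k T).obj (𝟙_ T)) _ _
  rw [Submodule.subquot_mk_eq_zero] at hx
  have hx' : ∀ᶠ i in germFilter T, symPowHom i.1.α i.2 ≫ (λ_ _).inv = 0 := hx
  rw [eventually_iff] at hx'
  obtain ⟨b, hb⟩ := hx'.exists
  obtain ⟨n, hn⟩ := hb.exists
  exact h b n ((cancel_mono (λ_ _).inv).1 (hn.trans zero_comp.symm))

/-- A compatible family of morphisms raising the degree by one. -/
structure Shift (U V : T) where
  /-- The morphisms. -/
  t : ∀ i : PointedObj T × ℕ, U ⊗ symPow i.1.X i.2 ⟶ V ⊗ symPow i.1.X (i.2 + 1)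
  comm : ∀ i, U ◁ i.1.step i.2 ≫ t (i.1, i.2 + 1) = t i ≫ V ◁ i.1.step (i.2 + 1)

namespace Shift

variable {U V W : T}

variable (k) in
/-- The action of a shift on families. -/
def seqMap (s : Shift U V) : Seq U →ₗ[k] Seq V where
  toFun x i := match i with
    -- Degree zero has no predecessor; the value there does not affect the germ.
    | (_, 0) => 0
    | (b, n + 1) => x (b, n) ≫ s.t (b, n)
  map_add' x y := by
    ext ⟨b, n⟩
    cases n <;> simp
  map_smul' r x := by
    ext ⟨b, n⟩
    cases n <;> simp

variable (k) in
/-- The action of a shift on germs. -/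
def germMap (s : Shift U V) :
    Submodule.Subquot (compat k U) (null k U) →ₗ[k] Submodule.Subquot (compat k V) (null k V) :=
  Submodule.subquotMap (s.seqMap k)
    (fun x hx => by
      refine eventually_succ.1 ?_
      filter_upwards [show ∀ᶠ i in germFilter T, _ from hx] with ⟨b, n⟩ h
      have h' : x (b, n + 1) = x (b, n) ≫ U ◁ b.step n := h
      change x (b, n + 1) ≫ s.t (b, n + 1) = (x (b, n) ≫ s.t (b, n)) ≫ V ◁ b.step (n + 1)
      have := s.comm (b, n)
      rw [h', Category.assoc, Category.assoc]
      exact congrArg _ this)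
    (fun x hx => by
      refine eventually_succ.1 ?_
      filter_upwards [show ∀ᶠ i in germFilter T, _ from hx] with ⟨b, n⟩ h
      change x (b, n) ≫ _ = 0
      rw [h, zero_comp])

lemma germMap_mk_ext (s : Shift U V) {x : compat k U} {y : compat k V}
    (h : ∀ᶠ i in germFilter T, x.1 i ≫ s.t i = y.1 (i.1, i.2 + 1)) :
    s.germMap k (Submodule.Quotient.mk x) = Submodule.Quotient.mk y := by
  apply germ_ext
  exact eventually_succ.1 h

lemma germMap_comp_ext {V' : T} (s : Shift U V) (s' : Shift V W) (t : Shift U V') (t' : Shift V' W)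
    (h : ∀ i, s.t i ≫ s'.t (i.1, i.2 + 1) = t.t i ≫ t'.t (i.1, i.2 + 1)) :
    s'.germMap k ∘ₗ s.germMap k = t'.germMap k ∘ₗ t.germMap k := by
  ext x
  refine germ_ext (eventually_succ.1 (eventually_succ.1 (Filter.Eventually.of_forall ?_)))
  intro i
  change (x.1 i ≫ s.t i) ≫ s'.t (i.1, i.2 + 1) = (x.1 i ≫ t.t i) ≫ t'.t (i.1, i.2 + 1)
  rw [Category.assoc, Category.assoc, h]

end Shift

end PointedObj

namespace PointedObj

variable {k : Type w} [Field k] {T : Type u} [Category.{v} T] [MonoidalCategory T]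
  [SymmetricCategory T] [Abelian T] [Linear k T] [MonoidalPreadditive T] [MonoidalLinear k T]
  [∀ X : T, PreservesFiniteColimits (tensorLeft X)]

namespace Shift

variable {U V W : T}

variable (k) in
/-- The action of a shift on germs, as a morphism. -/
def hom (s : Shift U V) : (germs k T).obj U ⟶ (germs k T).obj V := ModuleCat.ofHom (s.germMap k)

/-- Precomposition with a morphism. -/
def pre (f : W ⟶ U) (s : Shift U V) : Shift W V where
  t i := f ▷ _ ≫ s.t i
  comm i := by rw [whisker_exchange_assoc, s.comm, Category.assoc]

/-- Postcomposition with a morphism. -/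
def post (s : Shift U V) (f : V ⟶ W) : Shift U W where
  t i := s.t i ≫ f ▷ _
  comm i := by rw [← Category.assoc, s.comm, Category.assoc, Category.assoc, whisker_exchange]

lemma map_hom (f : W ⟶ U) (s : Shift U V) :
    (germs k T).map f ≫ s.hom k = (s.pre f).hom k := by
  ext x
  obtain ⟨x, rfl⟩ := Submodule.Quotient.mk_surjective ((null k W).submoduleOf (compat k W)) x
  refine germ_ext (k := k) ((eventually_succ (T := T)).1 (Filter.Eventually.of_forall fun i => ?_))
  exact Category.assoc _ _ _

lemma hom_map (s : Shift U V) (f : V ⟶ W) :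
    s.hom k ≫ (germs k T).map f = (s.post f).hom k := by
  ext x
  obtain ⟨x, rfl⟩ := Submodule.Quotient.mk_surjective ((null k U).submoduleOf (compat k U)) x
  refine germ_ext (k := k) ((eventually_succ (T := T)).1 (Filter.Eventually.of_forall fun i => ?_))
  exact Category.assoc _ _ _

lemma hom_comp_hom {V' : T} (s : Shift U V) (s' : Shift V W) (t : Shift U V') (t' : Shift V' W)
    (h : ∀ i, s.t i ≫ s'.t (i.1, i.2 + 1) = t.t i ≫ t'.t (i.1, i.2 + 1)) :
    s.hom k ≫ s'.hom k = t.hom k ≫ t'.hom k := by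
  exact congrArg ModuleCat.ofHom (germMap_comp_ext s s' t t' h)

lemma hom_congr {s t : Shift U V} (h : ∀ i, s.t i = t.t i) : s.hom k = t.hom k := by
  have : s = t := by
    cases s; cases t; congr; exact funext h
  rw [this]

end Shift

open Classical in
/-- A morphism `c ⟶ b` of pointed objects, if there is one. -/
def proj (c b : PointedObj T) : c.X ⟶ b.X := if h : c ≤ b then h.choose else 0

omit [MonoidalPreadditive T] [∀ X : T, PreservesFiniteColimits (tensorLeft X)] [SymmetricCategory T] in
lemma α_proj {c b : PointedObj T} (h : c ≤ b) : c.α ≫ c.proj b = b.α := by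
  rw [proj, dif_pos h, h.choose_spec]

/-- The shift attached to a pointed object. -/
def shift (c : PointedObj T) (Z : T) : Shift (Z ⊗ c.X) (Z ⊗ 𝟙_ T) where
  t i := (α_ _ _ _).hom ≫ Z ◁ i.1.act (c.proj i.1) i.2 ≫ (ρ_ Z).inv ▷ _
  comm i := by
    have := i.1.step_act (c.proj i.1) i.2
    rw [associator_naturality_right_assoc, ← MonoidalCategory.whiskerLeft_comp_assoc, this,
      MonoidalCategory.whiskerLeft_comp_assoc, Category.assoc, Category.assoc, whisker_exchange]

variable (k) in
/-- The operator attached to a pointed object. -/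
def ret (c : PointedObj T) : Twist.obj (germs k T) c.X ⟶ Twist.obj (germs k T) (𝟙_ T) where
  app Z := (c.shift Z).hom k
  naturality Z Z' f := by
    change (germs k T).map (f ▷ c.X) ≫ _ = _ ≫ (germs k T).map (f ▷ 𝟙_ T)
    rw [Shift.map_hom, Shift.hom_map]
    refine Shift.hom_congr fun i => ?_
    simp only [shift, Shift.pre, Shift.post, Category.assoc]
    rw [associator_naturality_left_assoc, ← whisker_exchange_assoc, ← comp_whiskerRight,
      ← comp_whiskerRight, rightUnitor_inv_naturality]

lemma ret_app (c : PointedObj T) (Z : T) : (c.ret k).app Z = (c.shift Z).hom k := rfl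

/-- For `b` above `c` the chosen morphism sends `c.α` to `b.α`, so the composite multiplies by `b.α`
and moves `x (b, n)` to `x (b, n + 1)`. On germs this is the identity. -/
lemma map_α_ret (c : PointedObj T) : Twist.map (germs k T) c.α ≫ c.ret k = 𝟙 _ := by
  ext1; ext1 Z
  rw [NatTrans.comp_app, ret_app, Twist.map_app, Shift.map_hom]
  ext x
  obtain ⟨x, rfl⟩ := Submodule.Quotient.mk_surjective
    ((null k (Z ⊗ 𝟙_ T)).submoduleOf (compat k (Z ⊗ 𝟙_ T))) x
  refine Shift.germMap_mk_ext ((c.shift Z).pre (Z ◁ c.α)) (x := x) (y := x) ?_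
  filter_upwards [show ∀ᶠ i in germFilter T, _ from x.2, eventually_le c] with i h hi
  refine Eq.trans ?_ h.symm
  simp only [shift, Shift.pre]
  rw [associator_naturality_middle_assoc]
  have : c.α ▷ symPow i.1.X i.2 ≫ i.1.act (c.proj i.1) i.2 = i.1.act i.1.α i.2 := by
    rw [act, ← comp_whiskerRight_assoc, α_proj hi, act]
  rw [← MonoidalCategory.whiskerLeft_comp_assoc, this, step, whisker_exchange,
    MonoidalCategory.whiskerLeft_comp]
  have e : (α_ Z (𝟙_ T) (symPow i.1.X i.2)).hom ≫ (ρ_ Z).inv ▷ (𝟙_ T ⊗ symPow i.1.X i.2) =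
      (Z ⊗ 𝟙_ T) ◁ (λ_ _).inv := by monoidal
  rw [reassoc_of% e]

omit [Abelian T] [Linear k T] [MonoidalPreadditive T] [MonoidalLinear k T]
  [∀ X : T, PreservesFiniteColimits (tensorLeft X)] in
lemma shift_coherence (Z W S' S'' : T) (f : W ⊗ S' ⟶ S'') :
    (ρ_ (Z ⊗ W)).inv ▷ S' ≫ (α_ Z W (𝟙_ T)).hom ▷ S' ≫ (Z ◁ (β_ W (𝟙_ T)).hom) ▷ S' ≫
      (α_ Z (𝟙_ T) W).inv ▷ S' ≫ (α_ (Z ⊗ 𝟙_ T) W S').hom ≫ (Z ⊗ 𝟙_ T) ◁ f ≫ (ρ_ _).inv ▷ S'' =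
    (α_ Z W S').hom ≫ Z ◁ f ≫ ((ρ_ Z).inv ≫ (ρ_ _).inv) ▷ S'' := by
  rw [comp_whiskerRight, whisker_exchange_assoc]
  have : (ρ_ (Z ⊗ W)).inv ▷ S' ≫ (α_ Z W (𝟙_ T)).hom ▷ S' ≫ (Z ◁ (β_ W (𝟙_ T)).hom) ▷ S' ≫
      (α_ Z (𝟙_ T) W).inv ▷ S' ≫ (α_ (Z ⊗ 𝟙_ T) W S').hom =
      (α_ Z W S').hom ≫ (ρ_ Z).inv ▷ (W ⊗ S') := by
    rw [braiding_tensorUnit_right]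
    monoidal
  rw [reassoc_of% this]

/-- Both composites multiply by the images of `c.X` and `d.X`, in the two possible orders, so the
claim reduces to `act_comm`. -/
lemma comm_ret (c d : PointedObj T) : Twist.Comm (c.ret k) (d.ret k) := by
  unfold Twist.Comm
  ext1; ext1 Z
  rw [Twist.right, Twist.right]
  simp only [NatTrans.comp_app, Twist.left_app, Twist.map_app, ret_app, Category.assoc]
  -- All structure isomorphisms are absorbed into the shifts, leaving one identity in each degree.
  have hL := Shift.hom_comp_hom (k := k)
    ((c.shift (Z ⊗ d.X)).pre (Z ◁ (β_ c.X d.X).hom ≫ (α_ Z d.X c.X).inv))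
    (((d.shift (Z ⊗ 𝟙_ T)).pre ((α_ Z d.X (𝟙_ T)).hom ≫ Z ◁ (β_ d.X (𝟙_ T)).hom ≫
      (α_ Z (𝟙_ T) d.X).inv)).post (α_ Z (𝟙_ T) (𝟙_ T)).hom)
    ((d.shift (Z ⊗ c.X)).pre (α_ Z c.X d.X).inv)
    (((c.shift (Z ⊗ 𝟙_ T)).pre ((α_ Z c.X (𝟙_ T)).hom ≫ Z ◁ (β_ c.X (𝟙_ T)).hom ≫
      (α_ Z (𝟙_ T) c.X).inv)).post ((α_ Z (𝟙_ T) (𝟙_ T)).hom ≫ Z ◁ (β_ (𝟙_ T) (𝟙_ T)).hom))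
    (by
      rintro ⟨b, n⟩
      have h := b.act_comm (c.proj b) (d.proj b) n
      have h1 := shift_coherence Z d.X (symPow b.X (n + 1)) _ (b.act (d.proj b) (n + 1))
      have h2 := shift_coherence Z c.X (symPow b.X (n + 1)) _ (b.act (c.proj b) (n + 1))
      simp only [Shift.pre, Shift.post, shift, comp_whiskerRight, Category.assoc] at h1 h2 ⊢
      rw [reassoc_of% h1, reassoc_of% h2]
      have e : (β_ (𝟙_ T) (𝟙_ T)).hom = 𝟙 _ := by
        rw [braiding_tensorUnit_right, ← unitors_equal, Iso.hom_inv_id]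
      rw [associator_naturality_right_assoc, associator_naturality_right_assoc,
        pentagon_inv_hom_hom_hom_hom_assoc, pentagon_inv_hom_hom_hom_hom_assoc,
        associator_naturality_middle_assoc, e, MonoidalCategory.whiskerLeft_id, id_whiskerRight,
        Category.comp_id]
      simp only [← MonoidalCategory.whiskerLeft_comp_assoc, Category.assoc]
      rw [← h, Iso.hom_inv_id_assoc])
  simp only [← Shift.map_hom, ← Shift.hom_map, Functor.map_comp, Category.assoc] at hL
  exact hL

end PointedObj

/-! ### The extension of the category in which nonzero points have retractions. -/

namespace PointedObj

section

variable {T : Type u} [Category.{v} T] [MonoidalCategory T] [Abelian T]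

lemma nonempty_of_ne (h : 𝟙 (𝟙_ T) ≠ 0) : Nonempty (PointedObj T) := ⟨⟨_, _, h⟩⟩

/-- Two pointed objects are amalgamated by the pushout of their points. Its point is nonzero because
pushouts preserve monomorphisms in an abelian category. -/
lemma isDirectedOrder (h : 𝟙 (𝟙_ T) ≠ 0)
    (hm : ∀ (X : T) (α : 𝟙_ T ⟶ X), α ≠ 0 → Mono α) : IsDirectedOrder (PointedObj T) where
  directed b c := by
    have := hm _ _ b.ne
    have := hm _ _ c.ne
    refine ⟨⟨pushout b.α c.α, b.α ≫ pushout.inl _ _, fun h0 => ?_⟩, ⟨pushout.inl _ _, rfl⟩,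
      ⟨pushout.inr _ _, pushout.condition.symm⟩⟩
    have h1 : b.α = 0 := (cancel_mono (pushout.inl b.α c.α)).1 (by rw [h0, zero_comp])
    exact b.ne h1

end

variable (k : Type w) [Field k] (T : Type u) [Category.{v} T] [MonoidalCategory T]
  [SymmetricCategory T] [Abelian T] [Linear k T] [MonoidalPreadditive T] [MonoidalLinear k T]
  [∀ X : T, PreservesFiniteColimits (tensorLeft X)]

/-- The retraction operators attached to pointed objects. -/
inductive IsRet : ∀ X Y : T, (Twist.obj (germs k T) X ⟶ Twist.obj (germs k T) Y) → Prop
  | mk (c : PointedObj T) : IsRet c.X (𝟙_ T) (c.ret k)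

instance : Twist.IsCommuting (IsRet k T) where
  comm h h' := by
    obtain ⟨c⟩ := h
    obtain ⟨d⟩ := h'
    exact comm_ret c d

/-- The extension of `T` by retractions of the nonzero morphisms from the unit. -/
abbrev RetExt : Type u := Twist.Ext k (IsRet k T)

/-- The functor to the extension. -/
abbrev toRetExt : T ⥤ RetExt k T := Twist.Ext.J k (IsRet k T)

lemma exists_ret {X : T} (α : 𝟙_ T ⟶ X) (hα : α ≠ 0) :
    ∃ r : (toRetExt k T).obj X ⟶ 𝟙_ (RetExt k T),
      (toRetExt k T).map α ≫ r = 𝟙 (𝟙_ (RetExt k T)) :=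
  ⟨⟨(⟨X, α, hα⟩ : PointedObj T).ret k, Twist.subset_bicommutant (IsRet.mk ⟨X, α, hα⟩)⟩,
    Twist.Ext.hom_ext (map_α_ret ⟨X, α, hα⟩)⟩

end PointedObj

/-- An additive functor splitting short exact sequences is right exact. -/
lemma preservesFiniteColimits_of_splitting {C : Type u₁} [Category.{v₁} C] [Abelian C]
    {D : Type u₂} [Category.{v₂} D] [Abelian D] (F : C ⥤ D) [F.Additive]
    (h : ∀ S : ShortComplex C, S.ShortExact → Nonempty (S.map F).Splitting) :
    PreservesFiniteColimits F := by
  refine (F.preservesFiniteColimits_tfae.out 0 3).1 fun S hS => ?_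
  obtain ⟨s⟩ := h S hS
  exact ⟨s.exact, s.epi_g⟩

namespace IsTensorCategory

variable (k : Type w) [Field k] {T : Type u} [Category.{v} T] [MonoidalCategory T]
  [SymmetricCategory T] [Abelian T] [Linear k T] [IsTensorCategory k T]

/-- A tensor category with a faithful symmetric monoidal functor to a small one with nonvanishing
symmetric powers of points is locally semisimple. -/
theorem isLocallySemisimple_of_functor (S : Type v) [Category.{v} S] [MonoidalCategory S]
    [SymmetricCategory S] [Abelian S] [Linear k S] [MonoidalPreadditive S] [MonoidalLinear k S]
    [∀ X : S, PreservesFiniteColimits (tensorLeft X)] (e : T ⥤ S) [e.Braided] [e.Additive]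
    [e.Linear k] [e.Faithful] (h1 : 𝟙 (𝟙_ S) ≠ 0)
    (hm : ∀ (X : S) (α : 𝟙_ S ⟶ X), α ≠ 0 → Mono α)
    (hp : ∀ (X : S) (α : 𝟙_ S ⟶ X) (n : ℕ), α ≠ 0 → symPowHom α n ≠ 0) :
    IsLocallySemisimple k T := by
  have := PointedObj.nonempty_of_ne h1
  have := PointedObj.isDirectedOrder h1 hm
  let K := PointedObj.RetExt k S
  have : HasZeroObject K := Twist.Ext.hasZeroObject
  have : HasBinaryBiproducts K := Twist.Ext.hasBinaryBiproducts
  have hK : ¬ IsZero (𝟙_ K) := Twist.Ext.not_isZero_unit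
    (PointedObj.germs_not_isZero fun b n => hp b.X b.α n b.ne)
  let J : T ⥤ K := e ⋙ PointedObj.toRetExt k S
  have hJ : ∀ (X : T) (α : 𝟙_ T ⟶ X), α ≠ 0 →
      ∃ r : J.obj X ⟶ 𝟙_ K, Functor.LaxMonoidal.ε J ≫ J.map α ≫ r = 𝟙 _ := by
    intro X α hα
    have hα' : Functor.LaxMonoidal.ε e ≫ e.map α ≠ 0 := fun h0 => hα (by
      apply e.map_injective
      rw [← cancel_epi (Functor.LaxMonoidal.ε e), h0, e.map_zero, comp_zero])
    obtain ⟨r, hr⟩ := PointedObj.exists_ret k S _ hα'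
    refine ⟨r, ?_⟩
    rw [Functor.map_comp, Category.assoc] at hr
    refine (congrArg (· ≫ J.map α ≫ r) (Functor.LaxMonoidal.comp_ε e
      (PointedObj.toRetExt k S))).trans ((Category.assoc _ _ _).trans ?_)
    exact (Category.id_comp _).trans hr
  -- The universe lift places the objects of the envelope where `IsLocallySemisimple` expects them.
  let F : T ⥤ Envelope.{max u (v + 1)} k K := J ⋙ Envelope.ι k K
  have hF : ∀ S : ShortComplex T, S.ShortExact → Nonempty (S.map F).Splitting := by
    intro S hS
    obtain ⟨s⟩ := nonempty_splitting k J hJ S hS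
    exact ⟨s.map (Envelope.ι k K)⟩
  exact ⟨Envelope.{max u (v + 1)} k K, inferInstance, inferInstance, inferInstance, inferInstance,
    inferInstance, Envelope.isLinearSymmetricMonoidal k K hK, F, inferInstance,
    { rightExact := preservesFiniteColimits_of_splitting F hF }, hF⟩

end IsTensorCategory

/-! ### Symmetric powers under monoidal functors, and the forward implication. -/

section Transfer

open Functor.LaxMonoidal Functor.OplaxMonoidal

variable {C : Type u} [Category.{v} C] [MonoidalCategory C] [SymmetricCategory C]
  {D : Type u₁} [Category.{v₁} D] [MonoidalCategory D] [SymmetricCategory D]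
  (F : C ⥤ D) [F.Braided]

/-- Monoidal functors commute with tensor powers. -/
def tensorPowComparison (X : C) : ∀ n : ℕ, tensorPow (F.obj X) n ⟶ F.obj (tensorPow X n)
  | 0 => ε F
  | n + 1 => F.obj X ◁ tensorPowComparison X n ≫ μ F X (tensorPow X n)

instance isIso_tensorPowComparison (X : C) : ∀ n : ℕ, IsIso (tensorPowComparison F X n)
  | 0 => inferInstanceAs (IsIso (ε F))
  | n + 1 => by
    have := isIso_tensorPowComparison X n
    exact inferInstanceAs (IsIso (F.obj X ◁ tensorPowComparison F X n ≫ μ F X (tensorPow X n)))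

lemma tensorPowHom_comparison {X : C} (α : 𝟙_ C ⟶ X) : ∀ n : ℕ,
    tensorPowHom (ε F ≫ F.map α) n ≫ tensorPowComparison F X n = ε F ≫ F.map (tensorPowHom α n)
  | 0 => by
    change 𝟙 _ ≫ ε F = ε F ≫ F.map (𝟙 _)
    rw [F.map_id, Category.comp_id, Category.id_comp]
  | n + 1 => by
    have ih := tensorPowHom_comparison α n
    change ((λ_ (𝟙_ D)).inv ≫ ((ε F ≫ F.map α) ⊗ₘ tensorPowHom (ε F ≫ F.map α) n)) ≫
      F.obj X ◁ tensorPowComparison F X n ≫ μ F X (tensorPow X n) =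
      ε F ≫ F.map ((λ_ (𝟙_ C)).inv ≫ (α ⊗ₘ tensorPowHom α n))
    rw [MonoidalCategory.tensorHom_def, Category.assoc, Category.assoc,
      ← MonoidalCategory.whiskerLeft_comp_assoc, ih, MonoidalCategory.whiskerLeft_comp,
      Category.assoc, μ_natural_right, ← whisker_exchange_assoc, comp_whiskerRight_assoc,
      μ_natural_left_assoc, ← leftUnitor_inv_naturality_assoc,
      MonoidalCategory.tensorHom_def, F.map_comp, F.map_comp, left_unitality_inv_assoc]

lemma adjacentSwap_comparison (X : C) : ∀ n i : ℕ,
    adjacentSwap (F.obj X) n i ≫ tensorPowComparison F X n =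
      tensorPowComparison F X n ≫ F.map (adjacentSwap X n i)
  | 0, _ => by
    change 𝟙 _ ≫ _ = _ ≫ F.map (𝟙 _)
    rw [F.map_id, Category.comp_id, Category.id_comp]
  | 1, _ => by
    change 𝟙 _ ≫ _ = _ ≫ F.map (𝟙 _)
    rw [F.map_id, Category.comp_id, Category.id_comp]
  | n + 2, 0 => by
    change ((α_ _ _ (tensorPow (F.obj X) n)).inv ≫ (β_ _ _).hom ▷ tensorPow (F.obj X) n ≫
      (α_ _ _ (tensorPow (F.obj X) n)).hom) ≫
      F.obj X ◁ (F.obj X ◁ tensorPowComparison F X n ≫ μ F X (tensorPow X n)) ≫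
        μ F X (X ⊗ tensorPow X n) =
      (F.obj X ◁ (F.obj X ◁ tensorPowComparison F X n ≫ μ F X (tensorPow X n)) ≫
        μ F X (X ⊗ tensorPow X n)) ≫
      F.map ((α_ X X (tensorPow X n)).inv ≫ (β_ X X).hom ▷ tensorPow X n ≫
        (α_ X X (tensorPow X n)).hom)
    simp only [MonoidalCategory.whiskerLeft_comp, F.map_comp, Category.assoc]
    rw [← associator_naturality_right_assoc, ← whisker_exchange_assoc,
      ← associator_inv_naturality_right_assoc,
      Functor.LaxMonoidal.associativity_inv_assoc, ← Functor.LaxMonoidal.associativity, ← μ_natural_left_assoc, ← comp_whiskerRight_assoc, ← comp_whiskerRight_assoc,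
      Functor.LaxBraided.braided]
  | n + 2, i + 1 => by
    have ih := adjacentSwap_comparison X (n + 1) i
    change F.obj X ◁ adjacentSwap (F.obj X) (n + 1) i ≫
      F.obj X ◁ tensorPowComparison F X (n + 1) ≫ μ F X (tensorPow X (n + 1)) =
      (F.obj X ◁ tensorPowComparison F X (n + 1) ≫ μ F X (tensorPow X (n + 1))) ≫
        F.map (X ◁ adjacentSwap X (n + 1) i)
    rw [← MonoidalCategory.whiskerLeft_comp_assoc, ih, Category.assoc,
      ← μ_natural_right, MonoidalCategory.whiskerLeft_comp, Category.assoc]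

/-- Right exact symmetric monoidal functors detect the non-vanishing of powers. -/
theorem symPowHom_ne_zero_of_map [Abelian C] [Abelian D] [F.Additive] [PreservesFiniteColimits F]
    {X : C} (α : 𝟙_ C ⟶ X) (n : ℕ) (h : symPowHom (ε F ≫ F.map α) n ≠ 0) : symPowHom α n ≠ 0 := by
  intro h0
  obtain ⟨Q, q, hq, hne⟩ := (symPow.symPowHom_ne_zero_iff _ _).1 h
  obtain ⟨m, hm⟩ := symPow.exists_map_desc F (inv (tensorPowComparison F X n) ≫ q) fun i => by
    rw [← cancel_epi (tensorPowComparison F X n), ← Category.assoc, ← adjacentSwap_comparison]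
    simp [hq]
  apply hne
  have : q = tensorPowComparison F X n ≫ F.map (symPow.π X n) ≫ m := by
    rw [hm, IsIso.hom_inv_id_assoc]
  rw [this, ← Category.assoc, tensorPowHom_comparison, Category.assoc, ← F.map_comp_assoc,
    symPow.tensorPowHom_π, h0, F.map_zero, zero_comp, comp_zero]

/-- The tensor powers of a linear form. -/
def tensorPowForm {X : C} (r : X ⟶ 𝟙_ C) : ∀ n : ℕ, tensorPow X n ⟶ 𝟙_ C
  | 0 => 𝟙 _
  | n + 1 => X ◁ tensorPowForm r n ≫ (ρ_ X).hom ≫ r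

lemma tensorPowHom_form {X : C} {α : 𝟙_ C ⟶ X} {r : X ⟶ 𝟙_ C} (h : α ≫ r = 𝟙 _) :
    ∀ n : ℕ, tensorPowHom α n ≫ tensorPowForm r n = 𝟙 _
  | 0 => Category.comp_id _
  | n + 1 => by
    change ((λ_ (𝟙_ C)).inv ≫ (α ⊗ₘ tensorPowHom α n)) ≫ X ◁ tensorPowForm r n ≫ (ρ_ X).hom ≫ r =
      𝟙 _
    rw [MonoidalCategory.tensorHom_def, Category.assoc, Category.assoc,
      ← MonoidalCategory.whiskerLeft_comp_assoc, tensorPowHom_form h n]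
    rw [MonoidalCategory.whiskerLeft_id, Category.id_comp, rightUnitor_naturality_assoc, h,
      Category.comp_id, ← unitors_equal, Iso.inv_hom_id]

lemma adjacentSwap_form {X : C} (r : X ⟶ 𝟙_ C) : ∀ n i : ℕ,
    adjacentSwap X n i ≫ tensorPowForm r n = tensorPowForm r n
  | 0, _ => Category.id_comp _
  | 1, _ => Category.id_comp _
  | n + 2, 0 => by
    change ((α_ X X (tensorPow X n)).inv ≫ (β_ X X).hom ▷ tensorPow X n ≫
      (α_ X X (tensorPow X n)).hom) ≫ X ◁ (X ◁ tensorPowForm r n ≫ (ρ_ X).hom ≫ r) ≫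
        (ρ_ X).hom ≫ r = X ◁ (X ◁ tensorPowForm r n ≫ (ρ_ X).hom ≫ r) ≫ (ρ_ X).hom ≫ r
    have e : (β_ X X).hom ≫ X ◁ r ≫ (ρ_ X).hom ≫ r = X ◁ r ≫ (ρ_ X).hom ≫ r := by
      rw [← BraidedCategory.braiding_naturality_left_assoc, braiding_rightUnitor_assoc,
        ← leftUnitor_naturality, ← whisker_exchange_assoc, unitors_equal,
        rightUnitor_naturality]
    have e' : X ◁ (ρ_ X).hom = (α_ X X (𝟙_ C)).inv ≫ (ρ_ (X ⊗ X)).hom := by simp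
    simp only [MonoidalCategory.whiskerLeft_comp, Category.assoc]
    rw [← associator_naturality_right_assoc, ← whisker_exchange_assoc,
      ← associator_inv_naturality_right_assoc, e']
    simp only [Category.assoc, Iso.hom_inv_id_assoc]
    rw [rightUnitor_naturality_assoc, e]
  | n + 2, i + 1 => by
    change X ◁ adjacentSwap X (n + 1) i ≫ X ◁ tensorPowForm r (n + 1) ≫ (ρ_ X).hom ≫ r =
      X ◁ tensorPowForm r (n + 1) ≫ (ρ_ X).hom ≫ r
    rw [← MonoidalCategory.whiskerLeft_comp_assoc, adjacentSwap_form r (n + 1) i]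

/-- The tensor power of `r` is a symmetric form with value `1` on the tensor power of `α`. -/
theorem symPowHom_ne_zero_of_retraction [Abelian C] (h1 : 𝟙 (𝟙_ C) ≠ 0) {X : C} {α : 𝟙_ C ⟶ X}
    {r : X ⟶ 𝟙_ C} (h : α ≫ r = 𝟙 _) (n : ℕ) : symPowHom α n ≠ 0 :=
  (symPow.symPowHom_ne_zero_iff _ _).2
    ⟨_, tensorPowForm r n, adjacentSwap_form r n, by rwa [tensorPowHom_form h]⟩

end Transfer

/-- `F` splits the sequence `𝟙 ⟶ X ⟶ coker α`, which gives `F α` a retraction; nonvanishing is then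
pulled back along `F`. -/
theorem IsLocallySemisimple.symPowHom_ne_zero (k : Type w) [Field k] {T : Type u} [Category.{v} T]
    [MonoidalCategory T] [SymmetricCategory T] [Abelian T] [Linear k T] [IsTensorCategory k T]
    (hT : IsLocallySemisimple k T) {X : T} (α : 𝟙_ T ⟶ X) (hα : α ≠ 0) (n : ℕ) :
    symPowHom α n ≠ 0 := by
  obtain ⟨C, _, _, _, _, _, hC, F, _, hF, hsplit⟩ := hT
  have := hF.rightExact
  have := hF.toAdditive
  have := IsTensorCategory.mono_of_ne_zero k α hα
  let S : ShortComplex T := ShortComplex.mk α (cokernel.π α) (cokernel.condition α)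
  have hS : S.ShortExact := { exact := S.exact_of_g_is_cokernel (cokernelIsCokernel α) }
  obtain ⟨s⟩ := hsplit S hS
  apply symPowHom_ne_zero_of_map F
  let r : F.obj X ⟶ F.obj (𝟙_ T) := s.r
  refine symPowHom_ne_zero_of_retraction (r := r ≫ Functor.OplaxMonoidal.η F) ?_ ?_ n
  · exact fun h => hC.not_isZero_unit ((IsZero.iff_id_eq_zero _).2 h)
  · have : F.map α ≫ r = 𝟙 _ := s.f_r
    rw [Category.assoc, reassoc_of% this, Functor.Monoidal.ε_η]

/-! ### Passage to a small model. -/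

namespace IsTensorCategory

section SmallCat

variable (T : Type u) [Category.{v} T] [EssentiallySmall.{v} T]

/-- The full subcategory of `T` on a small set of representatives. -/
abbrev SmallSub : Type v :=
  InducedCategory T (fun X : SmallModel.{v} T => (equivSmallModel.{v} T).inverse.obj X)

instance : (inducedFunctor
    (fun X : SmallModel.{v} T => (equivSmallModel.{v} T).inverse.obj X)).EssSurj where
  mem_essImage X := ⟨(equivSmallModel.{v} T).functor.obj X,
    ⟨(equivSmallModel.{v} T).unitIso.symm.app X⟩⟩

instance : (inducedFunctor
    (fun X : SmallModel.{v} T => (equivSmallModel.{v} T).inverse.obj X)).IsEquivalence where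

/-- The equivalence of `T` with a small category. -/
def smallSubEquiv : T ≌ SmallSub T :=
  (inducedFunctor
    (fun X : SmallModel.{v} T => (equivSmallModel.{v} T).inverse.obj X)).asEquivalence.symm

variable [MonoidalCategory T]

/-- A small monoidal category equivalent to `T`. -/
abbrev Small : Type v := Monoidal.Transported (smallSubEquiv T)

/-- The monoidal equivalence with a small category. -/
abbrev smallEquiv : T ≌ Small T := Monoidal.equivalenceTransported (smallSubEquiv T)

instance [Preadditive T] : Preadditive (Small T) := inferInstanceAs (Preadditive (SmallSub T))

instance (k : Type w) [Field k] [Preadditive T] [Linear k T] : Linear k (Small T) :=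
  inferInstanceAs (Linear k (SmallSub T))

instance [Preadditive T] : (smallEquiv T).inverse.Additive :=
  inferInstanceAs (inducedFunctor
    (fun X : SmallModel.{v} T => (equivSmallModel.{v} T).inverse.obj X)).Additive

instance (k : Type w) [Field k] [Preadditive T] [Linear k T] : (smallEquiv T).inverse.Linear k :=
  inferInstanceAs ((inducedFunctor
    (fun X : SmallModel.{v} T => (equivSmallModel.{v} T).inverse.obj X)).Linear k)

instance [Abelian T] : Abelian (Small T) :=
  have : HasFiniteProducts (Small T) := ⟨fun _ =>
    Adjunction.hasLimitsOfShape_of_equivalence (smallEquiv T).inverse⟩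
  abelianOfEquivalence (smallEquiv T).inverse

end SmallCat

variable (k : Type w) [Field k] {T : Type u} [Category.{v} T] [MonoidalCategory T]
  [SymmetricCategory T] [Abelian T] [Linear k T] [IsTensorCategory k T]

open Functor.LaxMonoidal

/-- Germs are families indexed by all pointed objects. Over a small model these families, and the
natural transformations between their functors, stay in the universe of the morphisms. -/
theorem isLocallySemisimple_of_symPowHom_ne_zero
    (h : ∀ (X : T) (α : 𝟙_ T ⟶ X) (n : ℕ), α ≠ 0 → symPowHom α n ≠ 0) :
    IsLocallySemisimple k T := by
  have hT : IsLinearSymmetricMonoidal k T := inferInstance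
  have := hT.toMonoidalPreadditive
  have := hT.toMonoidalLinear
  have := essentiallySmall k (T := T)
  let G : Small T ⥤ T := (smallEquiv T).inverse
  let F : T ⥤ Small T := (smallEquiv T).functor
  have : (smallEquiv T).symm.functor.Additive := inferInstanceAs G.Additive
  have : (smallEquiv T).symm.functor.Linear k := inferInstanceAs (G.Linear k)
  have hadd : F.Additive := Equivalence.inverse_additive (smallEquiv T).symm
  have hlin : F.Linear k := Equivalence.inverseLinear k (smallEquiv T).symm
  have : MonoidalPreadditive (Small T) := monoidalPreadditive_of_faithful G
  have : MonoidalLinear k (Small T) := MonoidalLinear.ofFaithful k G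
  have (X : Small T) : PreservesFiniteColimits (tensorLeft X) := by
    have := hT.rightExact_tensorLeft (G.obj X)
    have : PreservesFiniteColimits (tensorLeft X ⋙ G) :=
      preservesFiniteColimits_of_natIso (F := G ⋙ tensorLeft (G.obj X))
        (NatIso.ofComponents (fun Y => Functor.Monoidal.μIso G X Y))
    exact ⟨fun J _ _ => preservesColimitsOfShape_of_reflects_of_preserves (tensorLeft X) G⟩
  have hα (X : Small T) (α : 𝟙_ (Small T) ⟶ X) (hα : α ≠ 0) : ε G ≫ G.map α ≠ 0 := fun h0 =>
    hα (by
      apply G.map_injective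
      rw [← cancel_epi (ε G), h0, G.map_zero, comp_zero])
  refine isLocallySemisimple_of_functor k (Small T) F ?_ ?_ ?_
  · intro h0
    have := congrArg G.map h0
    rw [G.map_id, G.map_zero] at this
    have h1 : 𝟙 (𝟙_ T) = ε G ≫ 𝟙 _ ≫ Functor.OplaxMonoidal.η G := by simp
    rw [this, zero_comp, comp_zero] at h1
    exact id_unit_ne_zero k h1
  · intro X α hX
    have := mono_of_ne_zero k _ (hα X α hX)
    have : Mono (G.map α) := by
      have e : G.map α = Functor.OplaxMonoidal.η G ≫ ε G ≫ G.map α := by simp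
      rw [e]
      infer_instance
    exact G.mono_of_mono_map this
  · intro X α n hX
    exact symPowHom_ne_zero_of_map G α n (h _ _ n (hα X α hX))

end IsTensorCategory

/-! ### Counting partitions into blocks of size `p`, modulo `p`. -/

/-- Labelings of `X` by `Fin m` using each label `p` times. -/
abbrev Labeling (X : Type u) [Fintype X] (m p : ℕ) : Type u :=
  {l : X → Fin m // ∀ c, (Finset.univ.filter fun x => l x = c).card = p}

namespace Labeling

variable {X Y : Type u} [Fintype X] [Fintype Y] {m p : ℕ}

/-- Labelings which differ by a permutation of the labels. -/
instance setoid (X : Type u) [Fintype X] (m p : ℕ) : Setoid (Labeling X m p) where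
  r l l' := ∃ g : Equiv.Perm (Fin m), g ∘ l.1 = l'.1
  iseqv :=
    { refl := fun l => ⟨1, rfl⟩
      symm := fun ⟨g, hg⟩ => ⟨g⁻¹, by
        rw [← hg, ← Function.comp_assoc]
        ext x
        simp⟩
      trans := fun ⟨g, hg⟩ ⟨h, hh⟩ => ⟨h * g, by rw [← hh, ← hg]; rfl⟩ }

variable (X m p) in
/-- Partitions of `X` into `m` blocks of cardinality `p`. -/
abbrev Part : Type u := Quotient (setoid X m p)

instance : Fintype (Part X m p) := Fintype.ofFinite _

/-- Precomposition with a bijection. -/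
def precomp (l : Labeling X m p) (e : Y ≃ X) : Labeling Y m p :=
  ⟨l.1 ∘ e, fun c => by
    refine Eq.trans ?_ (l.2 c)
    exact Finset.card_equiv e (by simp)⟩

/-- Precomposition with a bijection. -/
def partComp (P : Part X m p) (e : Y ≃ X) : Part Y m p :=
  Quotient.map (fun l : Labeling X m p => precomp l e)
    (by
      rintro l l' ⟨g, hg⟩
      exact ⟨g, congrArg (· ∘ e) hg⟩) P

/-- Precomposition with a bijection, as a bijection. -/
def partCongr (e : Y ≃ X) : Part X m p ≃ Part Y m p where
  toFun P := partComp P e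
  invFun P := partComp P e.symm
  left_inv P := by
    obtain ⟨l, rfl⟩ := Quotient.exists_rep P
    exact congrArg (Quotient.mk _) (Subtype.ext (by ext; simp [precomp]))
  right_inv P := by
    obtain ⟨l, rfl⟩ := Quotient.exists_rep P
    exact congrArg (Quotient.mk _) (Subtype.ext (by ext; simp [precomp]))

section Count

variable (m p)

/-- Translations of the rows. -/
def rowShift (g : Fin m → ZMod p) : Equiv.Perm (Fin m × ZMod p) where
  toFun x := (x.1, x.2 + g x.1)
  invFun x := (x.1, x.2 - g x.1)
  left_inv x := by simp
  right_inv x := by simp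

variable [Fact p.Prime]

instance : MulAction (Multiplicative (Fin m → ZMod p)) (Part (Fin m × ZMod p) m p) where
  smul g P := partComp P (rowShift m p g.toAdd)
  one_smul P := by
    obtain ⟨l, rfl⟩ := Quotient.exists_rep P
    refine congrArg (Quotient.mk _) (Subtype.ext ?_)
    ext ⟨i, a⟩
    simp [precomp, rowShift]
  mul_smul g h P := by
    obtain ⟨l, rfl⟩ := Quotient.exists_rep P
    refine congrArg (Quotient.mk _) (Subtype.ext ?_)
    ext ⟨i, a⟩
    simp [precomp, rowShift, add_assoc]

/-- The labeling of a product by the rows. -/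
def rows : Labeling (Fin m × ZMod p) m p :=
  ⟨Prod.fst, fun c => by
    have : (Finset.univ.filter fun x : Fin m × ZMod p => x.1 = c) =
        Finset.univ.map ⟨fun a => (c, a), fun a b h => by simpa using h⟩ := by
      ext ⟨i, a⟩
      rw [Finset.mem_filter, Finset.mem_map]
      constructor
      · rintro ⟨-, rfl⟩
        exact ⟨a, Finset.mem_univ _, rfl⟩
      · rintro ⟨b, -, h⟩
        exact ⟨Finset.mem_univ _, (congrArg Prod.fst h).symm⟩
    rw [this, Finset.card_map, Finset.card_univ, ZMod.card]⟩

variable {m p}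

/-- Suppose a block of an invariant partition contains `(i, 0)` and `(j, b)` with `i ≠ j`.
Translating row `i` alone fixes `(j, b)`, hence the block, which then contains all of row `i` and
one more point. That exceeds `p` points. -/
lemma eq_rows (l : Labeling (Fin m × ZMod p) m p)
    (h : ∀ g : Fin m → ZMod p, (Quotient.mk (setoid _ m p) (precomp l (rowShift m p g))) =
      Quotient.mk _ l) : Quotient.mk (setoid _ m p) l = Quotient.mk _ (rows m p) := by
  have h1 : ∀ i j : Fin m, ∀ b : ZMod p, l.1 (i, 0) = l.1 (j, b) → i = j := by
    intro i j b hij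
    by_contra hne
    obtain ⟨s, hs⟩ := Quotient.exact (h (Pi.single i 1))
    have hs' : ∀ x, s (l.1 (rowShift m p (Pi.single i 1) x)) = l.1 x := fun x => congrFun hs x
    have hsj : s (l.1 (j, b)) = l.1 (j, b) := by
      have := hs' (j, b)
      simpa [rowShift, Pi.single_apply, Ne.symm hne] using this
    have hrow : ∀ n : ℕ, l.1 (i, (n : ZMod p)) = l.1 (j, b) := by
      intro n
      induction n with
      | zero => simpa using hij
      | succ n ih =>
        have := hs' (i, (n : ZMod p))
        have h2 : rowShift m p (Pi.single i 1) (i, (n : ZMod p)) = (i, ((n + 1 : ℕ) : ZMod p)) := by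
          simp [rowShift]
        rw [h2, ih] at this
        exact s.injective (this.trans hsj.symm)
    have hc := l.2 (l.1 (j, b))
    have hlt : (Finset.univ.map ⟨fun a : ZMod p => (i, a), fun a b h => by simpa using h⟩).card <
        (Finset.univ.filter fun x => l.1 x = l.1 (j, b)).card := by
      apply Finset.card_lt_card
      refine ⟨fun x hx => ?_, fun hsub => ?_⟩
      · obtain ⟨a, -, rfl⟩ := Finset.mem_map.1 hx
        refine Finset.mem_filter.2 ⟨Finset.mem_univ _, ?_⟩
        have := hrow a.val
        rwa [ZMod.natCast_zmod_val] at this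
      · have := hsub (Finset.mem_filter.2 ⟨Finset.mem_univ (j, b), rfl⟩)
        obtain ⟨a, -, ha⟩ := Finset.mem_map.1 this
        exact hne (congrArg Prod.fst ha)
    rw [hc, Finset.card_map, Finset.card_univ, ZMod.card] at hlt
    exact lt_irrefl _ hlt
  -- The zero column therefore carries each label once, and each row has the label of its entry in
  -- that column.
  have hinj : Function.Injective fun i : Fin m => l.1 (i, 0) := fun i j hij => h1 i j 0 hij
  let s : Equiv.Perm (Fin m) := Equiv.ofBijective _ (Finite.injective_iff_bijective.1 hinj)
  refine (Quotient.sound (s := setoid _ m p) (Exists.intro s ?_)).symm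
  ext ⟨j, b⟩
  obtain ⟨i, hi⟩ := s.surjective (l.1 (j, b))
  have hij : i = j := h1 i j b hi
  subst hij
  exact congrArg Fin.val hi

/-- The `p`-group of row translations has the partition into rows as its only fixed point. -/
lemma card_part_prod : Nat.card (Part (Fin m × ZMod p) m p) ≡ 1 [MOD p] := by
  have hG : IsPGroup p (Multiplicative (Fin m → ZMod p)) :=
    IsPGroup.of_card (n := m) (by simp)
  have h := hG.card_modEq_card_fixedPoints (Part (Fin m × ZMod p) m p)
  have h1 : Nat.card (MulAction.fixedPoints (Multiplicative (Fin m → ZMod p))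
      (Part (Fin m × ZMod p) m p)) = 1 := by
    rw [Nat.card_eq_one_iff_unique]
    constructor
    · constructor
      have : ∀ x : MulAction.fixedPoints (Multiplicative (Fin m → ZMod p))
          (Part (Fin m × ZMod p) m p), x.1 = Quotient.mk _ (rows m p) := by
        rintro ⟨P, hP⟩
        obtain ⟨l, rfl⟩ := Quotient.exists_rep P
        exact eq_rows l fun g => hP (Multiplicative.ofAdd g)
      intro x y
      exact Subtype.ext ((this x).trans (this y).symm)
    · exact ⟨⟨Quotient.mk _ (rows m p), fun g => rfl⟩⟩
  rwa [h1] at h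

/-- The number of partitions into blocks of cardinality `p` is `1` modulo `p`. -/
theorem natCast_card_part (k : Type w) [Field k] [CharP k p] (m : ℕ) :
    (Fintype.card (Part (Fin (m * p)) m p) : k) = 1 := by
  have e : Fin m × ZMod p ≃ Fin (m * p) := Fintype.equivFinOfCardEq (by simp [ZMod.card])
  have h := card_part_prod (m := m) (p := p)
  rw [← Nat.card_congr (partCongr e), Nat.card_eq_fintype_card] at h
  rw [← Nat.cast_one]
  exact (CharP.natCast_eq_natCast k p).2 h

end Count

end Labeling

/-! ### Actions on single factors of a tensor power, and words of such actions. -/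

namespace Slots

section Exch

variable {C : Type u} [Category.{v} C] [MonoidalCategory C] [SymmetricCategory C]

/-- The exchange of the first two of three factors. -/
def exch (E A P : C) : E ⊗ (A ⊗ P) ⟶ A ⊗ (E ⊗ P) :=
  (α_ E A P).inv ≫ (β_ E A).hom ▷ P ≫ (α_ A E P).hom

lemma exch_naturality_right (E A : C) {P Q : C} (f : P ⟶ Q) :
    E ◁ A ◁ f ≫ exch E A Q = exch E A P ≫ A ◁ E ◁ f := by
  simp only [exch, Category.assoc]
  rw [associator_inv_naturality_right_assoc, whisker_exchange_assoc, associator_naturality_right]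

lemma exch_naturality_right_assoc (E A : C) {P Q Z : C} (f : P ⟶ Q) (h : A ⊗ (E ⊗ Q) ⟶ Z) :
    E ◁ A ◁ f ≫ exch E A Q ≫ h = exch E A P ≫ A ◁ E ◁ f ≫ h := by
  rw [← Category.assoc, exch_naturality_right, Category.assoc]

lemma exch_naturality_middle (E : C) {A B : C} (g : A ⟶ B) (P : C) :
    E ◁ g ▷ P ≫ exch E B P = exch E A P ≫ g ▷ (E ⊗ P) := by
  simp only [exch, Category.assoc]
  rw [associator_inv_naturality_middle_assoc, ← comp_whiskerRight_assoc,
    BraidedCategory.braiding_naturality_right, comp_whiskerRight_assoc,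
    associator_naturality_left]

lemma exch_naturality_middle_assoc (E : C) {A B : C} (g : A ⟶ B) (P : C) {Z : C}
    (h : B ⊗ (E ⊗ P) ⟶ Z) :
    E ◁ g ▷ P ≫ exch E B P ≫ h = exch E A P ≫ g ▷ (E ⊗ P) ≫ h := by
  rw [← Category.assoc, exch_naturality_middle, Category.assoc]

lemma exch_naturality_left {E F : C} (g : E ⟶ F) (A P : C) :
    g ▷ (A ⊗ P) ≫ exch F A P = exch E A P ≫ A ◁ g ▷ P := by
  simp only [exch, Category.assoc]
  rw [associator_inv_naturality_left_assoc, ← comp_whiskerRight_assoc,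
    BraidedCategory.braiding_naturality_left, comp_whiskerRight_assoc,
    associator_naturality_middle]

@[simp]
lemma exch_exch (E A P : C) : exch E A P ≫ exch A E P = 𝟙 _ := by
  simp [exch, ← comp_whiskerRight_assoc]

@[simp]
lemma exch_exch_assoc (E A P : C) {Z : C} (h : E ⊗ (A ⊗ P) ⟶ Z) :
    exch E A P ≫ exch A E P ≫ h = h := by
  rw [← Category.assoc, exch_exch, Category.id_comp]

lemma exch_assoc (E F A P : C) :
    exch E F (A ⊗ P) ≫ F ◁ (α_ E A P).inv ≫ (α_ F (E ⊗ A) P).inv =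
      E ◁ (α_ F A P).inv ≫ (α_ E (F ⊗ A) P).inv ≫ exch E F A ▷ P := by
  simp only [exch]
  monoidal

lemma whiskerLeft_exch_assoc (E F A P : C) :
    F ◁ exch E A P ≫ F ◁ (α_ A E P).inv ≫ (α_ F (A ⊗ E) P).inv =
      F ◁ (α_ E A P).inv ≫ (α_ F (E ⊗ A) P).inv ≫ (F ◁ (β_ E A).hom) ▷ P := by
  simp only [exch]
  monoidal

lemma exch_yang_baxter (E F A P : C) :
    exch E F (A ⊗ P) ≫ F ◁ exch E A P ≫ exch F A (E ⊗ P) =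
      E ◁ exch F A P ≫ exch E A (F ⊗ P) ≫ A ◁ exch E F P := by
  have h := BraidedCategory.yang_baxter E F A
  have h' : exch E F A ≫ F ◁ (β_ E A).hom ≫ exch F A E =
      E ◁ (β_ F A).hom ≫ exch E A F ≫ A ◁ (β_ E F).hom := by
    simpa [exch] using h
  rw [← cancel_mono (A ◁ (α_ F E P).inv ≫ (α_ A (F ⊗ E) P).inv)]
  simp only [Category.assoc]
  rw [exch_assoc, whiskerLeft_exch_assoc, reassoc_of% (whiskerLeft_exch_assoc E F A P),
    reassoc_of% (exch_assoc E F A P), reassoc_of% (exch_assoc E A F P),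
    reassoc_of% (whiskerLeft_exch_assoc F E A P)]
  simp only [← comp_whiskerRight, h']

lemma exch_tensor_middle (E F A P : C) :
    exch E (F ⊗ A) P = E ◁ (α_ F A P).hom ≫ exch E F (A ⊗ P) ≫ F ◁ exch E A P ≫
      (α_ F A (E ⊗ P)).inv := by
  simp only [exch, BraidedCategory.braiding_tensor_right_hom]
  monoidal

lemma exch_tensor_left (E F A P : C) :
    exch (E ⊗ F) A P = (α_ E F (A ⊗ P)).hom ≫ E ◁ exch F A P ≫ exch E A (F ⊗ P) ≫
      A ◁ (α_ E F P).inv := by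
  simp only [exch, BraidedCategory.braiding_tensor_left_hom]
  monoidal

/-- The insertion of a point as a new factor. -/
def el {X : C} (α : 𝟙_ C ⟶ X) (P : C) : P ⟶ X ⊗ P := (λ_ P).inv ≫ α ▷ P

lemma el_naturality {X : C} (α : 𝟙_ C ⟶ X) {P Q : C} (f : P ⟶ Q) :
    el α P ≫ X ◁ f = f ≫ el α Q := by
  simp [el, ← whisker_exchange]

lemma el_naturality_assoc {X : C} (α : 𝟙_ C ⟶ X) {P Q Z : C} (f : P ⟶ Q) (h : X ⊗ Q ⟶ Z) :
    el α P ≫ X ◁ f ≫ h = f ≫ el α Q ≫ h := by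
  rw [← Category.assoc, el_naturality, Category.assoc]

lemma el_whiskerRight {X Y : C} (α : 𝟙_ C ⟶ X) (g : X ⟶ Y) (P : C) :
    el α P ≫ g ▷ P = el (α ≫ g) P := by
  simp [el]

lemma el_whiskerRight_assoc {X Y : C} (α : 𝟙_ C ⟶ X) (g : X ⟶ Y) (P : C) {Z : C}
    (h : Y ⊗ P ⟶ Z) : el α P ≫ g ▷ P ≫ h = el (α ≫ g) P ≫ h := by
  rw [← Category.assoc, el_whiskerRight]

lemma el_associator_inv {X : C} (α : 𝟙_ C ⟶ X) (A P : C) :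
    el α (A ⊗ P) ≫ (α_ X A P).inv = el α A ▷ P := by
  simp [el]

lemma el_associator_inv_assoc {X : C} (α : 𝟙_ C ⟶ X) (A P : C) {Z : C}
    (h : (X ⊗ A) ⊗ P ⟶ Z) : el α (A ⊗ P) ≫ (α_ X A P).inv ≫ h = el α A ▷ P ≫ h := by
  rw [← Category.assoc, el_associator_inv]

lemma el_exch {X : C} (α : 𝟙_ C ⟶ X) (A P : C) :
    el α (A ⊗ P) ≫ exch X A P = A ◁ el α P := by
  have h : (λ_ (A ⊗ P)).inv ≫ exch (𝟙_ C) A P = A ◁ (λ_ P).inv := by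
    simp only [exch, braiding_tensorUnit_left]
    monoidal
  rw [el, Category.assoc, exch_naturality_left, reassoc_of% h, el,
    MonoidalCategory.whiskerLeft_comp]

lemma el_exch_assoc {X : C} (α : 𝟙_ C ⟶ X) (A P : C) {Z : C} (h : A ⊗ (X ⊗ P) ⟶ Z) :
    el α (A ⊗ P) ≫ exch X A P ≫ h = A ◁ el α P ≫ h := by
  rw [← Category.assoc, el_exch]

lemma tensorPowHom_succ {X : C} (α : 𝟙_ C ⟶ X) (n : ℕ) :
    tensorPowHom α (n + 1) = tensorPowHom α n ≫ el α (tensorPow X n) := by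
  rw [← el_naturality]
  change (λ_ (𝟙_ C)).inv ≫ (α ⊗ₘ tensorPowHom α n) = ((λ_ _).inv ≫ α ▷ _) ≫ X ◁ _
  rw [MonoidalCategory.tensorHom_def, Category.assoc]

lemma tensorPowHom_adjacentSwap {X : C} (α : 𝟙_ C ⟶ X) : ∀ n i : ℕ,
    tensorPowHom α n ≫ adjacentSwap X n i = tensorPowHom α n
  | 0, _ => Category.comp_id _
  | 1, _ => Category.comp_id _
  | n + 2, 0 => by
    rw [tensorPowHom_succ, tensorPowHom_succ]
    change ((tensorPowHom α n ≫ el α (tensorPow X n)) ≫ el α (X ⊗ tensorPow X n)) ≫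
      exch X X (tensorPow X n) =
      (tensorPowHom α n ≫ el α (tensorPow X n)) ≫ el α (X ⊗ tensorPow X n)
    rw [Category.assoc, el_exch, Category.assoc, Category.assoc, el_naturality]
  | n + 2, i + 1 => by
    rw [tensorPowHom_succ]
    change (tensorPowHom α (n + 1) ≫ el α (tensorPow X (n + 1))) ≫
      X ◁ adjacentSwap X (n + 1) i = tensorPowHom α (n + 1) ≫ el α (tensorPow X (n + 1))
    rw [Category.assoc, el_naturality, ← Category.assoc, tensorPowHom_adjacentSwap α (n + 1) i]

end Exch

section Act

variable {C : Type u} [Category.{v} C] [MonoidalCategory C] [SymmetricCategory C]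
  {E A : C}

/-- Two actions of `E` commute. -/
def ActComm {M : C} (a b : E ⊗ M ⟶ M) : Prop := exch E E M ≫ E ◁ a ≫ b = E ◁ b ≫ a

lemma ActComm.symm {M : C} {a b : E ⊗ M ⟶ M} (h : ActComm a b) : ActComm b a := by
  unfold ActComm at *
  rw [← h, exch_exch_assoc]

/-- The action on the second factor. -/
def liftAct (A : C) {P : C} (a : E ⊗ P ⟶ P) : E ⊗ (A ⊗ P) ⟶ A ⊗ P := exch E A P ≫ A ◁ a

/-- The action on the first factor. -/
def headAct (y : E ⊗ A ⟶ A) (P : C) : E ⊗ (A ⊗ P) ⟶ A ⊗ P := (α_ E A P).inv ≫ y ▷ P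

lemma ActComm.liftAct {P : C} {a b : E ⊗ P ⟶ P} (h : ActComm a b) :
    ActComm (liftAct A a) (liftAct A b) := by
  unfold ActComm Slots.liftAct at *
  simp only [MonoidalCategory.whiskerLeft_comp, Category.assoc]
  rw [exch_naturality_right_assoc, exch_naturality_right_assoc,
    reassoc_of% (exch_yang_baxter E E A P), ← MonoidalCategory.whiskerLeft_comp,
    ← MonoidalCategory.whiskerLeft_comp, h, MonoidalCategory.whiskerLeft_comp]

lemma ActComm.headAct {y y' : E ⊗ A ⟶ A} (h : ActComm y y') (P : C) :
    ActComm (headAct y P) (headAct y' P) := by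
  unfold ActComm Slots.headAct at *
  simp only [MonoidalCategory.whiskerLeft_comp, Category.assoc]
  rw [associator_inv_naturality_middle_assoc, associator_inv_naturality_middle_assoc,
    reassoc_of% (exch_assoc E E A P), ← comp_whiskerRight, ← comp_whiskerRight,
    ← comp_whiskerRight, h]

lemma actComm_head_lift (y : E ⊗ A ⟶ A) {P : C} (a : E ⊗ P ⟶ P) :
    ActComm (headAct y P) (liftAct A a) := by
  unfold ActComm headAct liftAct
  simp only [MonoidalCategory.whiskerLeft_comp, Category.assoc]
  rw [exch_naturality_middle_assoc, exch_tensor_middle, associator_inv_naturality_right_assoc]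
  simp only [Category.assoc, whisker_exchange]
  rw [← MonoidalCategory.whiskerLeft_comp_assoc, Iso.inv_hom_id, MonoidalCategory.whiskerLeft_id,
    Category.id_comp, exch_exch_assoc]

lemma headAct_exch (y : E ⊗ A ⟶ A) (P : C) :
    headAct y (A ⊗ P) ≫ exch A A P = E ◁ exch A A P ≫ liftAct A (headAct y P) := by
  unfold headAct liftAct
  rw [Category.assoc, exch_naturality_left, exch_tensor_left]
  simp

lemma liftAct_headAct_exch (y : E ⊗ A ⟶ A) (P : C) :
    liftAct A (headAct y P) ≫ exch A A P = E ◁ exch A A P ≫ headAct y (A ⊗ P) := by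
  have h := headAct_exch y P
  calc liftAct A (headAct y P) ≫ exch A A P
      = E ◁ (exch A A P ≫ exch A A P) ≫ liftAct A (headAct y P) ≫ exch A A P := by simp
    _ = E ◁ exch A A P ≫ (headAct y (A ⊗ P) ≫ exch A A P) ≫ exch A A P := by
      rw [h]; simp only [MonoidalCategory.whiskerLeft_comp, Category.assoc]
    _ = E ◁ exch A A P ≫ headAct y (A ⊗ P) := by simp

lemma liftAct_liftAct_exch {P : C} (a : E ⊗ P ⟶ P) :
    liftAct A (liftAct A a) ≫ exch A A P = E ◁ exch A A P ≫ liftAct A (liftAct A a) := by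
  unfold liftAct
  simp only [MonoidalCategory.whiskerLeft_comp, Category.assoc]
  rw [exch_naturality_right, reassoc_of% (exch_yang_baxter E A A P)]

variable [Preadditive C] [MonoidalPreadditive C]

/-- The action on the `i`-th factor of a tensor power. -/
def slot (y : E ⊗ A ⟶ A) : ∀ m : ℕ, ℕ → (E ⊗ tensorPow A m ⟶ tensorPow A m)
  -- A default value: there is no factor to act on.
  | 0, _ => 0
  | m + 1, 0 => headAct y (tensorPow A m)
  | m + 1, i + 1 => liftAct A (slot y m i)

/-- Actions on different factors always commute; on a common factor this is the hypothesis on `y`.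
-/
lemma slot_comm {y : E ⊗ A ⟶ A} (h : ActComm y y) : ∀ m i j : ℕ,
    ActComm (slot y m i) (slot y m j)
  | 0, _, _ => by
    change ActComm 0 0
    simp [ActComm]
  | m + 1, 0, 0 => h.headAct _
  | m + 1, 0, j + 1 => actComm_head_lift _ _
  | m + 1, i + 1, 0 => (actComm_head_lift _ _).symm
  | m + 1, i + 1, j + 1 => (slot_comm h m i j).liftAct

lemma slot_adjacentSwap (y : E ⊗ A ⟶ A) : ∀ m i j : ℕ, j + 1 < m →
    slot y m i ≫ adjacentSwap A m j =
      E ◁ adjacentSwap A m j ≫ slot y m (Equiv.swap j (j + 1) i)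
  | m + 2, 0, 0, _ => headAct_exch y _
  | m + 2, 1, 0, _ => by
    rw [show Equiv.swap 0 (0 + 1) 1 = 0 from Equiv.swap_apply_right 0 1]
    exact liftAct_headAct_exch y _
  | m + 2, i + 2, 0, _ => by
    rw [Equiv.swap_apply_of_ne_of_ne (by omega) (by omega)]
    exact liftAct_liftAct_exch _
  | m + 2, 0, j + 1, _ => by
    rw [Equiv.swap_apply_of_ne_of_ne (by omega) (by omega)]
    change headAct y (tensorPow A (m + 1)) ≫ A ◁ adjacentSwap A (m + 1) j =
      E ◁ A ◁ adjacentSwap A (m + 1) j ≫ headAct y (tensorPow A (m + 1))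
    simp only [headAct, Category.assoc]
    rw [← whisker_exchange, associator_inv_naturality_right_assoc]
  | m + 2, i + 1, j + 1, h => by
    have ih := slot_adjacentSwap y (m + 1) i j (by omega)
    have e : Equiv.swap (j + 1) (j + 1 + 1) (i + 1) = Equiv.swap j (j + 1) i + 1 := by
      simp only [Equiv.swap_apply_def]
      split_ifs <;> omega
    rw [e]
    change liftAct A (slot y (m + 1) i) ≫ A ◁ adjacentSwap A (m + 1) j =
      E ◁ A ◁ adjacentSwap A (m + 1) j ≫ liftAct A (slot y (m + 1) (Equiv.swap j (j + 1) i))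
    simp only [liftAct, Category.assoc]
    rw [exch_naturality_right_assoc, ← MonoidalCategory.whiskerLeft_comp, ih,
      MonoidalCategory.whiskerLeft_comp]

end Act

end Slots

namespace Slots

section Word

variable {C : Type u} [Category.{v} C] [MonoidalCategory C] [SymmetricCategory C]
  [Preadditive C] [MonoidalPreadditive C] {E A : C}

/-- The action of a word of slots on a tensor power of a point. -/
def word (y : E ⊗ A ⟶ A) (u : 𝟙_ C ⟶ A) (m : ℕ) :
    ∀ n : ℕ, (ℕ → ℕ) → (tensorPow E n ⟶ tensorPow A m)
  | 0, _ => tensorPowHom u m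
  | n + 1, l => E ◁ word y u m n (fun i => l (i + 1)) ≫ slot y m (l 0)

variable (y : E ⊗ A ⟶ A) (u : 𝟙_ C ⟶ A) (m : ℕ)

lemma word_congr : ∀ (n : ℕ) (l l' : ℕ → ℕ), (∀ i < n, l i = l' i) →
    word y u m n l = word y u m n l'
  | 0, _, _, _ => rfl
  | n + 1, l, l', h => by
    rw [word, word, h 0 (by omega), word_congr n _ (fun i => l' (i + 1)) fun i hi =>
      h (i + 1) (by omega)]

/-- Permuting the target factors renames the slots, because the starting tensor `u ⊗ ⋯ ⊗ u` is
symmetric. -/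
lemma word_adjacentSwap (j : ℕ) (hj : j + 1 < m) : ∀ (n : ℕ) (l : ℕ → ℕ),
    word y u m n l ≫ adjacentSwap A m j =
      word y u m n (fun i => Equiv.swap j (j + 1) (l i))
  | 0, _ => tensorPowHom_adjacentSwap u m j
  | n + 1, l => by
    have ih := word_adjacentSwap j hj n (fun i => l (i + 1))
    change (E ◁ word y u m n (fun i => l (i + 1)) ≫ slot y m (l 0)) ≫ adjacentSwap A m j =
      E ◁ word y u m n (fun i => Equiv.swap j (j + 1) (l (i + 1))) ≫
        slot y m (Equiv.swap j (j + 1) (l 0))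
    rw [Category.assoc, slot_adjacentSwap y m _ j hj, ← ih,
      MonoidalCategory.whiskerLeft_comp, Category.assoc]

-- Permuting the letters permutes the positions in the word. This is where commutativity of the
-- action enters.
variable {y} in
lemma adjacentSwap_word (h : ActComm y y) : ∀ (n j : ℕ) (l : ℕ → ℕ), j + 1 < n →
    adjacentSwap E n j ≫ word y u m n l = word y u m n (fun i => l (Equiv.swap j (j + 1) i))
  | n + 2, 0, l, _ => by
    change exch E E (tensorPow E n) ≫ E ◁ (E ◁ word y u m n (fun i => l (i + 2)) ≫
        slot y m (l 1)) ≫ slot y m (l 0) =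
      E ◁ (E ◁ word y u m n (fun i => l (Equiv.swap 0 (0 + 1) (i + 2))) ≫
        slot y m (l (Equiv.swap 0 (0 + 1) 1))) ≫ slot y m (l (Equiv.swap 0 (0 + 1) 0))
    have e : (fun i => l (Equiv.swap 0 (0 + 1) (i + 2))) = fun i => l (i + 2) := by
      funext i
      rw [Equiv.swap_apply_of_ne_of_ne (by omega) (by omega)]
    have e0 : Equiv.swap 0 (0 + 1) 0 = 1 := Equiv.swap_apply_left 0 1
    have e1 : Equiv.swap 0 (0 + 1) 1 = 0 := Equiv.swap_apply_right 0 1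
    have hc : exch E E _ ≫ E ◁ slot y m (l 1) ≫ slot y m (l 0) =
      E ◁ slot y m (l 0) ≫ slot y m (l 1) := slot_comm h m (l 1) (l 0)
    rw [e, e0, e1, MonoidalCategory.whiskerLeft_comp, MonoidalCategory.whiskerLeft_comp,
      Category.assoc, Category.assoc, ← exch_naturality_right_assoc, hc]
  | n + 2, j + 1, l, hj => by
    have ih := adjacentSwap_word h (n + 1) j (fun i => l (i + 1)) (by omega)
    change E ◁ adjacentSwap E (n + 1) j ≫ E ◁ word y u m (n + 1) (fun i => l (i + 1)) ≫
        slot y m (l 0) =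
      E ◁ word y u m (n + 1) (fun i => l (Equiv.swap (j + 1) (j + 1 + 1) (i + 1))) ≫
        slot y m (l (Equiv.swap (j + 1) (j + 1 + 1) 0))
    have e : (fun i => l (Equiv.swap (j + 1) (j + 1 + 1) (i + 1))) =
        fun i => l (Equiv.swap j (j + 1) i + 1) := by
      funext i
      congr 1
      simp only [Equiv.swap_apply_def]
      split_ifs <;> omega
    rw [e, Equiv.swap_apply_of_ne_of_ne (by omega) (by omega),
      ← MonoidalCategory.whiskerLeft_comp_assoc, ih]

variable (α : 𝟙_ C ⟶ E)

/-- The iterated action of a point. -/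
def power : ℕ → (𝟙_ C ⟶ A)
  | 0 => u
  | n + 1 => power n ≫ el α A ≫ y

/-- A product of powers in a tensor power. -/
def powers : ∀ m : ℕ, (ℕ → ℕ) → (𝟙_ C ⟶ tensorPow A m)
  | 0, _ => 𝟙 _
  | m + 1, c => powers m (fun i => c (i + 1)) ≫ el (power y u α (c 0)) (tensorPow A m)

lemma powers_const (i : ℕ) : ∀ m : ℕ, powers y u α m (fun _ => i) = tensorPowHom (power y u α i) m
  | 0 => rfl
  | m + 1 => by rw [tensorPowHom_succ, ← powers_const i m]; rfl

lemma powers_congr : ∀ (m : ℕ) (c c' : ℕ → ℕ), (∀ j < m, c j = c' j) →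
    powers y u α m c = powers y u α m c'
  | 0, _, _, _ => rfl
  | m + 1, c, c', h => by
    rw [powers, powers, h 0 (by omega), powers_congr m _ (fun i => c' (i + 1)) fun i hi =>
      h (i + 1) (by omega)]

lemma powers_slot : ∀ (m i : ℕ) (c : ℕ → ℕ), i < m →
    powers y u α m c ≫ el α _ ≫ slot y m i = powers y u α m (fun j => c j + if i = j then 1 else 0)
  | m + 1, 0, c, _ => by
    change (powers y u α m (fun i => c (i + 1)) ≫ el (power y u α (c 0)) (tensorPow A m)) ≫
      el α (A ⊗ tensorPow A m) ≫ headAct y (tensorPow A m) =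
      powers y u α m (fun i => c (i + 1)) ≫ el (power y u α (c 0 + 1)) (tensorPow A m)
    rw [headAct, el_associator_inv_assoc, Category.assoc, el_whiskerRight_assoc, el_whiskerRight,
      Category.assoc, power]
  | m + 1, i + 1, c, hi => by
    have ih := powers_slot m i (fun i => c (i + 1)) (by omega)
    have e : powers y u α (m + 1) (fun j => c j + if i + 1 = j then 1 else 0) =
        powers y u α m (fun j => c (j + 1) + if i = j then 1 else 0) ≫
          el (power y u α (c 0)) (tensorPow A m) := by
      have h0 : (fun j => c (j + 1) + if i + 1 = j + 1 then 1 else 0) =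
          fun j => c (j + 1) + if i = j then 1 else 0 := by
        funext j
        simp
      change powers y u α m (fun j => c (j + 1) + if i + 1 = j + 1 then 1 else 0) ≫
        el (power y u α (c 0)) (tensorPow A m) = _
      rw [h0]
    rw [e, ← ih]
    change (powers y u α m (fun i => c (i + 1)) ≫ el (power y u α (c 0)) (tensorPow A m)) ≫
      el α (A ⊗ tensorPow A m) ≫ liftAct A (slot y m i) = _
    rw [liftAct, el_exch_assoc, ← MonoidalCategory.whiskerLeft_comp, Category.assoc, el_naturality,
      Category.assoc, Category.assoc, Category.assoc]

/-- With all letters equal to `α`, only the number of times each slot is hit matters. -/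
lemma tensorPowHom_word : ∀ (n : ℕ) (l : ℕ → ℕ), (∀ i < n, l i < m) →
    tensorPowHom α n ≫ word y u m n l =
      powers y u α m (fun j => (Finset.univ.filter fun i : Fin n => l i = j).card)
  | 0, l, _ => by
    change 𝟙 _ ≫ tensorPowHom u m = powers y u α m (fun _ => 0)
    rw [Category.id_comp, powers_const]
    rfl
  | n + 1, l, h => by
    have ih := tensorPowHom_word n (fun i => l (i + 1)) fun i hi => h (i + 1) (by omega)
    rw [tensorPowHom_succ]
    change (tensorPowHom α n ≫ el α (tensorPow E n)) ≫
      E ◁ word y u m n (fun i => l (i + 1)) ≫ slot y m (l 0) = _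
    rw [Category.assoc, el_naturality_assoc, reassoc_of% ih, powers_slot y u α m _ _ (h 0 (by omega))]
    congr 1
    funext j
    rw [Fin.card_filter_univ_succ]
    by_cases h0 : l 0 = j <;> simp [h0]

end Word

end Slots

/-! ### Symmetrisation over partitions. -/

namespace Slots

section Symmetrize

variable {C : Type u} [Category.{v} C] [MonoidalCategory C] [SymmetricCategory C]
  [Preadditive C] [MonoidalPreadditive C] {E A Q : C} {N n p : ℕ}

/-- The extension by zero of a labeling to the natural numbers. -/
def extendLabel (l : Fin N → Fin (n + 1)) (i : ℕ) : ℕ := if h : i < N then l ⟨i, h⟩ else 0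

lemma extendLabel_of_lt (l : Fin N → Fin (n + 1)) {i : ℕ} (h : i < N) :
    extendLabel l i = l ⟨i, h⟩ := dif_pos h

/-- The word of a labeling, followed by a morphism. -/
def labelHom (y : E ⊗ A ⟶ A) (u : 𝟙_ C ⟶ A) (q : tensorPow A (n + 1) ⟶ Q)
    (l : Fin N → Fin (n + 1)) : tensorPow E N ⟶ Q :=
  word y u (n + 1) N (extendLabel l) ≫ q

variable {y : E ⊗ A ⟶ A} {u : 𝟙_ C ⟶ A} {q : tensorPow A (n + 1) ⟶ Q}

/-- Adjacent transpositions generate the symmetric group, and each is absorbed by the symmetric `q`.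
So the word depends only on the partition, not on the names of its blocks. -/
lemma labelHom_perm_comp (hq : ∀ i, adjacentSwap A (n + 1) i ≫ q = q)
    (g : Equiv.Perm (Fin (n + 1))) (l : Fin N → Fin (n + 1)) :
    labelHom y u q (g ∘ l) = labelHom y u q l := by
  have hg : g ∈ Submonoid.closure
      (Set.range fun i : Fin n => Equiv.swap i.castSucc i.succ) := by
    rw [Equiv.Perm.mclosure_swap_castSucc_succ]
    trivial
  induction hg using Submonoid.closure_induction generalizing l with
  | one => rfl
  | mul a b _ _ ha hb => exact (ha (b ∘ l)).trans (hb l)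
  | mem x hx =>
    obtain ⟨i, rfl⟩ := hx
    unfold labelHom
    rw [← hq i, ← Category.assoc, ← Category.assoc, word_adjacentSwap y u _ _ (by omega),
      Category.assoc, hq]
    congr 1
    apply word_congr
    intro j hj
    rw [extendLabel_of_lt _ hj, extendLabel_of_lt _ hj]
    simp only [Function.comp_apply, Equiv.swap_apply_def, Fin.ext_iff]
    split_ifs <;> simp_all

lemma adjacentSwap_labelHom (h : ActComm y y) {j : ℕ} (hj : j + 1 < N)
    (l : Fin N → Fin (n + 1)) :
    adjacentSwap E N j ≫ labelHom y u q l =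
      labelHom y u q (l ∘ Equiv.swap ⟨j, by omega⟩ ⟨j + 1, hj⟩) := by
  unfold labelHom
  rw [← Category.assoc, adjacentSwap_word u _ h N j _ hj]
  congr 1
  apply word_congr
  intro i hi
  have hs : Equiv.swap j (j + 1) i < N := by
    rw [Equiv.swap_apply_def]
    split_ifs <;> omega
  rw [extendLabel_of_lt _ hi, extendLabel_of_lt _ hs]
  simp only [Function.comp_apply, Equiv.swap_apply_def, Fin.ext_iff]
  congr 2
  ext
  split_ifs <;> rfl

lemma tensorPowHom_labelHom (α : 𝟙_ C ⟶ E) (l : Labeling (Fin N) (n + 1) p) :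
    tensorPowHom α N ≫ labelHom y u q l.1 = tensorPowHom (power y u α p) (n + 1) ≫ q := by
  unfold labelHom
  rw [← Category.assoc, tensorPowHom_word, ← powers_const]
  · congr 1
    apply powers_congr
    intro j hj
    refine Eq.trans ?_ (l.2 ⟨j, hj⟩)
    congr 1
    ext i
    simp [extendLabel_of_lt _ i.2, Fin.ext_iff]
  · intro i hi
    rw [extendLabel_of_lt _ hi]
    exact Fin.is_lt _

/-- The morphism attached to a partition. -/
def partHom (y : E ⊗ A ⟶ A) (u : 𝟙_ C ⟶ A) (hq : ∀ i, adjacentSwap A (n + 1) i ≫ q = q)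
    (P : Labeling.Part (Fin N) (n + 1) p) : tensorPow E N ⟶ Q :=
  Quotient.lift (fun l : Labeling (Fin N) (n + 1) p => labelHom y u q l.1)
    (by
      rintro l l' ⟨g, hg⟩
      change labelHom y u q l.1 = labelHom y u q l'.1
      rw [← hg, labelHom_perm_comp hq]) P

/-- A transposition of letters permutes the partitions, hence the summands. -/
lemma adjacentSwap_sum_partHom (h : ActComm y y) (hq : ∀ i, adjacentSwap A (n + 1) i ≫ q = q)
    (j : ℕ) : adjacentSwap E N j ≫ ∑ P : Labeling.Part (Fin N) (n + 1) p, partHom y u hq P =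
      ∑ P : Labeling.Part (Fin N) (n + 1) p, partHom y u hq P := by
  by_cases hj : j + 1 < N
  · rw [Preadditive.comp_sum, ← Equiv.sum_comp
      (Labeling.partCongr (Equiv.swap (⟨j, by omega⟩ : Fin N) ⟨j + 1, hj⟩)) (partHom y u hq)]
    refine Finset.sum_congr rfl fun P _ => ?_
    obtain ⟨l, rfl⟩ := Quotient.exists_rep P
    exact adjacentSwap_labelHom h hj l.1
  · rw [adjacentSwap_of_le E (by omega), Category.id_comp]

lemma tensorPowHom_sum_partHom (α : 𝟙_ C ⟶ E)
    (hq : ∀ i, adjacentSwap A (n + 1) i ≫ q = q) :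
    tensorPowHom α N ≫ ∑ P : Labeling.Part (Fin N) (n + 1) p, partHom y u hq P =
      Fintype.card (Labeling.Part (Fin N) (n + 1) p) •
        (tensorPowHom (power y u α p) (n + 1) ≫ q) := by
  rw [Preadditive.comp_sum, Finset.sum_congr rfl (g := fun _ =>
    tensorPowHom (power y u α p) (n + 1) ≫ q), Finset.sum_const, Finset.card_univ]
  intro P _
  obtain ⟨l, rfl⟩ := Quotient.exists_rep P
  exact tensorPowHom_labelHom α l

end Symmetrize

/-- Every partition contributes the same value, and their number is `1` in `k`. A sum over labelings
would bring in an extra factor `(n + 1)!`, which may vanish in `k`. -/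
lemma symPowHom_mul_ne_zero (k : Type w) [Field k] {p : ℕ} [CharP k p] [Fact p.Prime]
    {C : Type u} [Category.{v} C] [MonoidalCategory C] [SymmetricCategory C] [Abelian C]
    [MonoidalPreadditive C] [Linear k C] {E A : C} {y : E ⊗ A ⟶ A} (h : ActComm y y)
    (u : 𝟙_ C ⟶ A) (α : 𝟙_ C ⟶ E) (n : ℕ)
    (hu : symPowHom (power y u α p) (n + 1) ≠ 0) : symPowHom α ((n + 1) * p) ≠ 0 := by
  obtain ⟨Q, q, hq, hne⟩ := (symPow.symPowHom_ne_zero_iff _ _).1 hu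
  refine (symPow.symPowHom_ne_zero_iff _ _).2
    ⟨Q, ∑ P : Labeling.Part (Fin ((n + 1) * p)) (n + 1) p, partHom y u hq P,
      adjacentSwap_sum_partHom h hq, ?_⟩
  rwa [tensorPowHom_sum_partHom, ← Nat.cast_smul_eq_nsmul k,
    Labeling.natCast_card_part k (n + 1), one_smul]

/-! ### The truncated symmetric algebra and the induction on powers of `p`. -/

section Trunc

variable {C : Type u} [Category.{v} C] [MonoidalCategory C] [SymmetricCategory C] [Abelian C]
  [MonoidalPreadditive C] [∀ X : C, PreservesFiniteColimits (tensorLeft X)]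

attribute [local instance] Abelian.hasFiniteBiproducts

/-- The direct sum of the symmetric powers of degree at most `p`. -/
abbrev trunc (E : C) (p : ℕ) : C := ⨁ fun i : Fin (p + 1) => symPow E i

/-- The projection to a symmetric power. -/
def truncπ (E : C) {p : ℕ} (i : ℕ) (h : i < p + 1) : trunc E p ⟶ symPow E i :=
  biproduct.π (fun i : Fin (p + 1) => symPow E i) ⟨i, h⟩

/-- The inclusion of the symmetric power of degree zero. -/
def truncι (E : C) (p : ℕ) : symPow E 0 ⟶ trunc E p :=
  biproduct.ι (fun i : Fin (p + 1) => symPow E i) ⟨0, by omega⟩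

lemma truncι_truncπ (E : C) (p : ℕ) : truncι E p ≫ truncπ E 0 (by omega) = 𝟙 _ :=
  biproduct.ι_π_self _ _

/-- The multiplication by elements of degree one. -/
def truncMul (E : C) (p : ℕ) : E ⊗ trunc E p ⟶ trunc E p :=
  biproduct.lift fun i => match i with
    | ⟨0, _⟩ => 0
    | ⟨i + 1, h⟩ => E ◁ truncπ E i (by omega) ≫ symPow.mul E i

lemma truncMul_truncπ_zero (E : C) (p : ℕ) : truncMul E p ≫ truncπ E 0 (by omega) = 0 :=
  biproduct.lift_π _ _

lemma truncMul_truncπ_succ (E : C) (p i : ℕ) (h : i + 1 < p + 1) :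
    truncMul E p ≫ truncπ E (i + 1) h = E ◁ truncπ E i (by omega) ≫ symPow.mul E i :=
  biproduct.lift_π _ _

/-- Two multiplications have no component in degrees `0` and `1`; in higher degrees this is
`symPow.mul_comm`. -/
lemma actComm_truncMul (E : C) (p : ℕ) : ActComm (truncMul E p) (truncMul E p) := by
  unfold ActComm
  apply biproduct.hom_ext
  rintro ⟨i, hi⟩
  change (_ ≫ _ ≫ _) ≫ truncπ E i hi = (_ ≫ _) ≫ truncπ E i hi
  simp only [Category.assoc]
  match i, hi with
  | 0, hi => rw [truncMul_truncπ_zero, comp_zero, comp_zero]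
  | 1, hi =>
    rw [truncMul_truncπ_succ, ← MonoidalCategory.whiskerLeft_comp_assoc, truncMul_truncπ_zero]
    simp
  | i + 2, hi =>
    rw [truncMul_truncπ_succ, ← MonoidalCategory.whiskerLeft_comp_assoc, truncMul_truncπ_succ,
      MonoidalCategory.whiskerLeft_comp_assoc, ← exch_naturality_right_assoc]
    have h := symPow.mul_comm E i
    simp only [exch, Category.assoc]
    rw [h]

lemma power_truncMul (E : C) (p : ℕ) (u : 𝟙_ C ⟶ trunc E p) (α : 𝟙_ C ⟶ E)
    (hu : u ≫ truncπ E 0 (by omega) = symPowHom α 0) : ∀ (i : ℕ) (h : i < p + 1),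
    power (truncMul E p) u α i ≫ truncπ E i h = symPowHom α i
  | 0, _ => hu
  | i + 1, h => by
    rw [power, Category.assoc, Category.assoc, truncMul_truncπ_succ, el_naturality_assoc,
      ← Category.assoc, power_truncMul E p u α hu i, symPow.symPowHom_succ, ← el_naturality_assoc,
      el, Category.assoc]

/-- Acting `p` times on the unit in degree zero gives a point whose component in degree `p` is `αᵖ`.
-/
lemma exists_power_ne_zero {E : C} {p : ℕ} (α : 𝟙_ C ⟶ E) (h : symPowHom α p ≠ 0) :
    ∃ u : 𝟙_ C ⟶ trunc E p, power (truncMul E p) u α p ≠ 0 := by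
  refine ⟨symPowHom α 0 ≫ truncι E p, fun h0 => h ?_⟩
  rw [← power_truncMul E p _ α ?_ p (by omega), h0, zero_comp]
  rw [Category.assoc, truncι_truncπ, Category.comp_id]

theorem symPowHom_ne_zero_of_prime (k : Type w) [Field k] {p : ℕ} [CharP k p] [Fact p.Prime]
    [Linear k C] (h : ∀ (X : C) (α : 𝟙_ C ⟶ X), α ≠ 0 → symPowHom α p ≠ 0)
    {X : C} (α : 𝟙_ C ⟶ X) (hα : α ≠ 0) (n : ℕ) : symPowHom α n ≠ 0 := by
  have hpow : ∀ (j : ℕ) (X : C) (α : 𝟙_ C ⟶ X), α ≠ 0 → symPowHom α (p ^ (j + 1)) ≠ 0 := by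
    intro j
    induction j with
    | zero =>
      rw [zero_add, pow_one]
      exact h
    | succ j ih =>
      intro X α hα
      obtain ⟨u, hu⟩ := exists_power_ne_zero α (h X α hα)
      obtain ⟨m, hm⟩ := Nat.exists_eq_succ_of_ne_zero
        (pow_ne_zero (j + 1) (Fact.out : p.Prime).ne_zero)
      -- The induction hypothesis is used for the new point of the truncated symmetric algebra, not
      -- for `α`.
      have := ih _ _ hu
      rw [pow_succ]
      rw [hm] at this ⊢
      exact symPowHom_mul_ne_zero k (actComm_truncMul X p) u α m this
  -- Vanishing passes to higher degrees, so it is enough to treat a power of `p` beyond `n`.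
  have hle : ∀ d, symPowHom α n = 0 → symPowHom α (n + d) = 0 := by
    intro d h0
    induction d with
    | zero => exact h0
    | succ d ih =>
      rw [← add_assoc, symPow.symPowHom_succ, ih]
      simp
  intro h0
  have hn : n ≤ p ^ (n + 1) :=
    (Nat.le_succ n).trans (Nat.lt_pow_self (Fact.out : p.Prime).one_lt).le
  obtain ⟨d, hd⟩ := Nat.exists_eq_add_of_le hn
  exact hpow n X α hα (hd ▸ hle d h0)

end Trunc

end Slots

theorem theorem3p5 (k : Type w) [Field k] (p : ℕ) [CharP k p] (hp : 0 < p)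
    (T : Type u) [Category.{v} T] [MonoidalCategory T] [SymmetricCategory T] [Abelian T]
    [Linear k T] [IsTensorCategory k T] :
    IsLocallySemisimple k T ↔
      ∀ (X : T) (α : 𝟙_ T ⟶ X), α ≠ 0 → symPowHom α p ≠ 0 := by
  have : Fact p.Prime := ⟨(CharP.char_is_prime_or_zero k p).resolve_right hp.ne'⟩
  have hT : IsLinearSymmetricMonoidal k T := inferInstance
  have := hT.toMonoidalPreadditive
  have := hT.rightExact_tensorLeft
  exact ⟨fun h X α hα => h.symPowHom_ne_zero k α hα p, fun h =>
    IsTensorCategory.isLocallySemisimple_of_symPowHom_ne_zero k fun X α n hα =>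
      Slots.symPowHom_ne_zero_of_prime k h α hα n⟩

end
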